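/- Let $K\ge 2$ be an integer and let $X$ be the rooted $K$-ary tree (vertices and edges, every vertex having exactly $K$ children, each edge an isometric copy of the unit interval), with root $0$; for $x\in X$ let $|x|$ be the length of the geodesic from $0$ to $x$ and let $d|x|$ be the measure that is Lebesgue measure on each edge. Let $\epsilon>0$, $p\ge 1$, $\beta,\lambda,\lambda_1,\lambda_2\in\mathbb R$ with $$p>\frac{\beta-\log K}{\epsilon}>0,\qquad \theta=1-\frac{\beta-\log K}{\epsilon p},\qquad \lambda_1+\lambda_2=\lambda ,$$ and suppose that either $p>1$, or $p=1$ and $\lambda_1\ge 0$. Put $\Phi(t)=t^p\log^{\lambda_1}(e+t)$ for $t\ge 0$, and $\Phi(\infty)=\infty$. For a measure $\mu$ and a measurable function $h$ write $\|h\|_{L^\Phi(\mu)}=\inf\{k>0:\int\Phi(|h|/k)\,d\mu\le 1\}$. *The space on $X$.* Let $d\mu_{\lambda_2}(x)=e^{-\beta|x|}(|x|+C)^{\lambda_2}\,d|x|$, where $C\ge\max\{2|\lambda_2|/(\beta-\log K),\,2(\log 4)/\epsilon\}$, and let $ds=e^{-\epsilon|x|}\,d|x|$. A Borel function $g:X\to[0,\infty]$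 is an upper gradient of $u:X\to\mathbb R$ if $|u(z)-u(y)|\le\int_{[y,z]}g\,ds$ for all $y,z\in X$, where $[y,z]$ is the geodesic from $y$ to $z$. The Orlicz–Sobolev space $N^{1,\Phi}(X,\mu_{\lambda_2})$ consists of all measurable $u$ for which $$\|u\|_{N^{1,\Phi}}=\|u\|_{L^\Phi(\mu_{\lambda_2})}+\inf_g\|g\|_{L^\Phi(\mu_{\lambda_2})}$$ is finite, the infimum being over all upper gradients $g$ of $u$. *The space on $\partial X$.* Let $\partial X$ be the set of infinite geodesics (rays) $\xi$ from $0$, with the metric $d(\xi,\zeta)=\frac2\epsilon e^{-\epsilon k}$ for $\xi\ne\zeta$, where $k$ is the level of the last common vertex of $\xi$ and $\zeta$. Let $Q=\log K/\epsilon$ and let $\nu$ be an Ahlfors $Q$-regular Borel measure on $\partial X$, i.e. $\nu(B(\xi,r))\approx r^Q$ uniformly in $\xi\in\partial X$ and $0<r\le 2/\epsilon=\operatorname{diam}\partial X$. For a vertex $x$ let $I_x$ be the set of rays through $x$; let $\mathscr Q_n=\{I_x:|x|=n\}$, and for $I=I_x\in\mathscr Q_n$, $n\ge1$, let $\widehat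 I=I_y$ with $y$ the mother of $x$. With $f_I=\nu(I)^{-1}\int_I f\,d\nu$, the Besov-type space $\mathcal B^{\theta,\lambda}_p(\partial X)$ consists of all $f\in L^p(\partial X,\nu)$ for which $$\|f\|_{\mathcal B^{\theta,\lambda}_p}=\|f\|_{L^p(\nu)}+\Big(\sum_{n=1}^\infty e^{\epsilon n\theta p}\,n^{\lambda}\sum_{I\in\mathscr Q_n}\nu(I)\,|f_I-f_{\widehat I}|^p\Big)^{1/p}$$ is finite. **Claim.** $\mathcal B^{\theta,\lambda}_p(\partial X)$ is the trace space of $N^{1,\Phi}(X,\mu_{\lambda_2})$: there are bounded linear operators $$T:N^{1,\Phi}(X,\mu_{\lambda_2})\to\mathcal B^{\theta,\lambda}_p(\partial X),\qquad E:\mathcal B^{\theta,\lambda}_p(\partial X)\to N^{1,\Phi}(X,\mu_{\lambda_2})$$ with $T\circ E=\mathrm{Id}$, where $T$ is the trace operator: for every $u\in N^{1,\Phi}(X,\mu_{\lambda_2})$ and $\nu$-almost every $\xi\in\partial X$, $u(x)\to Tu(\xi)$ as $x\to\xi$ along the ray $[0,\xi)$. Here an operator $A$ is bounded if $\|Aw\|\le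 c\,\|w\|$ for all $w$, with a finite constant $c$. -/

import Mathlib

open MeasureTheory Filter
open scoped ENNReal NNReal Topology

noncomputable section

namespace RegularTree

/-! ## The rooted `K`-ary tree and its boundary -/

/-- Vertices of the rooted `K`-ary tree are the finite words over `K` letters: the root is the empty
word, the `K` children of `v` are the words `v ++ [i]`, and the mother of a nonempty word `v` is
`v.dropLast`. The countable vertex set carries the discrete σ-algebra. -/
instance instMeasurableSpaceWord (K : ℕ) : MeasurableSpace (List (Fin K)) := ⊤

/-- The points of the rooted `K`-ary tree `X`, vertices and edges, with every edge an isometric copy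
of the unit interval. A point is a pair `(v, s)`, where `s = |x|` is the distance to the root and `v`
is the first vertex at or beyond the point (away from the root): so `([], 0)` is the root, and the
pairs `(v, s)` with `|v| - 1 < s ≤ |v|` are the points, other than the mother of `v`, on the edge
from the mother of `v` to `v`. -/
def treeSet (K : ℕ) : Set (List (Fin K) × ℝ) :=
  {x | 0 ≤ x.2 ∧ x.1.length = ⌈x.2⌉₊}

/-- The rooted `K`-ary tree. The induced σ-algebra (Borel on each of the countably many edges) is the
Borel σ-algebra of the tree. -/
abbrev Tree (K : ℕ) : Type := treeSet K

/-- `|x|`, the length of the geodesic from the root to `x`. -/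
def height {K : ℕ} (x : Tree K) : ℝ := x.1.2

/-- `x ≤ y`, that is, `x` lies on the geodesic from the root to `y`. -/
def Anc {K : ℕ} (x y : Tree K) : Prop := x.1.1 <+: y.1.1 ∧ height x ≤ height y

/-- The geodesic `[y, z]`: the points of `[0, y] ∪ [0, z]` that lie beyond all common ancestors
of `y` and `z`. -/
def geodesic {K : ℕ} (y z : Tree K) : Set (Tree K) :=
  {x | (Anc x y ∨ Anc x z) ∧ ∀ w, Anc w y → Anc w z → Anc w x}

/-- The natural measure `d|x|`, Lebesgue measure on every edge. -/
def lengthMeasure (K : ℕ) : Measure (Tree K) :=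
  (Measure.count.prod volume).comap Subtype.val

/-- The arc length measure `ds = e^{-ε|x|} d|x|` of the metric
`d_X(x, y) = ∫_{[x, y]} e^{-ε|z|} d|z|`. -/
def arcLength (K : ℕ) (ε : ℝ) : Measure (Tree K) :=
  (lengthMeasure K).withDensity fun x => ENNReal.ofReal (Real.exp (-ε * height x))

/-- The weighted measure `dμ = e^{-β|x|} (|x| + C)^l d|x|`. -/
def weightedMeasure (K : ℕ) (β C l : ℝ) : Measure (Tree K) :=
  (lengthMeasure K).withDensity fun x =>
    ENNReal.ofReal (Real.exp (-β * height x) * (height x + C) ^ l)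

/-- The boundary `∂X`: infinite geodesics from the root, that is, infinite words; `ξ n` is the
letter by which the `(n+1)`-st vertex extends the `n`-th one. The σ-algebra is the product one,
which is the Borel σ-algebra of the metric `boundaryDist`. -/
abbrev Boundary (K : ℕ) : Type := ℕ → Fin K

/-- The `n`-th vertex of the ray `ξ`. -/
def rayVertex {K : ℕ} (ξ : Boundary K) (n : ℕ) : List (Fin K) :=
  List.ofFn fun i : Fin n => ξ i

/-- The point at height `s` on the ray `[0, ξ)`. -/
def rayPoint {K : ℕ} (ξ : Boundary K) (s : ℝ≥0) : Tree K :=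
  ⟨(rayVertex ξ ⌈(s : ℝ)⌉₊, (s : ℝ)), s.2, by simp [rayVertex]⟩

/-- The metric of `∂X`: `(2/ε) e^{-εk}`, where `k` is the level of the last common vertex. -/
def boundaryDist {K : ℕ} (ε : ℝ) (ξ ζ : Boundary K) : ℝ :=
  open Classical in
  if ξ = ζ then 0 else 2 / ε * Real.exp (-ε * (PiNat.firstDiff ξ ζ : ℝ))

/-- Ahlfors `Q`-regularity of `ν`: `ν(B(ξ, r)) ≈ r^Q` for `0 < r ≤ diam ∂X = 2/ε`. -/
def IsAhlforsRegular {K : ℕ} (ε Q : ℝ) (ν : Measure (Boundary K)) : Prop :=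
  ∃ a b : ℝ, 0 < a ∧ 0 < b ∧ ∀ (ξ : Boundary K) (r : ℝ), 0 < r → r ≤ 2 / ε →
    ENNReal.ofReal (a * r ^ Q) ≤ ν {ζ | boundaryDist ε ζ ξ < r} ∧
      ν {ζ | boundaryDist ε ζ ξ < r} ≤ ENNReal.ofReal (b * r ^ Q)

/-- The dyadic element `I_v` of `∂X`: the rays passing through the vertex `v`. -/
def cyl {K : ℕ} (v : List (Fin K)) : Set (Boundary K) :=
  {ξ | rayVertex ξ v.length = v}

/-! ## Orlicz spaces -/

/-- `Φ(t) = t^p log^{l₁}(e + t)` for `t ≥ 0`. -/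
def Phi (p l₁ t : ℝ) : ℝ := t ^ p * Real.log (Real.exp 1 + t) ^ l₁

/-- `Φ` on `[0, ∞]`, with `Φ(∞) = ∞`. -/
def PhiE (p l₁ : ℝ) (t : ℝ≥0∞) : ℝ≥0∞ :=
  if t = ⊤ then ⊤ else ENNReal.ofReal (Phi p l₁ t.toReal)

/-- The range of parameters: `p > 1` and `l₁ ∈ ℝ`, or `p = 1` and `l₁ ≥ 0`. -/
def Admissible (p l₁ : ℝ) : Prop := 1 < p ∨ (p = 1 ∧ 0 ≤ l₁)

/-- The Luxemburg norm `inf {k > 0 : ∫ φ(h / k) dμ ≤ 1}` of `h ≥ 0`, with `inf ∅ = ∞`. -/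
def luxemburg {α : Type*} [MeasurableSpace α] (φ : ℝ≥0∞ → ℝ≥0∞) (μ : Measure α)
    (h : α → ℝ≥0∞) : ℝ≥0∞ :=
  ⨅ (k : ℝ≥0) (_ : 0 < k) (_ : ∫⁻ x, φ (h x / k) ∂μ ≤ 1), (k : ℝ≥0∞)

/-! ## The Orlicz–Sobolev space -/

/-- `g : X → [0, ∞]` is an upper gradient of `u`. -/
def IsUpperGradient {K : ℕ} (ε : ℝ) (g : Tree K → ℝ≥0∞) (u : Tree K → ℝ) : Prop :=
  Measurable g ∧
    ∀ y z : Tree K, ENNReal.ofReal |u z - u y| ≤ ∫⁻ x in geodesic y z, g x ∂(arcLength K ε)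

/-- The norm of `N^{1,Φ}(X, μ)`, with value `∞` outside of the space. -/
def sobolevNorm {K : ℕ} (ε p l₁ : ℝ) (μ : Measure (Tree K)) (u : Tree K → ℝ) : ℝ≥0∞ :=
  luxemburg (PhiE p l₁) μ (fun x => ‖u x‖ₑ) +
    ⨅ (g : Tree K → ℝ≥0∞) (_ : IsUpperGradient ε g u), luxemburg (PhiE p l₁) μ g

section aux

lemma Phi_zero {p l₁ : ℝ} (h : Admissible p l₁) : Phi p l₁ 0 = 0 := by
  have : p ≠ 0 := by rcases h with h | h <;> linarith [h]
  simp [Phi, Real.zero_rpow this]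

lemma Phi_nonneg {p l₁ t : ℝ} (ht : 0 ≤ t) : 0 ≤ Phi p l₁ t := by
  have : 0 ≤ Real.log (Real.exp 1 + t) :=
    Real.log_nonneg (by linarith [Real.add_one_le_exp (1 : ℝ)])
  unfold Phi
  positivity

lemma one_le_L {t : ℝ} (ht : 0 ≤ t) : 1 ≤ Real.log (Real.exp 1 + t) := by
  rw [Real.le_log_iff_exp_le (by positivity)]
  linarith

/-- `Φ(t) / t` is increasing up to a constant. -/
lemma exists_ratio {p l₁ : ℝ} (h : Admissible p l₁) :
    ∃ D : ℝ, 0 < D ∧ ∀ s t : ℝ, 0 < s → s ≤ t → Phi p l₁ s * t ≤ D * (Phi p l₁ t * s) := by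
  have key : ∃ D : ℝ, 0 < D ∧ ∀ s t : ℝ, 0 < s → s ≤ t →
      s ^ (p - 1) * Real.log (Real.exp 1 + s) ^ l₁ ≤
        D * (t ^ (p - 1) * Real.log (Real.exp 1 + t) ^ l₁) := by
    have hp : 0 ≤ p - 1 := by rcases h with h | h <;> linarith [h]
    rcases le_or_gt 0 l₁ with hl | hl
    · refine ⟨1, one_pos, fun s t hs hst => ?_⟩
      have h1 := one_le_L hs.le
      have h3 : Real.log (Real.exp 1 + s) ≤ Real.log (Real.exp 1 + t) :=
        Real.log_le_log (by positivity) (by linarith)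
      have ht : 0 < t := hs.trans_le hst
      rw [one_mul]
      gcongr
    · have hp1 : 0 < p - 1 := by rcases h with h | h <;> linarith [h]
      set a : ℝ := (p - 1) / (-l₁) with ha
      have hapos : 0 < a := div_pos hp1 (by linarith)
      refine ⟨(1 + 1 / a) ^ (-l₁), by positivity, fun s t hs hst => ?_⟩
      have ht : 0 < t := hs.trans_le hst
      have h1 := one_le_L hs.le
      have h2 := one_le_L ht.le
      set A := Real.log (Real.exp 1 + s) with hA
      set B := Real.log (Real.exp 1 + t) with hB
      have hr : 1 ≤ t / s := by rw [le_div_iff₀ hs]; linarith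
      have hr0 : 0 < t / s := by positivity
      have hlog : Real.log (t / s) ≤ (t / s) ^ a / a := Real.log_le_rpow_div hr0.le hapos
      have hra : 1 ≤ (t / s) ^ a := Real.one_le_rpow hr hapos.le
      have hBA : B ≤ Real.log (t / s) + A := by
        rw [hA, hB, ← Real.log_mul hr0.ne' (by positivity)]
        apply Real.log_le_log (by positivity)
        have : t / s * (Real.exp 1 + s) = t / s * Real.exp 1 + t := by field_simp
        rw [this]
        nlinarith [Real.exp_pos 1]
      have hlog0 : 0 ≤ Real.log (t / s) := Real.log_nonneg hr
      have hB2 : B ≤ A * ((1 + 1 / a) * (t / s) ^ a) := by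
        have e1 : B ≤ A * (1 + Real.log (t / s)) := by nlinarith
        refine e1.trans (mul_le_mul_of_nonneg_left ?_ (by linarith))
        have : (1 + 1 / a) * (t / s) ^ a = (t / s) ^ a + (t / s) ^ a / a := by ring
        rw [this]
        linarith
      have hA0 : 0 < A := by linarith
      have hB0 : 0 < B := by linarith
      have hpow : B ^ (-l₁) ≤ A ^ (-l₁) * ((1 + 1 / a) ^ (-l₁) * (t / s) ^ (p - 1)) := by
        have e2 : B ^ (-l₁) ≤ (A * ((1 + 1 / a) * (t / s) ^ a)) ^ (-l₁) :=
          Real.rpow_le_rpow hB0.le hB2 (by linarith)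
        rw [Real.mul_rpow hA0.le (by positivity), Real.mul_rpow (by positivity) (by positivity),
          ← Real.rpow_mul hr0.le] at e2
        have : a * (-l₁) = p - 1 := by
          rw [ha]
          exact div_mul_cancel₀ _ (by linarith)
        rwa [this] at e2
      have hAi : A ^ l₁ = (A ^ (-l₁))⁻¹ := by rw [Real.rpow_neg hA0.le, inv_inv]
      have hBi : B ^ l₁ = (B ^ (-l₁))⁻¹ := by rw [Real.rpow_neg hB0.le, inv_inv]
      rw [Real.div_rpow ht.le hs.le] at hpow
      have hsp : 0 < s ^ (p - 1) := by positivity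
      have htp : 0 < t ^ (p - 1) := by positivity
      have hAp : 0 < A ^ (-l₁) := by positivity
      have hBp : 0 < B ^ (-l₁) := by positivity
      rw [hAi, hBi, ← div_eq_mul_inv, ← div_eq_mul_inv, ← mul_div_assoc, div_le_div_iff₀ hAp hBp]
      calc s ^ (p - 1) * B ^ (-l₁)
          ≤ s ^ (p - 1) * (A ^ (-l₁) * ((1 + 1 / a) ^ (-l₁) * (t ^ (p - 1) / s ^ (p - 1)))) := by
            gcongr
        _ = (1 + 1 / a) ^ (-l₁) * t ^ (p - 1) * A ^ (-l₁) := by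
            field_simp
  obtain ⟨D, hD, H⟩ := key
  refine ⟨D, hD, fun s t hs hst => ?_⟩
  have ht : 0 < t := hs.trans_le hst
  have hs' : s ^ p = s ^ (p - 1) * s := by
    rw [← Real.rpow_add_one hs.ne']; simp
  have ht' : t ^ p = t ^ (p - 1) * t := by
    rw [← Real.rpow_add_one ht.ne']; simp
  have := mul_le_mul_of_nonneg_right (H s t hs hst) (mul_pos hs ht).le
  unfold Phi
  rw [hs', ht']
  nlinarith [this]

lemma exists_PhiE_le {p l₁ : ℝ} (h : Admissible p l₁) :
    ∃ c : ℝ≥0, 1 ≤ c ∧ ∀ s t : ℝ≥0∞, c * s ≤ t → PhiE p l₁ s ≤ 2⁻¹ * PhiE p l₁ t := by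
  obtain ⟨D, hD, H⟩ := exists_ratio h
  refine ⟨max 1 (2 * D).toNNReal, le_max_left _ _, fun s t hst => ?_⟩
  set c : ℝ≥0 := max 1 (2 * D).toNNReal with hc
  have hc1 : 1 ≤ c := le_max_left _ _
  have hcD : 2 * D ≤ (c : ℝ) := by
    have : (2 * D).toNNReal ≤ c := le_max_right _ _
    exact Real.toNNReal_le_iff_le_coe.1 this
  have hle : s ≤ t := by
    refine le_trans ?_ hst
    calc s = ((1 : ℝ≥0) : ℝ≥0∞) * s := by simp
      _ ≤ c * s := by gcongr
  rcases eq_or_ne t ⊤ with rfl | ht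
  · have : (2⁻¹ : ℝ≥0∞) * PhiE p l₁ ⊤ = ⊤ := by
      simp only [PhiE, if_true]
      exact ENNReal.mul_top (by simp)
    rw [this]; exact le_top
  have hs : s ≠ ⊤ := ne_top_of_le_ne_top ht hle
  rcases eq_or_ne s 0 with rfl | hs0
  · simp [PhiE, Phi_zero h]
  have hspos : 0 < s.toReal := ENNReal.toReal_pos hs0 hs
  have hleR : s.toReal ≤ t.toReal := ENNReal.toReal_mono ht hle
  have hcR : (c : ℝ) * s.toReal ≤ t.toReal := by
    have := ENNReal.toReal_mono ht hst
    simpa using this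
  have htpos : 0 < t.toReal := hspos.trans_le hleR
  have h1 := H _ _ hspos hleR
  have hPt : 0 ≤ Phi p l₁ t.toReal := Phi_nonneg htpos.le
  have h2 : Phi p l₁ s.toReal ≤ 2⁻¹ * Phi p l₁ t.toReal := by
    have h3 : 2 * D * s.toReal ≤ t.toReal :=
      (mul_le_mul_of_nonneg_right hcD hspos.le).trans hcR
    have h4 : Phi p l₁ s.toReal * t.toReal ≤ (2⁻¹ * Phi p l₁ t.toReal) * t.toReal := by
      nlinarith [mul_le_mul_of_nonneg_left h3 hPt]
    exact le_of_mul_le_mul_right h4 htpos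
  have h5 : (2⁻¹ : ℝ≥0∞) = ENNReal.ofReal 2⁻¹ := by
    rw [ENNReal.ofReal_inv_of_pos (by norm_num)]; simp
  simp only [PhiE, if_neg hs, if_neg ht]
  rw [h5, ← ENNReal.ofReal_mul (by norm_num)]
  exact ENNReal.ofReal_le_ofReal h2

lemma measurable_PhiE (p l₁ : ℝ) : Measurable (PhiE p l₁) := by
  unfold PhiE
  refine Measurable.ite (measurableSet_singleton _) measurable_const ?_
  refine ENNReal.measurable_ofReal.comp ?_
  have : Measurable (Phi p l₁) := by
    unfold Phi
    fun_prop
  exact this.comp ENNReal.measurable_toReal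

lemma luxemburg_lt_top_iff {α : Type*} [MeasurableSpace α] {φ : ℝ≥0∞ → ℝ≥0∞} {μ : Measure α}
    {h : α → ℝ≥0∞} :
    luxemburg φ μ h < ⊤ ↔ ∃ k : ℝ≥0, 0 < k ∧ ∫⁻ x, φ (h x / k) ∂μ ≤ 1 := by
  simp [luxemburg, iInf_lt_iff]

lemma luxemburg_lt_top_add {α : Type*} [MeasurableSpace α] {p l₁ : ℝ} (hΦ : Admissible p l₁)
    {μ : Measure α} {a b w : α → ℝ≥0∞} (ham : Measurable a)
    (ha : luxemburg (PhiE p l₁) μ a < ⊤) (hb : luxemburg (PhiE p l₁) μ b < ⊤)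
    (hw : ∀ x, w x ≤ a x + b x) : luxemburg (PhiE p l₁) μ w < ⊤ := by
  rw [luxemburg_lt_top_iff] at *
  obtain ⟨k, hk, hak⟩ := ha
  obtain ⟨l, hl, hbl⟩ := hb
  obtain ⟨c, hc, H⟩ := exists_PhiE_le hΦ
  have hc0 : c ≠ 0 := (zero_lt_one.trans_le hc).ne'
  have hm0 : max k l ≠ 0 := (hk.trans_le (le_max_left _ _)).ne'
  refine ⟨2 * c * max k l, by positivity, ?_⟩
  have aux : ∀ (z y : ℝ≥0∞) (j : ℝ≥0), j ≤ max k l → z ≤ 2 * y →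
      (c : ℝ≥0∞) * (z / ((2 * c * max k l : ℝ≥0) : ℝ≥0∞)) ≤ y / j := by
    intro z y j hj hz
    calc (c : ℝ≥0∞) * (z / ((2 * c * max k l : ℝ≥0) : ℝ≥0∞))
        ≤ c * ((2 * y) / ((2 * c * max k l : ℝ≥0) : ℝ≥0∞)) := by gcongr
      _ = (2 * c * y) / (2 * c * (max k l : ℝ≥0)) := by
          rw [← mul_div_assoc]; push_cast; congr 1; ring
      _ = y / (max k l : ℝ≥0) := by
          apply ENNReal.mul_div_mul_left
          · simp [hc0]
          · exact ENNReal.mul_ne_top (by simp) (by simp)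
      _ ≤ y / j := by gcongr
  have pt : ∀ x, PhiE p l₁ (w x / ((2 * c * max k l : ℝ≥0) : ℝ≥0∞)) ≤
      2⁻¹ * PhiE p l₁ (a x / k) + 2⁻¹ * PhiE p l₁ (b x / l) := by
    intro x
    rcases le_total (a x) (b x) with hx | hx
    · refine (H _ (b x / l) (aux _ _ _ (le_max_right _ _) ?_)).trans le_add_self
      rw [two_mul]; exact (hw x).trans (by gcongr)
    · refine (H _ (a x / k) (aux _ _ _ (le_max_left _ _) ?_)).trans le_self_add
      rw [two_mul]; exact (hw x).trans (by gcongr)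
  have hma : Measurable fun x => PhiE p l₁ (a x / k) :=
    (measurable_PhiE p l₁).comp (ham.div_const _)
  calc ∫⁻ x, PhiE p l₁ (w x / ((2 * c * max k l : ℝ≥0) : ℝ≥0∞)) ∂μ
      ≤ ∫⁻ x, (2⁻¹ * PhiE p l₁ (a x / k) + 2⁻¹ * PhiE p l₁ (b x / l)) ∂μ := lintegral_mono pt
    _ = 2⁻¹ * ∫⁻ x, PhiE p l₁ (a x / k) ∂μ + 2⁻¹ * ∫⁻ x, PhiE p l₁ (b x / l) ∂μ := by
        rw [lintegral_add_left (hma.const_mul _), lintegral_const_mul _ hma,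
          lintegral_const_mul' _ _ (by simp)]
    _ ≤ 2⁻¹ * 1 + 2⁻¹ * 1 := by gcongr
    _ = 1 := by simp [ENNReal.inv_two_add_inv_two]

lemma luxemburg_lt_top_smul {α : Type*} [MeasurableSpace α] {p l₁ : ℝ} (hΦ : Admissible p l₁)
    {μ : Measure α} {a : α → ℝ≥0∞} (ha : luxemburg (PhiE p l₁) μ a < ⊤) (r : ℝ≥0) :
    luxemburg (PhiE p l₁) μ (fun x => r * a x) < ⊤ := by
  rw [luxemburg_lt_top_iff] at *
  obtain ⟨k, hk, hak⟩ := ha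
  rcases eq_or_ne r 0 with rfl | hr
  · exact ⟨1, one_pos, by simp [PhiE, Phi_zero hΦ]⟩
  · refine ⟨r * k, by positivity, ?_⟩
    have : ∀ x, (r : ℝ≥0∞) * a x / ((r * k : ℝ≥0) : ℝ≥0∞) = a x / k := by
      intro x
      push_cast
      exact ENNReal.mul_div_mul_left _ _ (by simp [hr]) (by simp)
    simpa only [this] using hak

lemma sobolevNorm_lt_top_iff {K : ℕ} {ε p l₁ : ℝ} {μ : Measure (Tree K)} {u : Tree K → ℝ} :
    sobolevNorm ε p l₁ μ u < ⊤ ↔ luxemburg (PhiE p l₁) μ (fun x => ‖u x‖ₑ) < ⊤ ∧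
      ∃ g, IsUpperGradient ε g u ∧ luxemburg (PhiE p l₁) μ g < ⊤ := by
  simp [sobolevNorm, ENNReal.add_lt_top, iInf_lt_iff]

lemma IsUpperGradient.add {K : ℕ} {ε : ℝ} {g h : Tree K → ℝ≥0∞} {u v : Tree K → ℝ}
    (hg : IsUpperGradient ε g u) (hh : IsUpperGradient ε h v) :
    IsUpperGradient ε (fun x => g x + h x) (u + v) := by
  refine ⟨hg.1.add hh.1, fun y z => ?_⟩
  rw [lintegral_add_left hg.1]
  refine le_trans ?_ (add_le_add (hg.2 y z) (hh.2 y z))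
  rw [← ENNReal.ofReal_add (abs_nonneg _) (abs_nonneg _)]
  apply ENNReal.ofReal_le_ofReal
  have : (u + v) z - (u + v) y = (u z - u y) + (v z - v y) := by simp only [Pi.add_apply]; ring
  rw [this]
  exact abs_add_le _ _

lemma IsUpperGradient.smul {K : ℕ} {ε : ℝ} {g : Tree K → ℝ≥0∞} {u : Tree K → ℝ}
    (hg : IsUpperGradient ε g u) (c : ℝ) :
    IsUpperGradient ε (fun x => (‖c‖₊ : ℝ≥0∞) * g x) (c • u) := by
  refine ⟨hg.1.const_mul _, fun y z => ?_⟩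
  rw [lintegral_const_mul _ hg.1]
  refine le_trans (le_of_eq ?_) (mul_le_mul_right (hg.2 y z) _)
  have : (c • u) z - (c • u) y = c * (u z - u y) := by
    simp only [Pi.smul_apply, smul_eq_mul]; ring
  rw [this, abs_mul, ENNReal.ofReal_mul (abs_nonneg _)]
  congr 1
  exact (Real.enorm_eq_ofReal_abs c).symm

end aux

/-- The Orlicz–Sobolev space `N^{1,Φ}(X, μ)` of all measurable `u` with finite norm. For the
measures `weightedMeasure` such functions are continuous, so that no two of them agree almost
everywhere unless they are equal. -/
def sobolevSpace {K : ℕ} (ε : ℝ) {p l₁ : ℝ} (hΦ : Admissible p l₁) (μ : Measure (Tree K)) :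
    Submodule ℝ (Tree K → ℝ) where
  carrier := {u | Measurable u ∧ sobolevNorm ε p l₁ μ u < ⊤}
  zero_mem' := by
    refine ⟨measurable_const, sobolevNorm_lt_top_iff.2 ⟨?_, fun _ => 0, ?_, ?_⟩⟩
    · exact luxemburg_lt_top_iff.2 ⟨1, one_pos, by simp [PhiE, Phi_zero hΦ]⟩
    · exact ⟨measurable_const, by simp⟩
    · exact luxemburg_lt_top_iff.2 ⟨1, one_pos, by simp [PhiE, Phi_zero hΦ]⟩
  add_mem' := by
    rintro u v ⟨hu, hu'⟩ ⟨hv, hv'⟩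
    obtain ⟨hu1, g, hg, hg1⟩ := sobolevNorm_lt_top_iff.1 hu'
    obtain ⟨hv1, h, hh, hh1⟩ := sobolevNorm_lt_top_iff.1 hv'
    exact ⟨hu.add hv, sobolevNorm_lt_top_iff.2
      ⟨luxemburg_lt_top_add hΦ hu.enorm hu1 hv1 fun x => enorm_add_le _ _,
        _, hg.add hh, luxemburg_lt_top_add hΦ hg.1 hg1 hh1 fun x => le_rfl⟩⟩
  smul_mem' := by
    rintro c u ⟨hu, hu'⟩
    obtain ⟨hu1, g, hg, hg1⟩ := sobolevNorm_lt_top_iff.1 hu'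
    refine ⟨hu.const_smul c, sobolevNorm_lt_top_iff.2
      ⟨?_, _, hg.smul c, luxemburg_lt_top_smul hΦ hg1 _⟩⟩
    have := luxemburg_lt_top_smul hΦ hu1 ‖c‖₊
    have e : (fun x => ‖(c • u) x‖ₑ) = fun x => (‖c‖₊ : ℝ≥0∞) * ‖u x‖ₑ := by
      funext x
      simp only [Pi.smul_apply, enorm_smul]
      rfl
    rwa [e]

/-! ## The Besov-type space -/

/-- The `p`-th power of the dyadic seminorm, `∑_{n ≥ 1} e^{εnθp} n^l ∑_{I ∈ Q_n} ν(I) |f_I - f_Î|^p`;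
here `Q_n` consists of the sets `I_v` for the `K^n` vertices `v` of level `n`, and `Î_v` belongs to
the mother of `v`. -/
def besovEnergy {K : ℕ} (ε θ p l : ℝ) (ν : Measure (Boundary K)) (f : Boundary K → ℝ) : ℝ≥0∞ :=
  ∑' m : ℕ, ENNReal.ofReal (Real.exp (ε * ((m + 1 : ℕ) : ℝ) * θ * p) * ((m + 1 : ℕ) : ℝ) ^ l) *
    ∑ v : Fin (m + 1) → Fin K, ν (cyl (List.ofFn v)) *
      ‖(⨍ ξ in cyl (List.ofFn v), f ξ ∂ν) - ⨍ ξ in cyl (List.ofFn v).dropLast, f ξ ∂ν‖ₑ ^ p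

/-- The norm of the Besov-type space, with value `∞` outside of the space. -/
def besovNorm {K : ℕ} (ε θ p l : ℝ) (ν : Measure (Boundary K))
    (f : Lp ℝ (ENNReal.ofReal p) ν) : ℝ≥0∞ :=
  ‖f‖ₑ + besovEnergy ε θ p l ν f ^ (1 / p)

section aux

lemma besovEnergy_congr {K : ℕ} {ε θ p l : ℝ} {ν : Measure (Boundary K)} {f g : Boundary K → ℝ}
    (h : f =ᵐ[ν] g) : besovEnergy ε θ p l ν f = besovEnergy ε θ p l ν g := by
  have : ∀ s : Set (Boundary K), (⨍ ξ in s, f ξ ∂ν) = ⨍ ξ in s, g ξ ∂ν := fun s =>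
    average_congr (ae_restrict_of_ae h)
  simp only [besovEnergy, this]

lemma besovNorm_lt_top_iff {K : ℕ} {ε θ p l : ℝ} (hp : 1 ≤ p) {ν : Measure (Boundary K)}
    {f : Lp ℝ (ENNReal.ofReal p) ν} :
    besovNorm ε θ p l ν f < ⊤ ↔ besovEnergy ε θ p l ν f < ⊤ := by
  have hp' : 0 < 1 / p := by positivity
  rw [besovNorm, ENNReal.add_lt_top, ENNReal.rpow_lt_top_iff_of_pos hp']
  have : ‖f‖ₑ < ⊤ := by
    rw [Lp.enorm_def]
    exact (Lp.memLp f).2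
  tauto

lemma besovEnergy_add_le {K : ℕ} {ε θ p l : ℝ} (hp : 1 ≤ p) {ν : Measure (Boundary K)}
    {f g : Boundary K → ℝ} (hf : Integrable f ν) (hg : Integrable g ν) :
    besovEnergy ε θ p l ν (f + g) ≤
      2 ^ (p - 1) * (besovEnergy ε θ p l ν f + besovEnergy ε θ p l ν g) := by
  have avg : ∀ s : Set (Boundary K), (⨍ ξ in s, (f + g) ξ ∂ν) =
      (⨍ ξ in s, f ξ ∂ν) + ⨍ ξ in s, g ξ ∂ν := by
    intro s
    simp only [setAverage_eq, Pi.add_apply]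
    rw [integral_add hf.integrableOn hg.integrableOn, smul_add]
  simp only [besovEnergy, avg]
  rw [← ENNReal.tsum_add, ← ENNReal.tsum_mul_left]
  refine ENNReal.tsum_le_tsum fun m => ?_
  rw [← mul_add, mul_left_comm]
  refine mul_le_mul_right ?_ _
  rw [← Finset.sum_add_distrib, Finset.mul_sum]
  refine Finset.sum_le_sum fun v _ => ?_
  rw [← mul_add, mul_left_comm]
  refine mul_le_mul_right ?_ _
  refine le_trans ?_ (ENNReal.rpow_add_le_mul_rpow_add_rpow _ _ hp)
  refine ENNReal.rpow_le_rpow ?_ (by linarith)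
  rw [add_sub_add_comm]
  exact enorm_add_le _ _

lemma besovEnergy_smul {K : ℕ} {ε θ p l : ℝ} (hp : 1 ≤ p) {ν : Measure (Boundary K)} (c : ℝ)
    (f : Boundary K → ℝ) :
    besovEnergy ε θ p l ν (c • f) = ‖c‖ₑ ^ p * besovEnergy ε θ p l ν f := by
  have avg : ∀ s : Set (Boundary K), (⨍ ξ in s, (c • f) ξ ∂ν) = c * ⨍ ξ in s, f ξ ∂ν := by
    intro s
    simp only [setAverage_eq, Pi.smul_apply, smul_eq_mul, integral_const_mul]
    ring
  simp only [besovEnergy, avg, ← mul_sub, enorm_mul,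
    ENNReal.mul_rpow_of_nonneg _ _ (by linarith : (0 : ℝ) ≤ p)]
  rw [← ENNReal.tsum_mul_left]
  refine tsum_congr fun m => ?_
  rw [mul_left_comm, Finset.mul_sum _ _ (‖c‖ₑ ^ p)]
  congr 1
  refine Finset.sum_congr rfl fun v _ => ?_
  rw [mul_left_comm]

lemma integrable_of_Lp {K : ℕ} {p : ℝ} (hp : 1 ≤ p) {ν : Measure (Boundary K)} [IsFiniteMeasure ν]
    (f : Lp ℝ (ENNReal.ofReal p) ν) : Integrable f ν :=
  (Lp.memLp f).integrable (by simpa using hp)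

end aux

/-- The Besov-type space of all `f ∈ L^p(∂X)` whose dyadic energy is finite. -/
def besovSpace {K : ℕ} (ε θ : ℝ) {p : ℝ} (hp : 1 ≤ p) (l : ℝ) (ν : Measure (Boundary K))
    [IsFiniteMeasure ν] : Submodule ℝ (Lp ℝ (ENNReal.ofReal p) ν) where
  carrier := {f | besovNorm ε θ p l ν f < ⊤}
  zero_mem' := by
    refine (besovNorm_lt_top_iff hp).2 ?_
    rw [besovEnergy_congr (Lp.coeFn_zero ℝ (ENNReal.ofReal p) ν)]
    have h0 : (0 : ℝ) < p := by linarith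
    have : besovEnergy ε θ p l ν (0 : Boundary K → ℝ) = 0 := by
      simp [besovEnergy, h0]
    rw [this]
    exact ENNReal.zero_lt_top
  add_mem' := by
    intro f g hf hg
    have hf' := (besovNorm_lt_top_iff hp).1 hf
    have hg' := (besovNorm_lt_top_iff hp).1 hg
    refine (besovNorm_lt_top_iff hp).2 ?_
    rw [besovEnergy_congr (Lp.coeFn_add f g)]
    refine (besovEnergy_add_le hp (integrable_of_Lp hp f) (integrable_of_Lp hp g)).trans_lt ?_
    exact ENNReal.mul_lt_top (ENNReal.rpow_lt_top_of_nonneg (by linarith) (by simp))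
      (ENNReal.add_lt_top.2 ⟨hf', hg'⟩)
  smul_mem' := by
    intro c f hf
    have hf' := (besovNorm_lt_top_iff hp).1 hf
    refine (besovNorm_lt_top_iff hp).2 ?_
    rw [besovEnergy_congr (Lp.coeFn_smul c f), besovEnergy_smul hp]
    exact ENNReal.mul_lt_top (ENNReal.rpow_lt_top_of_nonneg (by linarith) (by simp)) hf'

/-! ## Trace spaces -/

/-- The space `B` of (classes of) functions on `∂X`, normed by `normB`, is a trace space of the
space `Y` of functions on `X`, normed by `normY`: there are bounded linear operators `T : Y → B` and
`E : B → Y` with `T ∘ E = id`, where `T` is the trace operator, `T u (ξ)` being the limit of `u`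
along the ray `[0, ξ)` for almost every `ξ`. -/
def IsTraceSpace {K : ℕ} {ν : Measure (Boundary K)} {q : ℝ≥0∞}
    (B : Submodule ℝ (Lp ℝ q ν)) (normB : Lp ℝ q ν → ℝ≥0∞)
    (Y : Submodule ℝ (Tree K → ℝ)) (normY : (Tree K → ℝ) → ℝ≥0∞) : Prop :=
  ∃ (T : Y →ₗ[ℝ] B) (E : B →ₗ[ℝ] Y),
    (∃ c : ℝ≥0, ∀ u : Y, normB (T u) ≤ c * normY u) ∧
    (∃ c : ℝ≥0, ∀ f : B, normY (E f) ≤ c * normB f) ∧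
    (∀ f : B, T (E f) = f) ∧
    ∀ u : Y, ∀ᵐ ξ ∂ν, Tendsto (fun s : ℝ≥0 => (u : Tree K → ℝ) (rayPoint ξ s)) atTop
      (𝓝 ((T u : Lp ℝ q ν) ξ))

lemma Admissible.one_le {p l₁ : ℝ} (h : Admissible p l₁) : 1 ≤ p := by
  rcases h with h | h
  · exact h.le
  · exact h.1.ge

end RegularTree

end

/-!
The trace of `u` at a boundary point is its limit along the ray, and the extension of `f` takes
the average of `f` over the rays through `v` as its value at the vertex `v` and is affine on
edges.

Both bounds reduce to sums over the vertices. On the edge that ends at a vertex of level `n` the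
measure `μ` is comparable to `e^{-βn} n^{l₂} d|x|`, so that by Jensen's inequality
(`exists_PhiE_lintegral_le`) the Luxemburg norm of `g` controls the sum of `e^{-βn} n^{l₂}
Φ(t_v)`, where `t_v` is the integral of `g` over the edge. The key point is that this sum may be
replaced by the sum of `e^{-βn} n^{l₁ + l₂} t_v^p`, in both directions (`exists_levelSum_rpow_le`,
`exists_levelSum_PhiE_le`). Indeed, if either sum is bounded, then `t_v` grows at most
exponentially in `n`, so that `log (e + t_v)` is comparable to `n` unless `t_v` is less than a
small exponential of `n`; and the terms with such small `t_v` have a bounded sum, since there are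
`K^n` vertices of level `n` and `β > log K`. Although `Φ` is not homogeneous, the norms are, and
bounds for functions of norm at most one suffice.

As `εθp = εp - (β - log K)` and a cylinder of level `n` has mass comparable to `K^{-n}`, the sum
of `e^{-βn} n^{l₁ + l₂} t_v^p` is comparable to that of `e^{εnθp} n^{l₁ + l₂} ν(I_v) (e^{-εn}
t_v)^p`, in which `e^{-εn} t_v` bounds the oscillation of `u` over the edge. A Hardy inequality
with exponentially growing weights (`exists_hardy`) passes from these oscillations to the distance
of `u` from its boundary values, which bounds the dyadic energy of the trace (`exists_trace`). For
the extension, `e^{-εn} t_v` is the difference of two consecutive averages, and the sum is the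
dyadic energy itself (`exists_sobolevNorm_dyadicExtension_le`). The trace of the extension of `f`
is `f`, because averages over the cylinders around a point converge almost everywhere, by Lévy's
upward theorem (`tendsto_average_cyl`).
-/

namespace RegularTree

/-! ### Comparison of `Φ` with powers on exponential scales -/

lemma rpow_le_of_comparable {a b x y : ℝ} (l : ℝ) (ha : 0 < a) (hb : 0 < b) (hy : 0 < y)
    (h1 : a * y ≤ x) (h2 : x ≤ b * y) : x ^ l ≤ max (a ^ l) (b ^ l) * y ^ l := by
  have hx : 0 < x := (mul_pos ha hy).trans_le h1
  rcases le_total 0 l with hl | hl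
  · calc x ^ l ≤ (b * y) ^ l := Real.rpow_le_rpow hx.le h2 hl
      _ = b ^ l * y ^ l := Real.mul_rpow hb.le hy.le
      _ ≤ _ := by gcongr; exact le_max_right _ _
  · calc x ^ l ≤ (a * y) ^ l := Real.rpow_le_rpow_of_nonpos (mul_pos ha hy) h1 hl
      _ = a ^ l * y ^ l := Real.mul_rpow ha.le hy.le
      _ ≤ _ := by gcongr; exact le_max_left _ _

lemma exists_rpow_le_exp (N : ℝ) {d : ℝ} (hd : 0 < d) :
    ∃ M : ℝ, 0 < M ∧ ∀ x : ℝ, 1 ≤ x → x ^ N ≤ M * Real.exp (d * x) := by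
  obtain ⟨k, hk⟩ := exists_nat_ge N
  refine ⟨k.factorial / d ^ k, by positivity, fun x hx => ?_⟩
  have h1 : x ^ N ≤ x ^ k := by
    rw [← Real.rpow_natCast]
    exact Real.rpow_le_rpow_of_exponent_le hx hk
  have h2 := Real.pow_div_factorial_le_exp (d * x) (by positivity) k
  rw [div_le_iff₀ (by positivity), mul_pow] at h2
  rw [div_mul_eq_mul_div, le_div_iff₀ (by positivity)]
  calc x ^ N * d ^ k ≤ x ^ k * d ^ k := by gcongr
    _ = d ^ k * x ^ k := mul_comm _ _
    _ ≤ _ := by linarith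

lemma exists_le_exp_of_weight_le (β l M₀ : ℝ) :
    ∃ B : ℝ, 0 ≤ B ∧ ∀ x y : ℝ, 1 ≤ x → Real.exp (-β * x) * x ^ l * y ≤ M₀ →
      y ≤ Real.exp (B * x) := by
  obtain ⟨M, hM, H⟩ := exists_rpow_le_exp (-l) one_pos
  refine ⟨|β| + 1 + |M₀| * M, by positivity, fun x y hx h => ?_⟩
  have hx0 : 0 < x := by linarith
  have h1 : y ≤ |M₀| * (Real.exp (β * x) * x ^ (-l)) := by
    rw [Real.rpow_neg hx0.le]
    have e : Real.exp (β * x) = (Real.exp (-β * x))⁻¹ := by rw [← Real.exp_neg]; ring_nf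
    rw [e, ← mul_inv, ← div_eq_mul_inv, le_div_iff₀ (by positivity)]
    calc _ = Real.exp (-β * x) * x ^ l * y := by ring
      _ ≤ _ := h.trans (le_abs_self _)
  calc y ≤ |M₀| * (Real.exp (β * x) * x ^ (-l)) := h1
    _ ≤ |M₀| * (Real.exp (|β| * x) * (M * Real.exp (1 * x))) := by
        gcongr
        · exact le_abs_self _
        · exact H x hx
    _ = (|M₀| * M) * (Real.exp (|β| * x) * Real.exp (1 * x)) := by ring
    _ ≤ Real.exp (|M₀| * M * x) * (Real.exp (|β| * x) * Real.exp (1 * x)) := by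
        gcongr
        have h3 : |M₀| * M ≤ |M₀| * M * x := le_mul_of_one_le_right (by positivity) hx
        linarith [Real.add_one_le_exp (|M₀| * M * x)]
    _ = _ := by
        rw [← Real.exp_add, ← Real.exp_add]
        congr 1
        ring

/-- As long as `t` grows at most exponentially in `x`, the factor `log^{l₁}(e + t)` in `Φ(t)` can be
traded for `x^{l₁}`, up to an error that only matters for `t` below a small exponential of `x`. -/
lemma exists_Phi_comparison {p : ℝ} (hp : 0 < p) (l₁ l₂ : ℝ) {c B : ℝ} (hc : 0 < c) (hB : 0 ≤ B) :
    ∃ M : ℝ, 0 < M ∧ ∀ x t : ℝ, 1 ≤ x → 0 ≤ t → t ≤ Real.exp (B * x) →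
      x ^ l₂ * Phi p l₁ t ≤ M * (x ^ (l₁ + l₂) * t ^ p + Real.exp (c * x)) ∧
      x ^ (l₁ + l₂) * t ^ p ≤ M * (x ^ l₂ * Phi p l₁ t + Real.exp (c * x)) := by
  -- below the threshold `e^{bx}` the power `t^p` is at most `e^{cx/2}`, and the other half of
  -- `e^{cx}` absorbs all powers of `x`; above it, `log (e + t)` is comparable to `x`
  set b : ℝ := c / (2 * p) with hb
  have hb0 : 0 < b := by positivity
  obtain ⟨M₁, hM₁, H₁⟩ := exists_rpow_le_exp (|l₁| + |l₂|) (half_pos hc)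
  set A₁ : ℝ := max (b ^ l₁) ((2 + B) ^ l₁) with hA₁
  set A₂ : ℝ := max ((2 + B)⁻¹ ^ l₁) (b⁻¹ ^ l₁) with hA₂
  have hA₁0 : 0 < A₁ := lt_max_of_lt_left (by positivity)
  have hA₂0 : 0 < A₂ := lt_max_of_lt_left (by positivity)
  refine ⟨A₁ + A₂ + (2 + B) ^ |l₁| * M₁ + M₁, by positivity, fun x t hx ht htB => ?_⟩
  have hx0 : 0 < x := by linarith
  set L := Real.log (Real.exp 1 + t) with hL
  have hL1 : 1 ≤ L := one_le_L ht
  have hL0 : 0 < L := by linarith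
  have hLu : L ≤ (2 + B) * x := by
    rw [hL, Real.log_le_iff_le_exp (by positivity)]
    have e1 : (2 + B) * x = x + ((1 + B) * x) := by ring
    have e2 : Real.exp 1 ≤ Real.exp ((1 + B) * x) := Real.exp_le_exp.2 (by nlinarith)
    have e3 : Real.exp (B * x) ≤ Real.exp ((1 + B) * x) := Real.exp_le_exp.2 (by nlinarith)
    rw [e1, Real.exp_add]
    nlinarith [Real.add_one_le_exp x, Real.exp_pos ((1 + B) * x)]
  have hsplit : x ^ (l₁ + l₂) = x ^ l₁ * x ^ l₂ := Real.rpow_add hx0 _ _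
  have hPhi : Phi p l₁ t = t ^ p * L ^ l₁ := rfl
  have htp : 0 ≤ t ^ p := by positivity
  have hLl : 0 < L ^ l₁ := by positivity
  have hxl₁ : 0 < x ^ l₁ := by positivity
  have hxl₂ : 0 < x ^ l₂ := by positivity
  have hE := Real.exp_pos (c * x)
  have hA₃ : 0 < (2 + B) ^ |l₁| * M₁ := by positivity
  rcases le_or_gt (Real.exp (b * x)) t with hbt | hbt
  · have hLl' : b * x ≤ L := by
      rw [hL, Real.le_log_iff_exp_le (by positivity)]
      linarith [Real.exp_pos 1]
    have c1 : L ^ l₁ ≤ A₁ * x ^ l₁ :=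
      rpow_le_of_comparable l₁ hb0 (by positivity) hx0 hLl' hLu
    have c2 : x ^ l₁ ≤ A₂ * L ^ l₁ := by
      refine rpow_le_of_comparable l₁ (by positivity) (by positivity) hL0 ?_ ?_
      · rw [inv_mul_le_iff₀ (by positivity)]; exact hLu
      · rw [le_inv_mul_iff₀ hb0]; exact hLl'
    rw [hPhi, hsplit]
    constructor
    · calc x ^ l₂ * (t ^ p * L ^ l₁) ≤ x ^ l₂ * (t ^ p * (A₁ * x ^ l₁)) := by gcongr
        _ = A₁ * (x ^ l₁ * x ^ l₂ * t ^ p) := by ring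
        _ ≤ _ := by
          gcongr
          · linarith
          · linarith
    · calc x ^ l₁ * x ^ l₂ * t ^ p ≤ (A₂ * L ^ l₁) * x ^ l₂ * t ^ p := by gcongr
        _ = A₂ * (x ^ l₂ * (t ^ p * L ^ l₁)) := by ring
        _ ≤ _ := by
          gcongr
          · linarith
          · linarith
  · have htp' : t ^ p ≤ Real.exp (c / 2 * x) := by
      calc t ^ p ≤ (Real.exp (b * x)) ^ p := Real.rpow_le_rpow ht hbt.le hp.le
        _ = Real.exp (c / 2 * x) := by
          rw [← Real.exp_mul, hb]
          congr 1
          field_simp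
    have hEE : Real.exp (c * x) = Real.exp (c / 2 * x) * Real.exp (c / 2 * x) := by
      rw [← Real.exp_add]; ring_nf
    constructor
    · have hLle : L ^ l₁ ≤ (2 + B) ^ |l₁| * x ^ |l₁| := by
        rw [← Real.mul_rpow (by positivity) hx0.le]
        calc L ^ l₁ ≤ L ^ |l₁| := Real.rpow_le_rpow_of_exponent_le hL1 (le_abs_self _)
          _ ≤ _ := Real.rpow_le_rpow hL0.le hLu (abs_nonneg _)
      have hx2 : x ^ l₂ ≤ x ^ |l₂| := Real.rpow_le_rpow_of_exponent_le hx (le_abs_self _)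
      calc x ^ l₂ * Phi p l₁ t = x ^ l₂ * (t ^ p * L ^ l₁) := rfl
        _ ≤ x ^ |l₂| * (Real.exp (c / 2 * x) * ((2 + B) ^ |l₁| * x ^ |l₁|)) := by gcongr
        _ = (2 + B) ^ |l₁| * (x ^ (|l₁| + |l₂|)) * Real.exp (c / 2 * x) := by
          rw [Real.rpow_add hx0]; ring
        _ ≤ (2 + B) ^ |l₁| * (M₁ * Real.exp (c / 2 * x)) * Real.exp (c / 2 * x) := by
          gcongr
          exact H₁ x hx
        _ = (2 + B) ^ |l₁| * M₁ * Real.exp (c * x) := by rw [hEE]; ring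
        _ ≤ _ := by
          gcongr
          · linarith
          · exact le_add_of_nonneg_left (by positivity)
    · have hxl : x ^ (l₁ + l₂) ≤ x ^ (|l₁| + |l₂|) :=
        Real.rpow_le_rpow_of_exponent_le hx (add_le_add (le_abs_self _) (le_abs_self _))
      calc x ^ (l₁ + l₂) * t ^ p ≤ (M₁ * Real.exp (c / 2 * x)) * Real.exp (c / 2 * x) := by
            gcongr
            exact hxl.trans (H₁ x hx)
        _ = M₁ * Real.exp (c * x) := by rw [hEE]; ring
        _ ≤ _ := by
          gcongr
          · linarith
          · exact le_add_of_nonneg_left (mul_nonneg hxl₂.le (Phi_nonneg ht))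

/-- `Φ` grows at least linearly. -/
lemma exists_le_Phi {p l₁ : ℝ} (h : Admissible p l₁) :
    ∃ D : ℝ, 0 < D ∧ ∀ t : ℝ, 0 ≤ t → t ≤ 1 + D * Phi p l₁ t := by
  obtain ⟨D, hD, H⟩ := exists_ratio h
  have h1 : 0 < Phi p l₁ 1 := by
    have := one_le_L (t := 1) zero_le_one
    unfold Phi
    positivity
  refine ⟨D / Phi p l₁ 1, by positivity, fun t ht => ?_⟩
  rcases le_total t 1 with h2 | h2
  · have := Phi_nonneg (p := p) (l₁ := l₁) ht
    have : 0 ≤ D / Phi p l₁ 1 * Phi p l₁ t := by positivity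
    linarith
  · have := H 1 t one_pos h2
    have h3 : t ≤ D / Phi p l₁ 1 * Phi p l₁ t := by
      rw [div_mul_eq_mul_div, le_div_iff₀ h1]
      linarith
    linarith

/-! ### Weighted sums over the vertices of the tree -/

/-- The weight `e^{-βn} n^l`, `n = m + 1`, of the vertices of level `m + 1`. -/
noncomputable def levelWeight (β l : ℝ) (m : ℕ) : ℝ≥0∞ :=
  ENNReal.ofReal (Real.exp (-β * ((m + 1 : ℕ) : ℝ)) * ((m + 1 : ℕ) : ℝ) ^ l)

/-- The sum of `e^{-βn} n^l F(v)` over all vertices `v` of level `n ≥ 1`. -/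
noncomputable def levelSum {K : ℕ} (β l : ℝ) (F : List (Fin K) → ℝ≥0∞) : ℝ≥0∞ :=
  ∑' m : ℕ, levelWeight β l m * ∑ v : Fin (m + 1) → Fin K, F (List.ofFn v)

lemma levelWeight_ne_zero (β l : ℝ) (m : ℕ) : levelWeight β l m ≠ 0 := by
  have : (0 : ℝ) < Real.exp (-β * ((m + 1 : ℕ) : ℝ)) * ((m + 1 : ℕ) : ℝ) ^ l := by positivity
  simpa [levelWeight] using this

lemma levelWeight_ne_top (β l : ℝ) (m : ℕ) : levelWeight β l m ≠ ⊤ := ENNReal.ofReal_ne_top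

lemma levelSum_mono {K : ℕ} (β l : ℝ) {F G : List (Fin K) → ℝ≥0∞}
    (h : ∀ (m : ℕ) (v : Fin (m + 1) → Fin K), F (List.ofFn v) ≤ G (List.ofFn v)) :
    levelSum β l F ≤ levelSum β l G := by
  unfold levelSum
  gcongr with m v
  exact h m v

lemma levelSum_const_mul {K : ℕ} (β l : ℝ) (c : ℝ≥0∞) (F : List (Fin K) → ℝ≥0∞) :
    levelSum β l (fun v => c * F v) = c * levelSum β l F := by
  simp only [levelSum, ← Finset.mul_sum, mul_left_comm _ c, ENNReal.tsum_mul_left]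

lemma levelSum_add {K : ℕ} (β l : ℝ) (F G : List (Fin K) → ℝ≥0∞) :
    levelSum β l (fun v => F v + G v) = levelSum β l F + levelSum β l G := by
  simp only [levelSum, Finset.sum_add_distrib, mul_add, ENNReal.tsum_add]

lemma le_levelSum {K : ℕ} (β l : ℝ) (F : List (Fin K) → ℝ≥0∞) (m : ℕ)
    (v : Fin (m + 1) → Fin K) : levelWeight β l m * F (List.ofFn v) ≤ levelSum β l F := by
  refine le_trans ?_ (ENNReal.le_tsum m)
  gcongr
  exact Finset.single_le_sum (f := fun v : Fin (m + 1) → Fin K => F (List.ofFn v))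
    (fun _ _ => zero_le) (Finset.mem_univ v)

/-- The error terms of `exists_Phi_comparison` are summable: `K^n e^{-βn} e^{cn}` decays
geometrically as `c < β - log K`. -/
lemma tsum_errors_ne_top {K : ℕ} (hK : 0 < K) {β c : ℝ} (hc : c < β - Real.log K) :
    ∑' m : ℕ, ∑ _v : Fin (m + 1) → Fin K,
      ENNReal.ofReal (Real.exp (-β * ((m + 1 : ℕ) : ℝ)) * Real.exp (c * ((m + 1 : ℕ) : ℝ))) ≠
      ⊤ := by
  have hK0 : (0 : ℝ) < K := by exact_mod_cast hK
  set r : ℝ := Real.exp (-(β - Real.log K - c)) with hr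
  have hr1 : r < 1 := by rw [hr, Real.exp_lt_one_iff]; linarith
  have key : ∀ m : ℕ, ∑ _v : Fin (m + 1) → Fin K,
      ENNReal.ofReal (Real.exp (-β * ((m + 1 : ℕ) : ℝ)) * Real.exp (c * ((m + 1 : ℕ) : ℝ))) =
      ENNReal.ofReal (r ^ (m + 1)) := by
    intro m
    rw [Finset.sum_const, Finset.card_univ, Fintype.card_fun, Fintype.card_fin, Fintype.card_fin,
      nsmul_eq_mul, ← ENNReal.ofReal_natCast, ← ENNReal.ofReal_mul (by positivity)]
    congr 1
    have e : ((K ^ (m + 1) : ℕ) : ℝ) = Real.exp (Real.log K * ((m + 1 : ℕ) : ℝ)) := by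
      rw [Real.exp_mul, Real.exp_log hK0, Real.rpow_natCast]
      push_cast
      rfl
    rw [e, hr, ← Real.exp_nat_mul, ← Real.exp_add, ← Real.exp_add]
    congr 1
    ring
  simp only [key]
  have hs : Summable fun m : ℕ => r ^ (m + 1) :=
    (summable_nat_add_iff 1).2 (summable_geometric_of_lt_one (Real.exp_pos _).le hr1)
  rw [← ENNReal.ofReal_tsum_of_nonneg (fun m => by positivity) hs]
  exact ENNReal.ofReal_ne_top

lemma PhiE_of_ne_top {p l₁ : ℝ} {t : ℝ≥0∞} (ht : t ≠ ⊤) :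
    PhiE p l₁ t = ENNReal.ofReal (Phi p l₁ t.toReal) := if_neg ht

lemma PhiE_top {p l₁ : ℝ} : PhiE p l₁ ⊤ = ⊤ := if_pos rfl

/-- A bound on the weighted `ℓ^p` sum with weights `e^{-βn} n^{l₁ + l₂}` gives one on the weighted
Orlicz sum with weights `e^{-βn} n^{l₂}`. -/
lemma exists_levelSum_PhiE_le {K : ℕ} (hK : 0 < K) {β p : ℝ} (l₁ l₂ : ℝ)
    (hβ : Real.log K < β) (hp : 0 < p) (M₀ : ℝ≥0) :
    ∃ M : ℝ≥0, ∀ t : List (Fin K) → ℝ≥0∞, levelSum β (l₁ + l₂) (fun v => t v ^ p) ≤ M₀ →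
      levelSum β l₂ (fun v => PhiE p l₁ (t v)) ≤ M := by
  set c : ℝ := (β - Real.log K) / 2 with hc
  have hc0 : 0 < c := by rw [hc]; linarith
  obtain ⟨B, hB, HB⟩ := exists_le_exp_of_weight_le β (l₁ + l₂) M₀
  obtain ⟨M, hM, HM⟩ := exists_Phi_comparison hp l₁ l₂ hc0 (B := B / p) (by positivity)
  have herr := tsum_errors_ne_top hK (β := β) (c := c) (by rw [hc]; linarith)
  set R := ∑' m : ℕ, ∑ _v : Fin (m + 1) → Fin K,
      ENNReal.ofReal (Real.exp (-β * ((m + 1 : ℕ) : ℝ)) * Real.exp (c * ((m + 1 : ℕ) : ℝ))) with hR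
  refine ⟨(ENNReal.ofReal M * (M₀ + R)).toNNReal, fun t ht => ?_⟩
  rw [ENNReal.coe_toNNReal (by finiteness)]
  refine le_trans ?_ (mul_le_mul_right (add_le_add_left ht R) _)
  rw [levelSum, levelSum, hR, ← ENNReal.tsum_add, ← ENNReal.tsum_mul_left]
  refine ENNReal.tsum_le_tsum fun m => ?_
  rw [Finset.mul_sum, Finset.mul_sum, ← Finset.sum_add_distrib, Finset.mul_sum]
  refine Finset.sum_le_sum fun v _ => ?_
  have h1 := (le_levelSum β (l₁ + l₂) (fun v => t v ^ p) m v).trans ht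
  have htop : t (List.ofFn v) ≠ ⊤ := by
    intro h
    rw [h, ENNReal.top_rpow_of_pos hp, ENNReal.mul_top (levelWeight_ne_zero _ _ _)] at h1
    exact absurd h1 (by simp)
  rw [PhiE_of_ne_top htop]
  obtain ⟨y, hy, hty⟩ : ∃ y : ℝ, 0 ≤ y ∧ t (List.ofFn v) = ENNReal.ofReal y :=
    ⟨_, ENNReal.toReal_nonneg, (ENNReal.ofReal_toReal htop).symm⟩
  have hx1 : (1 : ℝ) ≤ ((m + 1 : ℕ) : ℝ) := by exact_mod_cast Nat.le_add_left 1 m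
  simp only [hty] at h1 ⊢
  rw [ENNReal.toReal_ofReal hy, levelWeight, levelWeight]
  rw [levelWeight, ENNReal.ofReal_rpow_of_nonneg hy hp.le, ← ENNReal.ofReal_mul (by positivity),
    ← ENNReal.ofReal_coe_nnreal] at h1
  replace h1 := (ENNReal.ofReal_le_ofReal_iff M₀.2).1 h1
  generalize ((m + 1 : ℕ) : ℝ) = x at *
  have hx0 : 0 < x := by linarith
  have h2 := HB x _ hx1 h1
  have h3 : y ≤ Real.exp (B / p * x) := by
    have := Real.rpow_le_rpow (by positivity) h2 (by positivity : (0:ℝ) ≤ 1 / p)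
    rw [← Real.rpow_mul hy, mul_one_div_cancel hp.ne', Real.rpow_one, ← Real.exp_mul] at this
    refine this.trans_eq ?_
    congr 1; ring
  have h4 := (HM x y hx1 hy h3).1
  rw [ENNReal.ofReal_rpow_of_nonneg hy hp.le, ← ENNReal.ofReal_mul (by positivity),
    ← ENNReal.ofReal_mul (by positivity), ← ENNReal.ofReal_add (by positivity) (by positivity),
    ← ENNReal.ofReal_mul hM.le]
  apply ENNReal.ofReal_le_ofReal
  have h5 := mul_le_mul_of_nonneg_left h4 (Real.exp_pos (-β * x)).le
  linarith

/-- A bound on the weighted Orlicz sum with weights `e^{-βn} n^{l₂}` gives one on the weighted `ℓ^p`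
sum with weights `e^{-βn} n^{l₁ + l₂}`. -/
lemma exists_levelSum_rpow_le {K : ℕ} (hK : 0 < K) {β p l₁ : ℝ} (l₂ : ℝ)
    (hβ : Real.log K < β) (hΦ : Admissible p l₁) (M₀ : ℝ≥0) :
    ∃ M : ℝ≥0, ∀ t : List (Fin K) → ℝ≥0∞, levelSum β l₂ (fun v => PhiE p l₁ (t v)) ≤ M₀ →
      levelSum β (l₁ + l₂) (fun v => t v ^ p) ≤ M := by
  have hp : 0 < p := zero_lt_one.trans_le hΦ.one_le
  set c : ℝ := (β - Real.log K) / 2 with hc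
  have hc0 : 0 < c := by rw [hc]; linarith
  obtain ⟨B, hB, HB⟩ := exists_le_exp_of_weight_le β l₂ M₀
  obtain ⟨D, hD, HD⟩ := exists_le_Phi hΦ
  obtain ⟨M, hM, HM⟩ := exists_Phi_comparison hp l₁ l₂ hc0 (B := B + D) (by positivity)
  have herr := tsum_errors_ne_top hK (β := β) (c := c) (by rw [hc]; linarith)
  set R := ∑' m : ℕ, ∑ _v : Fin (m + 1) → Fin K,
      ENNReal.ofReal (Real.exp (-β * ((m + 1 : ℕ) : ℝ)) * Real.exp (c * ((m + 1 : ℕ) : ℝ))) with hR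
  refine ⟨(ENNReal.ofReal M * (M₀ + R)).toNNReal, fun t ht => ?_⟩
  rw [ENNReal.coe_toNNReal (by finiteness)]
  refine le_trans ?_ (mul_le_mul_right (add_le_add_left ht R) _)
  rw [levelSum, levelSum, hR, ← ENNReal.tsum_add, ← ENNReal.tsum_mul_left]
  refine ENNReal.tsum_le_tsum fun m => ?_
  rw [Finset.mul_sum, Finset.mul_sum, ← Finset.sum_add_distrib, Finset.mul_sum]
  refine Finset.sum_le_sum fun v _ => ?_
  have h1 := (le_levelSum β l₂ (fun v => PhiE p l₁ (t v)) m v).trans ht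
  have htop : t (List.ofFn v) ≠ ⊤ := by
    intro h
    rw [h, PhiE_top, ENNReal.mul_top (levelWeight_ne_zero _ _ _)] at h1
    exact absurd h1 (by simp)
  rw [PhiE_of_ne_top htop] at h1 ⊢
  obtain ⟨y, hy, hty⟩ : ∃ y : ℝ, 0 ≤ y ∧ t (List.ofFn v) = ENNReal.ofReal y :=
    ⟨_, ENNReal.toReal_nonneg, (ENNReal.ofReal_toReal htop).symm⟩
  have hx1 : (1 : ℝ) ≤ ((m + 1 : ℕ) : ℝ) := by exact_mod_cast Nat.le_add_left 1 m
  have hPhi : 0 ≤ Phi p l₁ y := Phi_nonneg hy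
  simp only [hty] at h1 ⊢
  rw [ENNReal.toReal_ofReal hy] at h1 ⊢
  rw [levelWeight, levelWeight]
  rw [levelWeight, ← ENNReal.ofReal_mul (by positivity),
    ← ENNReal.ofReal_coe_nnreal] at h1
  replace h1 := (ENNReal.ofReal_le_ofReal_iff M₀.2).1 h1
  generalize ((m + 1 : ℕ) : ℝ) = x at *
  have hx0 : 0 < x := by linarith
  have h2 := HB x _ hx1 h1
  have h3 : y ≤ Real.exp ((B + D) * x) := by
    have e1 : 1 + D * Real.exp (B * x) ≤ (1 + D) * Real.exp (B * x) := by
      have := Real.one_le_exp (by positivity : 0 ≤ B * x)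
      linarith
    have e2 : 1 + D ≤ Real.exp (D * x) := by
      have := Real.add_one_le_exp (D * x)
      nlinarith
    calc y ≤ 1 + D * Phi p l₁ y := HD y hy
      _ ≤ 1 + D * Real.exp (B * x) := by gcongr
      _ ≤ (1 + D) * Real.exp (B * x) := e1
      _ ≤ Real.exp (D * x) * Real.exp (B * x) := by gcongr
      _ = _ := by rw [← Real.exp_add]; ring_nf
  have h4 := (HM x y hx1 hy h3).2
  rw [ENNReal.ofReal_rpow_of_nonneg hy hp.le, ← ENNReal.ofReal_mul (by positivity),
    ← ENNReal.ofReal_mul (by positivity), ← ENNReal.ofReal_add (by positivity) (by positivity),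
    ← ENNReal.ofReal_mul hM.le]
  apply ENNReal.ofReal_le_ofReal
  have h5 := mul_le_mul_of_nonneg_left h4 (Real.exp_pos (-β * x)).le
  linarith

/-! ### Jensen's inequality and scaling for `Φ` -/

/-- Jensen's inequality up to constants, which only uses that `Φ(t) / t` is almost increasing. -/
lemma exists_PhiE_lintegral_le {p l₁ : ℝ} (hΦ : Admissible p l₁) :
    ∃ D : ℝ≥0, ∀ {α : Type*} [MeasurableSpace α] (P : Measure α) [IsProbabilityMeasure P]
      (g : α → ℝ≥0∞), Measurable g →
      PhiE p l₁ (2⁻¹ * ∫⁻ x, g x ∂P) ≤ D * ∫⁻ x, PhiE p l₁ (g x) ∂P := by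
  obtain ⟨D, hD, H⟩ := exists_ratio hΦ
  obtain ⟨D', hD', H'⟩ := exists_le_Phi hΦ
  refine ⟨(max D 1).toNNReal, fun {α} _ P _ g hg => ?_⟩
  have hD1 : (ENNReal.ofReal D : ℝ≥0∞) ≤ ((max D 1).toNNReal : ℝ≥0∞) :=
    ENNReal.ofReal_le_ofReal (le_max_left _ _)
  have hmΦ : Measurable fun x => PhiE p l₁ (g x) := (measurable_PhiE p l₁).comp hg
  rcases eq_or_ne (∫⁻ x, PhiE p l₁ (g x) ∂P) ⊤ with htop | htop
  · rw [htop, ENNReal.mul_top (by positivity)]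
    exact le_top
  refine le_trans ?_ (mul_le_mul_left hD1 _)
  -- as `Φ` grows at least linearly, `g` is integrable; this allows the cancellation at the end
  have hgtop : ∫⁻ x, g x ∂P ≠ ⊤ := by
    have hle : ∀ x, g x ≤ 1 + ENNReal.ofReal D' * PhiE p l₁ (g x) := by
      intro x
      rcases eq_or_ne (g x) ⊤ with h | h
      · rw [h, PhiE_top, ENNReal.mul_top (by simpa using hD')]
        simp
      · rw [PhiE_of_ne_top h, ← ENNReal.ofReal_mul hD'.le, ← ENNReal.ofReal_one,
          ← ENNReal.ofReal_add zero_le_one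
            (mul_nonneg hD'.le (Phi_nonneg ENNReal.toReal_nonneg))]
        conv_lhs => rw [← ENNReal.ofReal_toReal h]
        exact ENNReal.ofReal_le_ofReal (H' _ ENNReal.toReal_nonneg)
    refine ne_top_of_le_ne_top ?_ (lintegral_mono hle)
    rw [lintegral_add_left measurable_const, lintegral_const_mul _ hmΦ]
    simp only [lintegral_const, measure_univ, mul_one]
    finiteness
  rcases eq_or_ne (∫⁻ x, g x ∂P) 0 with h0 | h0
  · rw [h0, mul_zero, PhiE_of_ne_top (by simp)]
    simp [Phi_zero hΦ]
  set s : ℝ≥0∞ := 2⁻¹ * ∫⁻ x, g x ∂P with hs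
  have hs0 : s ≠ 0 := by simp [hs, h0]
  have hst : s ≠ ⊤ := by rw [hs]; finiteness
  have hsr : 0 < s.toReal := ENNReal.toReal_pos hs0 hst
  have hss : ∫⁻ x, g x ∂P = s + s := by
    rw [hs, ← add_mul, ENNReal.inv_two_add_inv_two, one_mul]
  -- below the level `s` the integral of `g` is at most `s`; above it, `g` is controlled by `Φ(g)`
  have hpt : ∀ x, PhiE p l₁ s * g x ≤
      PhiE p l₁ s * s + s * (ENNReal.ofReal D * PhiE p l₁ (g x)) := by
    intro x
    rcases le_total (g x) s with hx | hx
    · exact (mul_le_mul_right hx _).trans le_self_add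
    · refine le_trans ?_ le_add_self
      rcases eq_or_ne (g x) ⊤ with h | h
      · rw [h, PhiE_top, ENNReal.mul_top (a := ENNReal.ofReal D) (by simpa using hD),
          ENNReal.mul_top hs0]
        exact le_top
      · rw [PhiE_of_ne_top h, PhiE_of_ne_top hst]
        conv_lhs => rw [← ENNReal.ofReal_toReal h]
        conv_rhs => rw [← ENNReal.ofReal_toReal hst]
        rw [← ENNReal.ofReal_mul (Phi_nonneg hsr.le), ← ENNReal.ofReal_mul hD.le,
          ← ENNReal.ofReal_mul hsr.le]
        apply ENNReal.ofReal_le_ofReal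
        have := H _ _ hsr (ENNReal.toReal_mono h hx)
        linarith
  have hint := lintegral_mono (μ := P) hpt
  rw [lintegral_const_mul _ hg, lintegral_add_left measurable_const,
    lintegral_const_mul _ (hmΦ.const_mul _), lintegral_const_mul _ hmΦ, lintegral_const,
    measure_univ, mul_one, hss, mul_add] at hint
  have hfin : PhiE p l₁ s * s ≠ ⊤ := by
    rw [PhiE_of_ne_top hst]
    finiteness
  have h2 := (ENNReal.add_le_add_iff_left hfin).1 hint
  rw [mul_comm s] at h2
  exact (ENNReal.mul_le_mul_iff_left hs0 hst).1 h2

lemma exists_PhiE_le_inv_mul {p l₁ : ℝ} (hΦ : Admissible p l₁) (M : ℝ≥0) :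
    ∃ A : ℝ≥0, 0 < A ∧ ∀ s t : ℝ≥0∞, A * s ≤ t → M * PhiE p l₁ s ≤ PhiE p l₁ t := by
  obtain ⟨c, hc, H⟩ := exists_PhiE_le hΦ
  obtain ⟨j, hj⟩ : ∃ j : ℕ, (M : ℝ≥0) ≤ 2 ^ j := pow_unbounded_of_one_lt M one_lt_two |>.imp
    fun _ h => h.le
  have hc0 : 0 < c := zero_lt_one.trans_le hc
  have key : ∀ j : ℕ, ∀ s t : ℝ≥0∞, (c : ℝ≥0∞) ^ (j + 1) * s ≤ t →
      2 ^ j * PhiE p l₁ s ≤ PhiE p l₁ t := by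
    intro j
    induction j with
    | zero =>
      intro s t hst
      rw [pow_zero, one_mul]
      refine (H s t (by simpa using hst)).trans ?_
      exact mul_le_of_le_one_left zero_le (by simp)
    | succ j ih =>
      intro s t hst
      have h1 := ih s (c ^ (j + 1) * s) le_rfl
      have h2 := H (c ^ (j + 1) * s) t (by rw [← mul_assoc, ← pow_succ']; exact hst)
      calc (2 : ℝ≥0∞) ^ (j + 1) * PhiE p l₁ s = 2 * (2 ^ j * PhiE p l₁ s) := by
            rw [pow_succ', mul_assoc]
        _ ≤ 2 * (2⁻¹ * PhiE p l₁ t) := mul_le_mul_right (h1.trans h2) _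
        _ = PhiE p l₁ t := by
            rw [← mul_assoc, ENNReal.mul_inv_cancel (by simp) (by simp), one_mul]
  refine ⟨c ^ (j + 1), by positivity, fun s t hst => ?_⟩
  refine le_trans ?_ (key j s t (by exact_mod_cast hst))
  gcongr
  exact_mod_cast hj

/-! ### Edges, segments and geodesics of the tree -/

instance instDiscreteMeasurableSpaceWord (K : ℕ) : DiscreteMeasurableSpace (List (Fin K)) :=
  ⟨fun _ => trivial⟩

lemma measurableSet_treeSet (K : ℕ) : MeasurableSet (treeSet K) := by
  have h1 : Measurable fun x : List (Fin K) × ℝ => x.1.length :=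
    (measurable_of_countable _).comp measurable_fst
  have h2 : Measurable fun x : List (Fin K) × ℝ => ⌈x.2⌉₊ :=
    Nat.measurable_ceil.comp measurable_snd
  exact (measurableSet_le measurable_const measurable_snd).inter (measurableSet_eq_fun h1 h2)

lemma measurable_height {K : ℕ} : Measurable (height : Tree K → ℝ) :=
  measurable_snd.comp measurable_subtype_coe

lemma measurable_word {K : ℕ} : Measurable fun x : Tree K => x.1.1 :=
  measurable_fst.comp measurable_subtype_coe

lemma height_nonneg {K : ℕ} (x : Tree K) : 0 ≤ height x := x.2.1

lemma length_word {K : ℕ} (x : Tree K) : x.1.1.length = ⌈height x⌉₊ := x.2.2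

lemma height_le_length {K : ℕ} (x : Tree K) : height x ≤ x.1.1.length := by
  rw [length_word]
  exact Nat.le_ceil _

lemma Anc.trans {K : ℕ} {x y z : Tree K} (h₁ : Anc x y) (h₂ : Anc y z) : Anc x z :=
  ⟨h₁.1.trans h₂.1, h₁.2.trans h₂.2⟩

lemma Anc.refl {K : ℕ} (x : Tree K) : Anc x x := ⟨List.prefix_rfl, le_rfl⟩

/-- The edge from the mother of `w` to `w`, without the mother of `w`. -/
def edge {K : ℕ} (w : List (Fin K)) : Set (Tree K) := {x | x.1.1 = w}

/-- The vertex `w` as a point of the tree. -/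
def vertexPoint {K : ℕ} (w : List (Fin K)) : Tree K :=
  ⟨(w, (w.length : ℝ)), Nat.cast_nonneg _, (Nat.ceil_natCast _).symm⟩

lemma measurableSet_edge {K : ℕ} (w : List (Fin K)) : MeasurableSet (edge w) :=
  measurable_word (measurableSet_singleton w)

lemma height_mem_of_mem_edge {K m : ℕ} {w : List (Fin K)} (hw : w.length = m + 1) {x : Tree K}
    (hx : x ∈ edge w) : (m : ℝ) < height x ∧ height x ≤ ((m + 1 : ℕ) : ℝ) := by
  have h : ⌈height x⌉₊ = m + 1 := by
    have hx' : x.1.1 = w := hx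
    rw [← length_word, hx', hw]
  exact (Nat.ceil_eq_iff (Nat.succ_ne_zero m)).1 h

lemma lengthMeasure_apply {K : ℕ} (s : Set (Tree K)) :
    lengthMeasure K s = (Measure.count.prod volume) (Subtype.val '' s) :=
  (MeasurableEmbedding.subtype_coe (measurableSet_treeSet K)).comap_apply _ _

lemma lengthMeasure_edge {K m : ℕ} {w : List (Fin K)} (hw : w.length = m + 1) :
    lengthMeasure K (edge w) = 1 := by
  have : (Subtype.val '' (edge w) : Set (List (Fin K) × ℝ)) =
      {w} ×ˢ Set.Ioc (m : ℝ) ((m + 1 : ℕ) : ℝ) := by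
    ext ⟨v, s⟩
    constructor
    · rintro ⟨x, hx, hxe⟩
      have h := height_mem_of_mem_edge hw hx
      have hx' : x.1.1 = w := hx
      refine ⟨?_, ?_⟩
      · rw [← hxe]; exact hx'
      · rw [← hxe]; exact h
    · rintro ⟨h1, h2⟩
      have h1' : v = w := h1
      subst h1'
      refine ⟨⟨(v, s), ?_, ?_⟩, rfl, rfl⟩
      · exact (Nat.cast_nonneg m).trans h2.1.le
      · rw [hw]; exact ((Nat.ceil_eq_iff (Nat.succ_ne_zero m)).2 h2).symm
  rw [lengthMeasure_apply, this, Measure.prod_prod, Measure.count_singleton, Real.volume_Ioc]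
  simp

lemma lengthMeasure_singleton {K : ℕ} (x : Tree K) : lengthMeasure K {x} = 0 := by
  have : ({(x.1.1, x.1.2)} : Set (List (Fin K) × ℝ)) = {x.1.1} ×ˢ {x.1.2} := by
    rw [Set.singleton_prod_singleton]
  rw [lengthMeasure_apply, Set.image_singleton, show x.1 = (x.1.1, x.1.2) from rfl, this,
    Measure.prod_prod]
  simp

lemma edge_nil {K : ℕ} : edge ([] : List (Fin K)) = {vertexPoint []} := by
  ext x
  constructor
  · intro hx
    have hx' : x.1.1 = [] := hx
    have h0 : height x ≤ 0 := by
      have := height_le_length x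
      rw [hx'] at this
      simpa using this
    apply Subtype.ext
    refine Prod.ext hx' ?_
    have : x.1.2 = 0 := le_antisymm h0 (height_nonneg x)
    simpa [vertexPoint] using this
  · rintro rfl
    rfl

lemma tsum_list_eq {K : ℕ} (F : List (Fin K) → ℝ≥0∞) (h0 : F [] = 0) :
    ∑' w, F w = ∑' m : ℕ, ∑ v : Fin (m + 1) → Fin K, F (List.ofFn v) := by
  have h1 : ∑' w, F w = ∑' n : ℕ, ∑ v : Fin n → Fin K, F (List.ofFn v) := by
    rw [← List.equivSigmaTuple.symm.tsum_eq, ENNReal.tsum_sigma']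
    refine tsum_congr fun n => ?_
    rw [tsum_fintype]
    rfl
  rw [h1, tsum_eq_zero_add' ENNReal.summable]
  simp [h0]

/-- The length measure is a sum over the edges. -/
lemma lintegral_lengthMeasure {K : ℕ} (h : Tree K → ℝ≥0∞) :
    ∫⁻ x, h x ∂lengthMeasure K =
      ∑' m : ℕ, ∑ v : Fin (m + 1) → Fin K, ∫⁻ x in edge (List.ofFn v), h x ∂lengthMeasure K := by
  have hU : (⋃ w : List (Fin K), edge w) = Set.univ :=
    Set.eq_univ_of_forall fun x => Set.mem_iUnion.2 ⟨x.1.1, rfl⟩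
  rw [← setLIntegral_univ, ← hU, lintegral_iUnion measurableSet_edge, tsum_list_eq]
  · rw [edge_nil]
    exact setLIntegral_measure_zero _ _ (lengthMeasure_singleton _)
  · intro v w hvw
    refine Set.disjoint_left.2 fun x hx hx' => hvw ?_
    exact Eq.trans (Eq.symm hx) hx'

/-- On the edges of level `n` the density of the weighted measure is comparable to
`e^{-βn} n^l`. -/
lemma exists_density_comparable (β l : ℝ) {C : ℝ} (hC : 0 < C) :
    ∃ c : ℝ, 0 < c ∧ ∀ (m : ℕ) (s : ℝ), (m : ℝ) < s → s ≤ ((m + 1 : ℕ) : ℝ) →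
      Real.exp (-β * s) * (s + C) ^ l ≤
        c * (Real.exp (-β * ((m + 1 : ℕ) : ℝ)) * ((m + 1 : ℕ) : ℝ) ^ l) ∧
      Real.exp (-β * ((m + 1 : ℕ) : ℝ)) * ((m + 1 : ℕ) : ℝ) ^ l ≤
        c * (Real.exp (-β * s) * (s + C) ^ l) := by
  set a : ℝ := min C 1 with ha
  have ha0 : 0 < a := lt_min hC one_pos
  set A₁ : ℝ := max (a ^ l) ((1 + C) ^ l) with hA₁
  set A₂ : ℝ := max ((1 + C)⁻¹ ^ l) (a⁻¹ ^ l) with hA₂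
  have hA₁0 : 0 < A₁ := lt_max_of_lt_left (by positivity)
  have hA₂0 : 0 < A₂ := lt_max_of_lt_left (by positivity)
  refine ⟨Real.exp |β| * (A₁ + A₂), by positivity, fun m s hs1 hs2 => ?_⟩
  have hm : (0 : ℝ) ≤ m := Nat.cast_nonneg m
  push_cast at hs2 ⊢
  have hsC : 0 < s + C := by linarith
  have hm1 : (0 : ℝ) < m + 1 := by linarith
  have b1 : a * (m + 1) ≤ s + C := by
    have h1 : a * m ≤ 1 * m := by gcongr; exact min_le_right _ _
    have h2 : a ≤ C := min_le_left _ _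
    linarith
  have b2 : s + C ≤ (1 + C) * (m + 1) := by nlinarith
  have e1 : (s + C) ^ l ≤ A₁ * ((m : ℝ) + 1) ^ l :=
    rpow_le_of_comparable l ha0 (by positivity) hm1 b1 b2
  have e2 : ((m : ℝ) + 1) ^ l ≤ A₂ * (s + C) ^ l := by
    refine rpow_le_of_comparable l (by positivity) (by positivity) hsC ?_ ?_
    · rw [inv_mul_le_iff₀ (by positivity)]; exact b2
    · rw [le_inv_mul_iff₀ ha0]; exact b1
  have hd : |β * (m + 1 - s)| ≤ |β| := by
    rw [abs_mul]
    refine mul_le_of_le_one_right (abs_nonneg _) ?_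
    rw [abs_le]
    constructor <;> linarith
  have f1 : Real.exp (-β * s) ≤ Real.exp |β| * Real.exp (-β * (m + 1)) := by
    rw [← Real.exp_add]
    exact Real.exp_le_exp.2 (by linarith [(abs_le.1 hd).2])
  have f2 : Real.exp (-β * (m + 1)) ≤ Real.exp |β| * Real.exp (-β * s) := by
    rw [← Real.exp_add]
    exact Real.exp_le_exp.2 (by linarith [(abs_le.1 hd).1])
  constructor
  · calc _ ≤ (Real.exp |β| * Real.exp (-β * (m + 1))) * (A₁ * ((m : ℝ) + 1) ^ l) := by gcongr
      _ = Real.exp |β| * A₁ * (Real.exp (-β * (m + 1)) * ((m : ℝ) + 1) ^ l) := by ring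
      _ ≤ _ := by gcongr; linarith
  · calc _ ≤ (Real.exp |β| * Real.exp (-β * s)) * (A₂ * (s + C) ^ l) := by gcongr
      _ = Real.exp |β| * A₂ * (Real.exp (-β * s) * (s + C) ^ l) := by ring
      _ ≤ _ := by gcongr; linarith

/-- Integrals with respect to the weighted measure are comparable to weighted sums of the integrals
over the edges. -/
lemma exists_lintegral_weightedMeasure_comparable (K : ℕ) (β l : ℝ) {C : ℝ} (hC : 0 < C) :
    ∃ c : ℝ≥0, ∀ h : Tree K → ℝ≥0∞, Measurable h →
      ∫⁻ x, h x ∂weightedMeasure K β C l ≤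
        c * levelSum β l (fun w => ∫⁻ x in edge w, h x ∂lengthMeasure K) ∧
      levelSum β l (fun w => ∫⁻ x in edge w, h x ∂lengthMeasure K) ≤
        c * ∫⁻ x, h x ∂weightedMeasure K β C l := by
  obtain ⟨c, hc, H⟩ := exists_density_comparable β l hC
  refine ⟨c.toNNReal, fun h hh => ?_⟩
  have hcc : ((c.toNNReal : ℝ≥0) : ℝ≥0∞) = ENNReal.ofReal c := rfl
  have hρ : Measurable fun x : Tree K =>
      ENNReal.ofReal (Real.exp (-β * height x) * (height x + C) ^ l) := by
    have := measurable_height (K := K)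
    fun_prop
  have hlen : ∀ {m : ℕ} (v : Fin (m + 1) → Fin K), (List.ofFn v).length = m + 1 :=
    fun v => List.length_ofFn
  rw [hcc, weightedMeasure, lintegral_withDensity_eq_lintegral_mul _ hρ hh, lintegral_lengthMeasure,
    levelSum, ← ENNReal.tsum_mul_left, ← ENNReal.tsum_mul_left]
  constructor
  · refine ENNReal.tsum_le_tsum fun m => ?_
    rw [← mul_assoc, Finset.mul_sum]
    refine Finset.sum_le_sum fun v _ => ?_
    rw [← lintegral_const_mul _ hh]
    refine setLIntegral_mono' (measurableSet_edge _) fun x hx => ?_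
    rw [Pi.mul_apply, levelWeight, ← ENNReal.ofReal_mul hc.le]
    obtain ⟨h1, h2⟩ := height_mem_of_mem_edge (hlen v) hx
    exact mul_le_mul_left (ENNReal.ofReal_le_ofReal (H m _ h1 h2).1) _
  · refine ENNReal.tsum_le_tsum fun m => ?_
    rw [Finset.mul_sum, Finset.mul_sum]
    refine Finset.sum_le_sum fun v _ => ?_
    rw [← lintegral_const_mul _ hh, ← lintegral_const_mul _ (hρ.mul hh)]
    refine setLIntegral_mono' (measurableSet_edge _) fun x hx => ?_
    rw [Pi.mul_apply, levelWeight, ← mul_assoc, ← ENNReal.ofReal_mul hc.le]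
    obtain ⟨h1, h2⟩ := height_mem_of_mem_edge (hlen v) hx
    exact mul_le_mul_left (ENNReal.ofReal_le_ofReal (H m _ h1 h2).2) _

lemma measurable_arcDensity {K : ℕ} (ε : ℝ) :
    Measurable fun x : Tree K => ENNReal.ofReal (Real.exp (-ε * height x)) := by
  have := measurable_height (K := K)
  fun_prop

lemma setLIntegral_arcLength_edge_le {K m : ℕ} {ε : ℝ} (hε : 0 ≤ ε) {w : List (Fin K)}
    (hw : w.length = m + 1) {g : Tree K → ℝ≥0∞} (hg : Measurable g) :
    ∫⁻ x in edge w, g x ∂arcLength K ε ≤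
      ENNReal.ofReal (Real.exp (-ε * m)) * ∫⁻ x in edge w, g x ∂lengthMeasure K := by
  rw [arcLength, setLIntegral_withDensity_eq_setLIntegral_mul _ (measurable_arcDensity ε) hg
    (measurableSet_edge w), ← lintegral_const_mul _ hg]
  refine setLIntegral_mono' (measurableSet_edge _) fun x hx => ?_
  obtain ⟨h1, -⟩ := height_mem_of_mem_edge hw hx
  rw [Pi.mul_apply]
  gcongr ENNReal.ofReal (Real.exp ?_) * _
  nlinarith

/-- On an edge, a function differs from its value at the mother by at most the integral of an
upper gradient over that edge. -/
lemma IsUpperGradient.abs_sub_le_edge {K : ℕ} {ε : ℝ} {g : Tree K → ℝ≥0∞} {u : Tree K → ℝ}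
    (hg : IsUpperGradient ε g u) {x : Tree K} {w : List (Fin K)} (hx : x ∈ edge w)
    (hw : w ≠ []) :
    ENNReal.ofReal |u x - u (vertexPoint w.dropLast)| ≤
      ∫⁻ z in edge w, g z ∂arcLength K ε := by
  obtain ⟨m, hm⟩ : ∃ m, w.length = m + 1 :=
    Nat.exists_eq_succ_of_ne_zero (by simpa using hw)
  have hxw : x.1.1 = w := hx
  set y : Tree K := vertexPoint w.dropLast with hy
  have hyh : height y = m := by
    change ((w.dropLast.length : ℕ) : ℝ) = m
    simp [hm]
  have hyx : Anc y x := by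
    refine ⟨?_, ?_⟩
    · rw [hxw]; exact List.dropLast_prefix w
    · rw [hyh]; exact (height_mem_of_mem_edge hm hx).1.le
  have hsub : geodesic y x ⊆ edge w ∪ {y} := by
    rintro z ⟨hz1, hz2⟩
    have hyz : Anc y z := hz2 y (Anc.refl y) hyx
    have hzx : Anc z x := hz1.elim (fun h => h.trans hyx) id
    by_cases hzw : z.1.1 = w
    · exact Or.inl hzw
    · refine Or.inr ?_
      have hzp : z.1.1 <+: w := by rw [← hxw]; exact hzx.1
      have hlt : z.1.1.length < m + 1 := by
        refine lt_of_le_of_ne (hm ▸ hzp.length_le) fun h => hzw ?_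
        exact hzp.eq_of_length (h.trans hm.symm)
      have hp : z.1.1 <+: w.dropLast :=
        List.prefix_of_prefix_length_le hzp (List.dropLast_prefix w) (by simp [hm]; omega)
      have hword : y.1.1 = z.1.1 :=
        hyz.1.eq_of_length_le hp.length_le
      have hzh : height z = height y := by
        refine le_antisymm ?_ hyz.2
        rw [hyh]
        refine (height_le_length z).trans ?_
        exact_mod_cast Nat.lt_succ_iff.1 hlt
      exact Subtype.ext (Prod.ext hword.symm hzh)
  have hnull : arcLength K ε {y} = 0 :=
    withDensity_absolutelyContinuous _ _ (lengthMeasure_singleton y)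
  calc ENNReal.ofReal |u x - u y| ≤ ∫⁻ z in geodesic y x, g z ∂arcLength K ε := hg.2 y x
    _ ≤ ∫⁻ z in edge w ∪ {y}, g z ∂arcLength K ε := lintegral_mono_set hsub
    _ ≤ ∫⁻ z in edge w, g z ∂arcLength K ε + ∫⁻ z in {y}, g z ∂arcLength K ε :=
        lintegral_union_le _ _ _
    _ = ∫⁻ z in edge w, g z ∂arcLength K ε := by
        rw [setLIntegral_measure_zero _ _ hnull, add_zero]

/-- The points of the segment `[0, y]` at height more than `a`. -/
def segment {K : ℕ} (a : ℝ) (y : Tree K) : Set (Tree K) := {x | Anc x y ∧ a < height x}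

lemma measurableSet_segment {K : ℕ} (a : ℝ) (y : Tree K) : MeasurableSet (segment a y) := by
  have h1 : MeasurableSet {x : Tree K | x.1.1 <+: y.1.1} :=
    measurable_word (MeasurableSet.of_discrete (s := {v : List (Fin K) | v <+: y.1.1}))
  exact (h1.inter (measurableSet_le measurable_height measurable_const)).inter
    (measurableSet_lt measurable_const measurable_height)

/-- Integration along the segment `[0, y]`, parametrised by the height. -/
lemma le_setLIntegral_segment {K : ℕ} (φ : List (Fin K) → ℝ≥0∞) {a : ℝ} (ha : 0 ≤ a)
    (y : Tree K) :
    ∫⁻ s in Set.Ioc a (height y), φ (y.1.1.take ⌈s⌉₊) ≤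
      ∫⁻ x in segment a y, φ x.1.1 ∂lengthMeasure K := by
  classical
  set F : List (Fin K) × ℝ → ℝ≥0∞ := fun z =>
    {z : List (Fin K) × ℝ | z.1 <+: y.1.1 ∧ z.2 ≤ height y ∧ a < z.2}.indicator
      (fun z => φ z.1) z with hF
  have hFm : Measurable F := by
    refine Measurable.indicator ((measurable_of_countable φ).comp measurable_fst) ?_
    have h1 : MeasurableSet {z : List (Fin K) × ℝ | z.1 <+: y.1.1} :=
      measurable_fst (MeasurableSet.of_discrete (s := {v : List (Fin K) | v <+: y.1.1}))
    exact h1.inter ((measurableSet_le measurable_snd measurable_const).inter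
      (measurableSet_lt measurable_const measurable_snd))
  have e1 : ∫⁻ x in segment a y, φ x.1.1 ∂lengthMeasure K =
      ∫⁻ x : Tree K, F x.1 ∂lengthMeasure K := by
    rw [← lintegral_indicator (measurableSet_segment a y)]
    refine lintegral_congr fun x => ?_
    simp only [hF, Set.indicator_apply, segment, Anc, Set.mem_ofPred_eq, and_assoc]
    rfl
  rw [e1, lengthMeasure, lintegral_subtype_comap (measurableSet_treeSet K),
    ← lintegral_indicator (measurableSet_treeSet K), lintegral_prod_symm _
      (hFm.indicator (measurableSet_treeSet K)).aemeasurable,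
    ← lintegral_indicator measurableSet_Ioc]
  refine lintegral_mono fun s => ?_
  rw [lintegral_count]
  by_cases hs : s ∈ Set.Ioc a (height y)
  · rw [Set.indicator_of_mem hs]
    refine le_trans (le_of_eq ?_) (ENNReal.le_tsum (y.1.1.take ⌈s⌉₊))
    have hlen : (y.1.1.take ⌈s⌉₊).length = ⌈s⌉₊ := by
      rw [List.length_take, length_word, min_eq_left (Nat.ceil_mono hs.2)]
    rw [Set.indicator_of_mem (show (y.1.1.take ⌈s⌉₊, s) ∈ treeSet K from
      ⟨ha.trans hs.1.le, hlen⟩)]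
    simp only [hF]
    rw [Set.indicator_of_mem (show (y.1.1.take ⌈s⌉₊, s) ∈
      {z : List (Fin K) × ℝ | z.1 <+: y.1.1 ∧ z.2 ≤ height y ∧ a < z.2} from
      ⟨List.take_prefix _ _, hs.2, hs.1⟩)]
  · rw [Set.indicator_of_notMem hs]
    exact zero_le

/-- Any two points have a last common ancestor. -/
lemma exists_meet {K : ℕ} (y z : Tree K) :
    ∃ m : Tree K, Anc m y ∧ Anc m z ∧ ∀ w, Anc w y → Anc w z → Anc w m := by
  classical
  set k := Nat.findGreatest (fun k => k ≤ z.1.1.length ∧ y.1.1.take k = z.1.1.take k)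
    y.1.1.length with hk
  have hP : k ≤ z.1.1.length ∧ y.1.1.take k = z.1.1.take k :=
    Nat.findGreatest_spec (P := fun k => k ≤ z.1.1.length ∧ y.1.1.take k = z.1.1.take k)
      (Nat.zero_le _) ⟨Nat.zero_le _, by simp⟩
  have hky : k ≤ y.1.1.length := Nat.findGreatest_le _
  set h : ℝ := min (k : ℝ) (min (height y) (height z)) with hh
  have h0 : 0 ≤ h := le_min (Nat.cast_nonneg _) (le_min (height_nonneg y) (height_nonneg z))
  have hck : ⌈h⌉₊ ≤ k := Nat.ceil_le.2 (min_le_left _ _)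
  have htake : y.1.1.take ⌈h⌉₊ = z.1.1.take ⌈h⌉₊ := by
    have := congrArg (List.take ⌈h⌉₊) hP.2
    rwa [List.take_take, List.take_take, min_eq_left hck] at this
  refine ⟨⟨(y.1.1.take ⌈h⌉₊, h), h0, ?_⟩, ⟨List.take_prefix _ _, ?_⟩, ⟨?_, ?_⟩, ?_⟩
  · simp [hck.trans hky]
  · exact (min_le_right _ _).trans (min_le_left _ _)
  · change y.1.1.take ⌈h⌉₊ <+: z.1.1
    rw [htake]
    exact List.take_prefix _ _
  · exact (min_le_right _ _).trans (min_le_right _ _)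
  · intro w hwy hwz
    have hwk : w.1.1.length ≤ k := by
      refine Nat.le_findGreatest hwy.1.length_le ⟨hwz.1.length_le, ?_⟩
      rw [← List.prefix_iff_eq_take.1 hwy.1, ← List.prefix_iff_eq_take.1 hwz.1]
    have hwh : height w ≤ h := by
      refine le_min ((height_le_length w).trans (by exact_mod_cast hwk)) (le_min hwy.2 hwz.2)
    refine ⟨List.prefix_of_prefix_length_le hwy.1 (List.take_prefix _ _) ?_, hwh⟩
    rw [List.length_take, min_eq_left (hck.trans hky), length_word]
    exact Nat.ceil_mono hwh

/-- The integral along a geodesic is at least the sum of those over its two branches. -/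
lemma le_setLIntegral_geodesic {K : ℕ} (φ : List (Fin K) → ℝ≥0∞) {m y z : Tree K}
    (hy : Anc m y) (hz : Anc m z) (hm : ∀ w, Anc w y → Anc w z → Anc w m) :
    (∫⁻ s in Set.Ioc (height m) (height y), φ (y.1.1.take ⌈s⌉₊)) +
      ∫⁻ s in Set.Ioc (height m) (height z), φ (z.1.1.take ⌈s⌉₊) ≤
      ∫⁻ x in geodesic y z, φ x.1.1 ∂lengthMeasure K := by
  refine (add_le_add (le_setLIntegral_segment φ (height_nonneg m) y)
    (le_setLIntegral_segment φ (height_nonneg m) z)).trans ?_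
  rw [← lintegral_union (measurableSet_segment _ _)]
  · refine lintegral_mono_set ?_
    have key : ∀ {x y' : Tree K}, Anc m y' → x ∈ segment (height m) y' → Anc m x := by
      intro x y' hmy hx
      refine ⟨List.prefix_of_prefix_length_le hmy.1 hx.1.1 ?_, hx.2.le⟩
      rw [length_word, length_word]
      exact Nat.ceil_mono hx.2.le
    rintro x (hx | hx)
    · exact ⟨Or.inl hx.1, fun w h1 h2 => (hm w h1 h2).trans (key hy hx)⟩
    · exact ⟨Or.inr hx.1, fun w h1 h2 => (hm w h1 h2).trans (key hz hx)⟩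
  · refine Set.disjoint_left.2 fun x hx hx' => ?_
    exact absurd (hm x hx.1 hx'.1).2 (not_le.2 hx.2)

/-! ### A weighted Hardy inequality -/

lemma tsum_geometric_ne_top {κ : ℝ} (hκ : 0 < κ) :
    ∑' j : ℕ, ENNReal.ofReal (Real.exp (-κ * j)) ≠ ⊤ := by
  have h1 : ∀ j : ℕ, Real.exp (-κ * j) = Real.exp (-κ) ^ j := fun j => by
    rw [← Real.exp_nat_mul, mul_comm]
  have hs : Summable fun j : ℕ => Real.exp (-κ * j) := by
    simp only [h1]
    exact summable_geometric_of_lt_one (Real.exp_pos _).le (by rw [Real.exp_lt_one_iff]; linarith)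
  rw [← ENNReal.ofReal_tsum_of_nonneg (fun j => (Real.exp_pos _).le) hs]
  exact ENNReal.ofReal_ne_top

/-- Jensen's inequality for a series, with weights `ρ j`. -/
lemma tsum_rpow_le {p : ℝ} (hp : 1 ≤ p) {ρ : ℕ → ℝ≥0∞} (h0 : ∀ j, ρ j ≠ 0) (ht : ∀ j, ρ j ≠ ⊤)
    (a : ℕ → ℝ≥0∞) :
    (∑' j, a j) ^ p ≤ (∑' j, ρ j) ^ (p - 1) * ∑' j, ρ j * ((ρ j)⁻¹ * a j) ^ p := by
  have hp0 : 0 < p := by linarith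
  have h1 : ∑' j, a j ≤
      (∑' j, ρ j) ^ (1 - p⁻¹) * (∑' j, ρ j * ((ρ j)⁻¹ * a j) ^ p) ^ p⁻¹ := by
    rw [ENNReal.tsum_eq_iSup_sum]
    refine iSup_le fun s => ?_
    have e : ∑ j ∈ s, a j = ∑ j ∈ s, ρ j * ((ρ j)⁻¹ * a j) := by
      refine Finset.sum_congr rfl fun j _ => ?_
      rw [← mul_assoc, ENNReal.mul_inv_cancel (h0 j) (ht j), one_mul]
    rw [e]
    refine (ENNReal.inner_le_weight_mul_Lp_of_nonneg s hp ρ _).trans ?_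
    have : 0 ≤ 1 - p⁻¹ := sub_nonneg.2 (inv_le_one_of_one_le₀ hp)
    gcongr <;> exact ENNReal.sum_le_tsum s
  calc _ ≤ ((∑' j, ρ j) ^ (1 - p⁻¹) * (∑' j, ρ j * ((ρ j)⁻¹ * a j) ^ p) ^ p⁻¹) ^ p := by gcongr
    _ = _ := by
      rw [ENNReal.mul_rpow_of_nonneg _ _ hp0.le, ← ENNReal.rpow_mul, ← ENNReal.rpow_mul,
        inv_mul_cancel₀ hp0.ne', ENNReal.rpow_one, sub_mul, inv_mul_cancel₀ hp0.ne', one_mul]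

/-- Hardy's inequality for the tails of a series, with exponentially growing weights `e^{δn} n^l`,
where `n = m + 1`. -/
lemma exists_hardy {p δ : ℝ} (hp : 1 ≤ p) (hδ : 0 < δ) (l : ℝ) :
    ∃ M : ℝ≥0, ∀ a : ℕ → ℝ≥0∞,
      ∑' m, levelWeight (-δ) l m * (∑' j, a (j + m)) ^ p ≤
        M * ∑' m, levelWeight (-δ) l m * a m ^ p := by
  have hp0 : 0 < p := by linarith
  -- the loss `ρ_j^{1-p}` in Jensen's inequality is then at most `e^{δj/2}`, less than the gain
  -- `e^{δj}` from the growth of the weights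
  set κ : ℝ := δ / (2 * p) with hκ
  have hκ0 : 0 < κ := by positivity
  set ρ : ℕ → ℝ≥0∞ := fun j => ENNReal.ofReal (Real.exp (-κ * j)) with hρ
  set σ : ℕ → ℝ≥0∞ := fun j => ENNReal.ofReal (Real.exp (-(δ / 4) * j)) with hσ
  have hρt : ∑' j, ρ j ≠ ⊤ := tsum_geometric_ne_top hκ0
  have hσt : ∑' j, σ j ≠ ⊤ := tsum_geometric_ne_top (by positivity)
  obtain ⟨M, hM, HM⟩ := exists_rpow_le_exp |l| (by positivity : 0 < δ / 4)
  set N : ℝ := M * Real.exp (δ / 4) with hN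
  have hN0 : 0 < N := by positivity
  have hw : ∀ m j : ℕ, ∀ b : ℝ≥0∞, levelWeight (-δ) l m * (ρ j * ((ρ j)⁻¹ * b) ^ p) ≤
      ENNReal.ofReal N * (σ j * (levelWeight (-δ) l (j + m) * b ^ p)) := by
    intro m j b
    have e1 : ρ j * (ρ j)⁻¹ ^ p = ENNReal.ofReal (Real.exp (κ * (p - 1) * j)) := by
      simp only [hρ]
      rw [← ENNReal.ofReal_inv_of_pos (Real.exp_pos _), ← Real.exp_neg,
        ENNReal.ofReal_rpow_of_pos (Real.exp_pos _), ← ENNReal.ofReal_mul (Real.exp_pos _).le,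
        ← Real.exp_mul, ← Real.exp_add]
      congr 2
      ring
    rw [ENNReal.mul_rpow_of_nonneg _ _ hp0.le, ← mul_assoc (ρ j), e1, ← mul_assoc, ← mul_assoc,
      ← mul_assoc]
    refine mul_le_mul_left ?_ _
    simp only [hσ, levelWeight]
    rw [← ENNReal.ofReal_mul (by positivity), ← ENNReal.ofReal_mul (by positivity),
      ← ENNReal.ofReal_mul (by positivity)]
    apply ENNReal.ofReal_le_ofReal
    push_cast
    have hx1 : (1 : ℝ) ≤ (m : ℝ) + 1 := by linarith [(Nat.cast_nonneg m : (0 : ℝ) ≤ m)]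
    have hj : (0 : ℝ) ≤ j := Nat.cast_nonneg j
    rw [show (j : ℝ) + m + 1 = (m + 1) + j by ring]
    generalize (m : ℝ) + 1 = x at *
    generalize (j : ℝ) = y at *
    have hx0 : 0 < x := by linarith
    have hxl : x ^ l ≤ (1 + y) ^ |l| * (x + y) ^ l := by
      rcases le_total 0 l with hl | hl
      · have h1 : x ^ l ≤ (x + y) ^ l := Real.rpow_le_rpow hx0.le (by linarith) hl
        have h2 : (1 : ℝ) ≤ (1 + y) ^ |l| := Real.one_le_rpow (by linarith) (abs_nonneg _)
        exact h1.trans (le_mul_of_one_le_left (by positivity) h2)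
      · have h1 : (x + y) / (1 + y) ≤ x := by
          rw [div_le_iff₀ (by positivity)]
          nlinarith
        have h2 := Real.rpow_le_rpow_of_nonpos (by positivity) h1 hl
        rw [Real.div_rpow (by positivity) (by positivity)] at h2
        rw [abs_of_nonpos hl, Real.rpow_neg (by positivity)]
        rwa [mul_comm, ← div_eq_mul_inv]
    have h3 := HM (1 + y) (by linarith)
    have h4 : κ * (p - 1) ≤ δ / 2 := by
      rw [hκ, div_mul_eq_mul_div, div_le_div_iff₀ (by positivity) two_pos]
      nlinarith
    calc Real.exp (- -δ * x) * x ^ l * Real.exp (κ * (p - 1) * y)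
        ≤ Real.exp (- -δ * x) * ((M * Real.exp (δ / 4 * (1 + y))) * (x + y) ^ l) *
          Real.exp (δ / 2 * y) := by
          gcongr
          exact hxl.trans (by gcongr)
      _ = M * (Real.exp (- -δ * x) * Real.exp (δ / 4 * (1 + y)) * Real.exp (δ / 2 * y)) *
          (x + y) ^ l := by ring
      _ = M * (Real.exp (δ / 4) * Real.exp (-(δ / 4) * y) * Real.exp (- -δ * (x + y))) *
          (x + y) ^ l := by
          simp only [← Real.exp_add]
          ring_nf
      _ = _ := by rw [hN]; ring
  refine ⟨((∑' j, ρ j) ^ (p - 1) * (ENNReal.ofReal N * ∑' j, σ j)).toNNReal, fun a => ?_⟩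
  have hp1 : 0 ≤ p - 1 := by linarith
  rw [ENNReal.coe_toNNReal (by finiteness)]
  set S := ∑' m, levelWeight (-δ) l m * a m ^ p with hS
  calc ∑' m, levelWeight (-δ) l m * (∑' j, a (j + m)) ^ p
      ≤ ∑' m, levelWeight (-δ) l m * ((∑' j, ρ j) ^ (p - 1) *
          ∑' j, ρ j * ((ρ j)⁻¹ * a (j + m)) ^ p) := by
        gcongr with m
        exact tsum_rpow_le hp (fun j => by simp [hρ, Real.exp_pos]) (fun j => by simp [hρ]) _
    _ = (∑' j, ρ j) ^ (p - 1) * ∑' m, ∑' j,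
          levelWeight (-δ) l m * (ρ j * ((ρ j)⁻¹ * a (j + m)) ^ p) := by
        rw [← ENNReal.tsum_mul_left]
        refine tsum_congr fun m => ?_
        rw [ENNReal.tsum_mul_left, mul_left_comm]
    _ ≤ (∑' j, ρ j) ^ (p - 1) * ∑' m, ∑' j,
          ENNReal.ofReal N * (σ j * (levelWeight (-δ) l (j + m) * a (j + m) ^ p)) := by
        refine mul_le_mul_right ?_ _
        exact ENNReal.tsum_le_tsum fun m => ENNReal.tsum_le_tsum fun j => hw m j _
    _ = (∑' j, ρ j) ^ (p - 1) * (ENNReal.ofReal N *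
          ∑' j, σ j * ∑' m, levelWeight (-δ) l (j + m) * a (j + m) ^ p) := by
        rw [ENNReal.tsum_comm]
        simp only [ENNReal.tsum_mul_left]
    _ ≤ (∑' j, ρ j) ^ (p - 1) * (ENNReal.ofReal N * ∑' j, σ j * S) := by
        gcongr with j
        exact ENNReal.tsum_comp_le_tsum_of_injective (add_right_injective j)
          (fun i => levelWeight (-δ) l i * a i ^ p)
    _ = _ := by rw [ENNReal.tsum_mul_right]; ring

/-! ### Cylinders and averages on the boundary -/

variable {K : ℕ}

lemma length_rayVertex (ξ : Boundary K) (n : ℕ) : (rayVertex ξ n).length = n := by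
  simp [rayVertex]

lemma take_rayVertex (ξ : Boundary K) {m n : ℕ} (h : m ≤ n) :
    (rayVertex ξ n).take m = rayVertex ξ m := by
  refine List.ext_getElem (by simp [rayVertex, h]) fun i h1 h2 => ?_
  simp [rayVertex]

lemma dropLast_rayVertex (ξ : Boundary K) (n : ℕ) :
    (rayVertex ξ (n + 1)).dropLast = rayVertex ξ n := by
  rw [List.dropLast_eq_take, length_rayVertex, Nat.add_sub_cancel, take_rayVertex _ (Nat.le_succ n)]

lemma measurable_rayVertex (n : ℕ) : Measurable fun ξ : Boundary K => rayVertex ξ n := by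
  have h1 : Measurable fun ξ : Boundary K => fun i : Fin n => ξ i :=
    measurable_pi_lambda _ fun i => measurable_pi_apply _
  exact (measurable_of_countable (List.ofFn (n := n))).comp h1

lemma measurableSet_cyl (v : List (Fin K)) : MeasurableSet (cyl v) :=
  measurable_rayVertex v.length (measurableSet_singleton v)

lemma mem_cyl_ofFn {n : ℕ} {v : Fin n → Fin K} {ξ : Boundary K} :
    ξ ∈ cyl (List.ofFn v) ↔ rayVertex ξ n = List.ofFn v := by
  simp [cyl]

lemma cyl_subset_cyl_dropLast (v : List (Fin K)) : cyl v ⊆ cyl v.dropLast := by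
  intro ξ hξ
  have hξ' : rayVertex ξ v.length = v := hξ
  change rayVertex ξ v.dropLast.length = v.dropLast
  conv_rhs => rw [← hξ']
  rw [List.length_dropLast, List.dropLast_eq_take, length_rayVertex,
    take_rayVertex _ (Nat.sub_le _ _)]

lemma lintegral_eq_sum_cyl (ν : Measure (Boundary K)) (n : ℕ) (h : Boundary K → ℝ≥0∞) :
    ∫⁻ ξ, h ξ ∂ν = ∑ v : Fin n → Fin K, ∫⁻ ξ in cyl (List.ofFn v), h ξ ∂ν := by
  have hU : (⋃ v : Fin n → Fin K, cyl (List.ofFn v)) = Set.univ :=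
    Set.eq_univ_of_forall fun ξ => Set.mem_iUnion.2 ⟨fun i => ξ i, mem_cyl_ofFn.2 rfl⟩
  rw [← setLIntegral_univ, ← hU, lintegral_iUnion (fun _ => measurableSet_cyl _), tsum_fintype]
  intro v w hvw
  refine Set.disjoint_left.2 fun ξ hξ hξ' => hvw ?_
  exact List.ofFn_injective ((mem_cyl_ofFn.1 hξ).symm.trans (mem_cyl_ofFn.1 hξ'))

lemma lintegral_rayVertex (ν : Measure (Boundary K)) (n : ℕ) (F : List (Fin K) → ℝ≥0∞) :
    ∫⁻ ξ, F (rayVertex ξ n) ∂ν = ∑ v : Fin n → Fin K, ν (cyl (List.ofFn v)) * F (List.ofFn v) := by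
  rw [lintegral_eq_sum_cyl ν n]
  refine Finset.sum_congr rfl fun v _ => ?_
  rw [setLIntegral_congr_fun (g := fun _ => F (List.ofFn v)) (measurableSet_cyl _)
    (fun ξ hξ => by simp only [mem_cyl_ofFn.1 hξ]), setLIntegral_const, mul_comm]

/-- Every vertex is the mother of `K` vertices. -/
lemma sum_setLIntegral_cyl_dropLast (ν : Measure (Boundary K)) (m : ℕ) (h : Boundary K → ℝ≥0∞) :
    ∑ v : Fin (m + 1) → Fin K, ∫⁻ ξ in cyl (List.ofFn v).dropLast, h ξ ∂ν =
      K * ∫⁻ ξ, h ξ ∂ν := by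
  rw [← (Fin.snocEquiv fun _ => Fin K).sum_comp, Fintype.sum_prod_type]
  have : ∀ (i : Fin K) (v : Fin m → Fin K),
      (List.ofFn ((Fin.snocEquiv fun _ => Fin K) (i, v))).dropLast = List.ofFn v := by
    intro i v
    rw [List.ofFn_succ']
    simp [Fin.snocEquiv]
  simp only [this, ← lintegral_eq_sum_cyl ν m h]
  simp

/-- Jensen's inequality. -/
lemma rpow_lintegral_le {α : Type*} [MeasurableSpace α] {P : Measure α} [IsProbabilityMeasure P]
    {p : ℝ} (hp : 1 ≤ p) {h : α → ℝ≥0∞} (hh : AEMeasurable h P) :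
    (∫⁻ x, h x ∂P) ^ p ≤ ∫⁻ x, h x ^ p ∂P := by
  have hp0 : 0 < p := by linarith
  have h1 := eLpNorm'_le_eLpNorm'_mul_rpow_measure_univ (μ := P) one_pos hp
    hh.aestronglyMeasurable
  simp only [eLpNorm', enorm_eq_self, ENNReal.rpow_one, measure_univ, ENNReal.one_rpow, mul_one,
    div_one] at h1
  calc _ ≤ ((∫⁻ x, h x ^ p ∂P) ^ (1 / p)) ^ p := by gcongr
    _ = _ := by rw [← ENNReal.rpow_mul, one_div_mul_cancel hp0.ne', ENNReal.rpow_one]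

/-- Jensen's inequality for `|f - c|^p` and the average of `f` over `s`. -/
lemma measure_mul_setAverage_sub_le {α : Type*} [MeasurableSpace α] {ν : Measure α}
    [IsFiniteMeasure ν] {p : ℝ} (hp : 1 ≤ p) {f : α → ℝ} (hf : Integrable f ν) (c : ℝ)
    (s : Set α) :
    ν s * ‖(⨍ x in s, f x ∂ν) - c‖ₑ ^ p ≤ ∫⁻ x in s, ‖f x - c‖ₑ ^ p ∂ν := by
  rcases eq_or_ne (ν s) 0 with h0 | h0
  · simp [h0]
  have hst : ν s ≠ ⊤ := measure_ne_top _ _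
  set P : Measure α := (ν s)⁻¹ • ν.restrict s with hP
  have hPp : IsProbabilityMeasure P := ⟨by
    rw [hP, Measure.smul_apply, Measure.restrict_apply_univ, smul_eq_mul,
      ENNReal.inv_mul_cancel h0 hst]⟩
  have hfP : Integrable f P := by
    rw [hP]
    exact hf.integrableOn.smul_measure (ENNReal.inv_ne_top.2 h0)
  have e1 : (⨍ x in s, f x ∂ν) - c = ∫ x, (f x - c) ∂P := by
    rw [integral_sub hfP (integrable_const c), integral_const, probReal_univ, one_smul,
      average, hP, Measure.restrict_apply_univ]
  have e2 : ‖(⨍ x in s, f x ∂ν) - c‖ₑ ^ p ≤ (ν s)⁻¹ * ∫⁻ x in s, ‖f x - c‖ₑ ^ p ∂ν := by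
    rw [e1]
    calc _ ≤ (∫⁻ x, ‖f x - c‖ₑ ∂P) ^ p := by
          gcongr
          exact enorm_integral_le_lintegral_enorm _
      _ ≤ ∫⁻ x, ‖f x - c‖ₑ ^ p ∂P :=
          rpow_lintegral_le hp (hfP.sub (integrable_const c)).aestronglyMeasurable.enorm
      _ = _ := by rw [hP, lintegral_smul_measure, smul_eq_mul]
  calc _ ≤ ν s * ((ν s)⁻¹ * ∫⁻ x in s, ‖f x - c‖ₑ ^ p ∂ν) := by gcongr
    _ = _ := by rw [← mul_assoc, ENNReal.mul_inv_cancel h0 hst, one_mul]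

/-- The filtration of the boundary generated by the first `n` letters. -/
def rayFiltration (K : ℕ) : Filtration ℕ (MeasurableSpace.pi : MeasurableSpace (Boundary K)) where
  seq n := MeasurableSpace.comap (fun ξ => rayVertex ξ n) ⊤
  mono' m n hmn := by
    have : (fun ξ : Boundary K => rayVertex ξ m) =
        (fun w : List (Fin K) => w.take m) ∘ fun ξ => rayVertex ξ n :=
      funext fun ξ => (take_rayVertex ξ hmn).symm
    change MeasurableSpace.comap (fun ξ : Boundary K => rayVertex ξ m) ⊤ ≤ _
    rw [this, ← MeasurableSpace.comap_comp]
    exact MeasurableSpace.comap_mono le_top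
  le' n := (measurable_rayVertex n).comap_le

lemma iSup_rayFiltration :
    (⨆ n, rayFiltration K n) = (MeasurableSpace.pi : MeasurableSpace (Boundary K)) := by
  refine le_antisymm (iSup_le fun n => (rayFiltration K).le n) ?_
  refine iSup_le fun i => ?_
  refine le_trans ?_ (le_iSup _ (i + 1))
  have h : (fun ξ : Boundary K => some (ξ i)) =
      (fun w : List (Fin K) => w[i]?) ∘ fun ξ => rayVertex ξ (i + 1) := by
    funext ξ
    simp [rayVertex, -List.ofFn_succ]
  rintro s ⟨t, -, rfl⟩
  refine ⟨{w | ∃ a ∈ t, w[i]? = some a}, trivial, ?_⟩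
  ext ξ
  have h' : some (ξ i) = (rayVertex ξ (i + 1))[i]? := congrFun h ξ
  simp [← h']

/-- The averages of an integrable function over the cylinders around a boundary point converge to
the function almost everywhere: they are the conditional expectations with respect to
`rayFiltration`, so that Lévy's upward theorem applies. -/
lemma tendsto_average_cyl {ν : Measure (Boundary K)} [IsFiniteMeasure ν] {f : Boundary K → ℝ}
    (hf : Integrable f ν) :
    ∀ᵐ ξ ∂ν, Tendsto (fun n => ⨍ ζ in cyl (rayVertex ξ n), f ζ ∂ν) atTop (𝓝 (f ξ)) := by
  have h1 := tendsto_ae_condExp (μ := ν) (ℱ := rayFiltration K) f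
  rw [iSup_rayFiltration] at h1
  have h2 : ν[f | (MeasurableSpace.pi : MeasurableSpace (Boundary K))] =ᵐ[ν] f :=
    condExp_of_aestronglyMeasurable' le_rfl hf.1 hf
  have h3 : ∀ n, (fun ξ => ⨍ ζ in cyl (rayVertex ξ n), f ζ ∂ν) =ᵐ[ν] ν[f | rayFiltration K n] := by
    intro n
    set A : List (Fin K) → ℝ := fun w => ⨍ ζ in cyl w, f ζ ∂ν with hA
    have hmeas : Measurable[rayFiltration K n] fun ξ => A (rayVertex ξ n) :=
      (measurable_of_countable A).comp (comap_measurable _)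
    have hmeas' : Measurable fun ξ => A (rayVertex ξ n) :=
      hmeas.mono ((rayFiltration K).le n) le_rfl
    have hint : Integrable (fun ξ => A (rayVertex ξ n)) ν := by
      refine Integrable.of_bound hmeas'.aestronglyMeasurable
        (∑ v : Fin n → Fin K, ‖A (List.ofFn v)‖) (Eventually.of_forall fun ξ => ?_)
      exact Finset.single_le_sum (f := fun v : Fin n → Fin K => ‖A (List.ofFn v)‖)
        (fun _ _ => norm_nonneg _) (Finset.mem_univ fun i : Fin n => ξ i)
    refine ae_eq_condExp_of_forall_setIntegral_eq ((rayFiltration K).le n) hf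
      (fun s _ _ => hint.integrableOn) ?_ hmeas.stronglyMeasurable.aestronglyMeasurable
    rintro s ⟨t, -, rfl⟩ -
    classical
    have hs : (fun ξ : Boundary K => rayVertex ξ n) ⁻¹' t =
        ⋃ v ∈ (Finset.univ.filter fun v : Fin n → Fin K => List.ofFn v ∈ t), cyl (List.ofFn v) := by
      ext ξ
      simp only [Set.mem_preimage, Finset.mem_filter, Finset.mem_univ, true_and, Set.mem_iUnion,
        mem_cyl_ofFn, exists_prop]
      constructor
      · intro h
        exact ⟨fun i => ξ i, h, rfl⟩
      · rintro ⟨v, hv, h⟩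
        rwa [h]
    have hd : Set.PairwiseDisjoint
        (↑(Finset.univ.filter fun v : Fin n → Fin K => List.ofFn v ∈ t))
        fun v : Fin n → Fin K => cyl (List.ofFn v) := by
      intro v _ w _ hvw
      refine Set.disjoint_left.2 fun ξ hξ hξ' => hvw ?_
      exact List.ofFn_injective ((mem_cyl_ofFn.1 hξ).symm.trans (mem_cyl_ofFn.1 hξ'))
    rw [hs, integral_biUnion_finset _ (fun v _ => measurableSet_cyl _) hd
      (fun v _ => hint.integrableOn), integral_biUnion_finset _ (fun v _ => measurableSet_cyl _) hd
      (fun v _ => hf.integrableOn)]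
    refine Finset.sum_congr rfl fun v _ => ?_
    rw [setIntegral_congr_fun (g := fun _ => A (List.ofFn v)) (measurableSet_cyl _)
      (fun ξ hξ => by simp only [mem_cyl_ofFn.1 hξ]), setIntegral_const]
    exact measure_smul_setAverage _ (measure_ne_top _ _)
  filter_upwards [h1, h2, ae_all_iff.2 h3] with ξ ha hb hc
  rw [← hb]
  exact ha.congr fun n => (hc n).symm

/-! ### Ahlfors regularity -/

lemma ball_eq_cyl {ε : ℝ} (hε : 0 < ε) (m : ℕ) (ξ : Boundary K) :
    {ζ | boundaryDist ε ζ ξ < 2 / ε * Real.exp (-ε * m)} = cyl (rayVertex ξ (m + 1)) := by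
  have hcyl : ∀ ζ : Boundary K, ζ ∈ cyl (rayVertex ξ (m + 1)) ↔ ∀ i < m + 1, ζ i = ξ i := by
    intro ζ
    change rayVertex ζ (rayVertex ξ (m + 1)).length = rayVertex ξ (m + 1) ↔ _
    rw [length_rayVertex, rayVertex, rayVertex, List.ofFn_inj]
    constructor
    · intro h i hi
      exact congrFun h ⟨i, hi⟩
    · intro h
      exact funext fun i => h i i.2
  ext ζ
  rw [hcyl, Set.mem_ofPred_eq, boundaryDist]
  split_ifs with h
  · simp only [h, implies_true, iff_true]
    positivity
  · rw [mul_lt_mul_iff_right₀ (by positivity), Real.exp_lt_exp, neg_mul, neg_mul, neg_lt_neg_iff,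
      mul_lt_mul_iff_right₀ hε, Nat.cast_lt]
    have h2 := PiNat.mem_cylinder_iff_le_firstDiff (E := fun _ => Fin K) h (m + 1)
    rw [← Nat.succ_le_iff, ← h2, PiNat.mem_cylinder_iff]

/-- An Ahlfors regular measure of dimension `log K / ε` gives mass comparable to `K^{-n}` to the
cylinders of level `n ≥ 1`. -/
lemma IsAhlforsRegular.exists_cyl_comparable {ε : ℝ} (hε : 0 < ε)
    {ν : Measure (Boundary K)} (hν : IsAhlforsRegular ε (Real.log K / ε) ν) :
    ∃ b : ℝ≥0, ∀ (m : ℕ) (v : Fin (m + 1) → Fin K),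
      ν (cyl (List.ofFn v)) ≤ b * ENNReal.ofReal (Real.exp (-Real.log K * ((m + 1 : ℕ) : ℝ))) ∧
      ENNReal.ofReal (Real.exp (-Real.log K * ((m + 1 : ℕ) : ℝ))) ≤ b * ν (cyl (List.ofFn v)) := by
  obtain ⟨a, b, ha, hb, H⟩ := hν
  set q : ℝ := (2 / ε) ^ (Real.log K / ε) * Real.exp (Real.log K) with hq
  have hq0 : 0 < q := by positivity
  have key : ∀ (m : ℕ) (v : Fin (m + 1) → Fin K),
      ENNReal.ofReal (a * (q * Real.exp (-Real.log K * ((m + 1 : ℕ) : ℝ)))) ≤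
        ν (cyl (List.ofFn v)) ∧ ν (cyl (List.ofFn v)) ≤
        ENNReal.ofReal (b * (q * Real.exp (-Real.log K * ((m + 1 : ℕ) : ℝ)))) := by
    intro m v
    set ξ : Boundary K := fun i => if h : i < m + 1 then v ⟨i, h⟩ else v 0 with hξ
    have hv : rayVertex ξ (m + 1) = List.ofFn v := by
      rw [rayVertex, List.ofFn_inj]
      funext i
      simp only [hξ, dif_pos i.2]
    have hr : (0 : ℝ) < 2 / ε * Real.exp (-ε * m) := by positivity
    have hr2 : 2 / ε * Real.exp (-ε * m) ≤ 2 / ε := by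
      refine mul_le_of_le_one_right (by positivity) ?_
      rw [Real.exp_le_one_iff, neg_mul]
      exact neg_nonpos.2 (by positivity)
    have h := H ξ _ hr hr2
    have e : (2 / ε * Real.exp (-ε * m)) ^ (Real.log K / ε) =
        q * Real.exp (-Real.log K * ((m + 1 : ℕ) : ℝ)) := by
      rw [Real.mul_rpow (by positivity) (by positivity), ← Real.exp_mul, hq,
        mul_assoc _ (Real.exp (Real.log K)), ← Real.exp_add]
      congr 2
      push_cast
      field_simp
      ring
    rwa [ball_eq_cyl hε, hv, e] at h
  refine ⟨(max (b * q) ((a * q)⁻¹)).toNNReal, fun m v => ?_⟩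
  obtain ⟨h1, h2⟩ := key m v
  have hcoe : (((max (b * q) ((a * q)⁻¹)).toNNReal : ℝ≥0) : ℝ≥0∞) =
    ENNReal.ofReal (max (b * q) ((a * q)⁻¹)) := rfl
  rw [hcoe]
  constructor
  · refine h2.trans ?_
    rw [← ENNReal.ofReal_mul (by positivity)]
    apply ENNReal.ofReal_le_ofReal
    rw [← mul_assoc]
    gcongr
    exact le_max_left _ _
  · refine le_trans ?_ (mul_le_mul_right h1 _)
    rw [← ENNReal.ofReal_mul (by positivity)]
    apply ENNReal.ofReal_le_ofReal
    calc _ = (a * q)⁻¹ * (a * (q * Real.exp (-Real.log K * ((m + 1 : ℕ) : ℝ)))) := by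
          field_simp
      _ ≤ _ := by gcongr; exact le_max_right _ _

/-! ### The trace operator -/

lemma le_rpow_mul_of_rpow_le {p : ℝ} (hp : 0 < p) {x c k : ℝ≥0∞} (h : x ^ p ≤ c * k ^ p) :
    x ≤ c ^ (1 / p) * k := by
  have h1 : (x ^ p) ^ (1 / p) ≤ (c * k ^ p) ^ (1 / p) := by gcongr
  rwa [ENNReal.mul_rpow_of_nonneg _ _ (by positivity), ← ENNReal.rpow_mul, ← ENNReal.rpow_mul,
    mul_one_div_cancel hp.ne', ENNReal.rpow_one, ENNReal.rpow_one] at h1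

lemma levelWeight_mul_exp (β c l : ℝ) (m : ℕ) :
    levelWeight β l m * ENNReal.ofReal (Real.exp (-c * ((m + 1 : ℕ) : ℝ))) =
      levelWeight (β + c) l m := by
  rw [levelWeight, levelWeight, ← ENNReal.ofReal_mul (by positivity), mul_right_comm,
    ← Real.exp_add]
  ring_nf

/-- The `ℓ^p` sum of the integrals of `g` over the edges is controlled by the Luxemburg norm. -/
lemma exists_levelSum_edge_le (hK : 0 < K) {β C p l₁ l₂ : ℝ} (hβ : Real.log K < β)
    (hC : 0 < C) (hΦ : Admissible p l₁) :
    ∃ c : ℝ≥0, ∀ (g : Tree K → ℝ≥0∞) (k : ℝ≥0), Measurable g → 0 < k →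
      ∫⁻ x, PhiE p l₁ (g x / k) ∂weightedMeasure K β C l₂ ≤ 1 →
      levelSum β (l₁ + l₂) (fun w => (∫⁻ x in edge w, g x ∂lengthMeasure K) ^ p) ≤
        c * (k : ℝ≥0∞) ^ p := by
  have hp : 0 < p := zero_lt_one.trans_le hΦ.one_le
  obtain ⟨D, hD⟩ := exists_PhiE_lintegral_le hΦ
  obtain ⟨c, hc⟩ := exists_lintegral_weightedMeasure_comparable K β l₂ hC
  obtain ⟨M, hM⟩ := exists_levelSum_rpow_le hK l₂ hβ hΦ (D * c)
  refine ⟨2 ^ p * M, fun g k hg hk h1 => ?_⟩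
  have hgk : Measurable fun x => g x / k := hg.div_const _
  have hk0 : (k : ℝ≥0∞) ≠ 0 := by exact_mod_cast hk.ne'
  set t : List (Fin K) → ℝ≥0∞ := fun w => 2⁻¹ * ∫⁻ x in edge w, g x / k ∂lengthMeasure K with ht
  have h2 : levelSum β l₂ (fun w => PhiE p l₁ (t w)) ≤ (D * c : ℝ≥0) := by
    calc levelSum β l₂ (fun w => PhiE p l₁ (t w))
        ≤ levelSum β l₂
          (fun w => D * ∫⁻ x in edge w, PhiE p l₁ (g x / k) ∂lengthMeasure K) := by
          refine levelSum_mono _ _ fun m v => ?_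
          have : IsProbabilityMeasure ((lengthMeasure K).restrict (edge (List.ofFn v))) :=
            ⟨by rw [Measure.restrict_apply_univ, lengthMeasure_edge List.length_ofFn]⟩
          exact hD _ _ hgk
      _ ≤ D * (c * 1) := by
          rw [levelSum_const_mul]
          gcongr
          refine ((hc _ ((measurable_PhiE p l₁).comp hgk)).2).trans ?_
          exact mul_le_mul_right h1 _
      _ = _ := by push_cast; ring
  have h3 := hM t h2
  have h4 : ∀ w, (∫⁻ x in edge w, g x ∂lengthMeasure K) ^ p = 2 ^ p * (k : ℝ≥0∞) ^ p * t w ^ p := by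
    intro w
    rw [← ENNReal.mul_rpow_of_nonneg _ _ hp.le, ← ENNReal.mul_rpow_of_nonneg _ _ hp.le]
    congr 1
    simp only [ht, div_eq_mul_inv]
    rw [lintegral_mul_const _ hg]
    calc _ = (2 * 2⁻¹ : ℝ≥0∞) * (k * (k : ℝ≥0∞)⁻¹) * ∫⁻ x in edge w, g x ∂lengthMeasure K := by
          rw [ENNReal.mul_inv_cancel two_ne_zero (by simp), ENNReal.mul_inv_cancel hk0 (by simp)]
          simp
      _ = _ := by ring
  simp only [h4, levelSum_const_mul]
  calc _ ≤ 2 ^ p * (k : ℝ≥0∞) ^ p * M := by gcongr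
    _ = _ := by
      rw [ENNReal.coe_mul, ENNReal.coe_rpow_of_nonneg _ hp.le]
      push_cast
      ring

/-- The integral of `g` with respect to arc length over the `(m + 1)`-st edge of the ray `ξ`. -/
noncomputable def rayEdgeIntegral (ε : ℝ) (g : Tree K → ℝ≥0∞) (m : ℕ) (ξ : Boundary K) : ℝ≥0∞ :=
  ∫⁻ x in edge (rayVertex ξ (m + 1)), g x ∂arcLength K ε

/-- The integral of `g` with respect to arc length over the part of the ray `ξ` beyond level `m`. -/
noncomputable def rayTail (ε : ℝ) (g : Tree K → ℝ≥0∞) (m : ℕ) (ξ : Boundary K) : ℝ≥0∞ :=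
  ∑' j, rayEdgeIntegral ε g (j + m) ξ

lemma measurable_rayEdgeIntegral (ε : ℝ) (g : Tree K → ℝ≥0∞) (m : ℕ) :
    Measurable (rayEdgeIntegral ε g m) :=
  (measurable_of_countable fun w => ∫⁻ x in edge w, g x ∂arcLength K ε).comp
    (measurable_rayVertex (m + 1))

lemma measurable_rayTail (ε : ℝ) (g : Tree K → ℝ≥0∞) (m : ℕ) : Measurable (rayTail ε g m) :=
  Measurable.tsum fun j => measurable_rayEdgeIntegral ε g (j + m)

lemma rayEdgeIntegral_le_rayTail (ε : ℝ) (g : Tree K → ℝ≥0∞) (m : ℕ) (ξ : Boundary K) :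
    rayEdgeIntegral ε g m ξ ≤ rayTail ε g m ξ := by
  have := ENNReal.le_tsum (f := fun j => rayEdgeIntegral ε g (j + m) ξ) 0
  simpa [rayTail] using this

lemma exists_sum_rayTail_le (hK : 0 < K) {ε β C p l₁ l₂ θ : ℝ} (hε : 0 < ε)
    (hβ : Real.log K < β) (hC : 0 < C) (hΦ : Admissible p l₁) (hθ0 : 0 < θ)
    (hθ : ε * θ * p = ε * p - (β - Real.log K)) {ν : Measure (Boundary K)}
    (hν : IsAhlforsRegular ε (Real.log K / ε) ν) :
    ∃ c : ℝ≥0, ∀ (g : Tree K → ℝ≥0∞) (k : ℝ≥0), Measurable g → 0 < k →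
      ∫⁻ x, PhiE p l₁ (g x / k) ∂weightedMeasure K β C l₂ ≤ 1 →
      ∑' m, levelWeight (-(ε * θ * p)) (l₁ + l₂) m * ∫⁻ ξ, rayTail ε g m ξ ^ p ∂ν ≤
        c * (k : ℝ≥0∞) ^ p := by
  have hp1 := hΦ.one_le
  have hp : 0 < p := zero_lt_one.trans_le hp1
  obtain ⟨c, hc⟩ := exists_levelSum_edge_le (l₂ := l₂) hK hβ hC hΦ
  obtain ⟨M, hM⟩ := exists_hardy hp1 (by positivity : 0 < ε * θ * p) (l₁ + l₂)
  obtain ⟨b, hb⟩ := hν.exists_cyl_comparable hε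
  set e : ℝ≥0 := (Real.exp (ε * p)).toNNReal with he
  refine ⟨M * (b * e * c), fun g k hg hk h1 => ?_⟩
  have h2 := hc g k hg hk h1
  have h3 : ∑' m, levelWeight (-(ε * θ * p)) (l₁ + l₂) m * ∫⁻ ξ, rayEdgeIntegral ε g m ξ ^ p ∂ν ≤
      b * e * levelSum β (l₁ + l₂) (fun w => (∫⁻ x in edge w, g x ∂lengthMeasure K) ^ p) := by
    rw [levelSum, ← ENNReal.tsum_mul_left]
    refine ENNReal.tsum_le_tsum fun m => ?_
    have h4 : ∫⁻ ξ, rayEdgeIntegral ε g m ξ ^ p ∂ν =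
        ∑ v : Fin (m + 1) → Fin K, ν (cyl (List.ofFn v)) *
          (∫⁻ x in edge (List.ofFn v), g x ∂arcLength K ε) ^ p :=
      lintegral_rayVertex ν (m + 1) fun w => (∫⁻ x in edge w, g x ∂arcLength K ε) ^ p
    rw [h4, Finset.mul_sum, Finset.mul_sum, Finset.mul_sum]
    refine Finset.sum_le_sum fun v _ => ?_
    have h5 : ENNReal.ofReal (Real.exp (-ε * m)) ^ p =
        e * ENNReal.ofReal (Real.exp (-(ε * p) * ((m + 1 : ℕ) : ℝ))) := by
      change _ = ENNReal.ofReal (Real.exp (ε * p)) * _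
      rw [ENNReal.ofReal_rpow_of_pos (Real.exp_pos _), ← ENNReal.ofReal_mul (Real.exp_pos _).le,
        ← Real.exp_mul, ← Real.exp_add]
      congr 2
      push_cast
      ring
    calc _ ≤ levelWeight (-(ε * θ * p)) (l₁ + l₂) m *
          ((b * ENNReal.ofReal (Real.exp (-Real.log K * ((m + 1 : ℕ) : ℝ)))) *
          (ENNReal.ofReal (Real.exp (-ε * m)) *
            ∫⁻ x in edge (List.ofFn v), g x ∂lengthMeasure K) ^ p) := by
          gcongr
          · exact (hb m v).1
          · exact setLIntegral_arcLength_edge_le hε.le List.length_ofFn hg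
      _ = b * e * ((levelWeight (-(ε * θ * p)) (l₁ + l₂) m *
          ENNReal.ofReal (Real.exp (-Real.log K * ((m + 1 : ℕ) : ℝ))) *
          ENNReal.ofReal (Real.exp (-(ε * p) * ((m + 1 : ℕ) : ℝ)))) *
            (∫⁻ x in edge (List.ofFn v), g x ∂lengthMeasure K) ^ p) := by
          rw [ENNReal.mul_rpow_of_nonneg _ _ hp.le, h5]
          ring
      _ = _ := by
          rw [levelWeight_mul_exp, levelWeight_mul_exp,
            show -(ε * θ * p) + Real.log K + ε * p = β by rw [hθ]; ring]
  calc ∑' m, levelWeight (-(ε * θ * p)) (l₁ + l₂) m * ∫⁻ ξ, rayTail ε g m ξ ^ p ∂ν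
      = ∫⁻ ξ, ∑' m, levelWeight (-(ε * θ * p)) (l₁ + l₂) m * rayTail ε g m ξ ^ p ∂ν := by
        rw [lintegral_tsum fun m =>
          (((measurable_rayTail ε g m).pow_const p).const_mul _).aemeasurable]
        refine tsum_congr fun m => ?_
        rw [lintegral_const_mul _ ((measurable_rayTail ε g m).pow_const p)]
    _ ≤ ∫⁻ ξ, M * ∑' m, levelWeight (-(ε * θ * p)) (l₁ + l₂) m * rayEdgeIntegral ε g m ξ ^ p ∂ν :=
        lintegral_mono fun ξ => hM fun m => rayEdgeIntegral ε g m ξ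
    _ = M * ∑' m, levelWeight (-(ε * θ * p)) (l₁ + l₂) m *
          ∫⁻ ξ, rayEdgeIntegral ε g m ξ ^ p ∂ν := by
        rw [lintegral_const_mul' _ _ (by simp), lintegral_tsum fun m =>
          (((measurable_rayEdgeIntegral ε g m).pow_const p).const_mul _).aemeasurable]
        congr 1
        refine tsum_congr fun m => ?_
        rw [lintegral_const_mul _ ((measurable_rayEdgeIntegral ε g m).pow_const p)]
    _ ≤ M * (b * e * (c * (k : ℝ≥0∞) ^ p)) := by
        gcongr
        exact h3.trans (by gcongr)
    _ = _ := by push_cast; ring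

/-- Along a ray on which an upper gradient is integrable, the function converges. -/
lemma IsUpperGradient.exists_tendsto_ray {ε : ℝ} {g : Tree K → ℝ≥0∞} {u : Tree K → ℝ}
    (hg : IsUpperGradient ε g u) {ξ : Boundary K} (hξ : rayTail ε g 0 ξ ≠ ⊤) :
    ∃ a : ℝ, Tendsto (fun s : ℝ≥0 => u (rayPoint ξ s)) atTop (𝓝 a) ∧
      Tendsto (fun m : ℕ => u (vertexPoint (rayVertex ξ m))) atTop (𝓝 a) ∧
      ∀ m, ‖a - u (vertexPoint (rayVertex ξ m))‖ₑ ≤ rayTail ε g m ξ := by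
  have hedge : ∀ (m : ℕ) (x : Tree K), x ∈ edge (rayVertex ξ (m + 1)) →
      edist (u (vertexPoint (rayVertex ξ m))) (u x) ≤ rayEdgeIntegral ε g m ξ := by
    intro m x hx
    have h := hg.abs_sub_le_edge hx
      (fun h => by simpa [length_rayVertex] using congrArg List.length h)
    rw [dropLast_rayVertex] at h
    rw [edist_comm, edist_dist, Real.dist_eq]
    exact h
  have hstep : ∀ m : ℕ, edist (u (vertexPoint (rayVertex ξ m)))
      (u (vertexPoint (rayVertex ξ (m + 1)))) ≤ rayEdgeIntegral ε g m ξ :=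
    fun m => hedge m _ rfl
  have hsum : ∑' m, rayEdgeIntegral ε g m ξ ≠ ⊤ := hξ
  obtain ⟨a, ha⟩ := cauchySeq_tendsto_of_complete
    (cauchySeq_of_edist_le_of_tsum_ne_top _ hstep hsum)
  have hle : ∀ m, edist (u (vertexPoint (rayVertex ξ m))) a ≤ rayTail ε g m ξ := by
    intro m
    refine (edist_le_tsum_of_edist_le_of_tendsto _ hstep ha m).trans_eq ?_
    simp only [rayTail, add_comm]
  refine ⟨a, ?_, ha, fun m => ?_⟩
  · have htail : Tendsto (fun m => rayTail ε g m ξ) atTop (𝓝 0) :=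
      ENNReal.tendsto_sum_nat_add _ hsum
    have hceil : Tendsto (fun s : ℝ≥0 => ⌈(s : ℝ)⌉₊ - 1) atTop atTop :=
      (tendsto_sub_atTop_nat 1).comp
        (tendsto_nat_ceil_atTop.comp (NNReal.tendsto_coe_atTop.2 tendsto_id))
    have hlim : Tendsto (fun s : ℝ≥0 => 2 * rayTail ε g (⌈(s : ℝ)⌉₊ - 1) ξ) atTop (𝓝 0) := by
      have := ENNReal.Tendsto.const_mul (a := 2) (htail.comp hceil) (Or.inr (by simp))
      simpa using this
    rw [tendsto_iff_edist_tendsto_0]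
    refine tendsto_of_tendsto_of_tendsto_of_le_of_le' tendsto_const_nhds hlim
      (Eventually.of_forall fun _ => zero_le) ?_
    filter_upwards [eventually_gt_atTop 0] with s hs
    have hs1 : ⌈(s : ℝ)⌉₊ - 1 + 1 = ⌈(s : ℝ)⌉₊ :=
      Nat.sub_add_cancel (Nat.one_le_ceil_iff.2 (by exact_mod_cast hs))
    have hmem : rayPoint ξ s ∈ edge (rayVertex ξ (⌈(s : ℝ)⌉₊ - 1 + 1)) := by
      rw [hs1]; rfl
    rw [two_mul]
    refine (edist_triangle_left _ _ (u (vertexPoint (rayVertex ξ (⌈(s : ℝ)⌉₊ - 1))))).trans ?_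
    exact add_le_add ((hedge _ _ hmem).trans (rayEdgeIntegral_le_rayTail _ _ _ _)) (hle _)
  · rw [← edist_eq_enorm_sub, edist_comm]
    exact hle m

/-- The dyadic energy is controlled by the rate of approximation by values at the vertices. -/
lemma besovEnergy_le_of_approx {ε θ p l : ℝ} (hp : 1 ≤ p) {ν : Measure (Boundary K)}
    [IsFiniteMeasure ν] {f : Boundary K → ℝ} (hf : Integrable f ν) (U : List (Fin K) → ℝ)
    {S : ℕ → Boundary K → ℝ≥0∞}
    (h : ∀ᵐ ξ ∂ν, ∀ m, ‖f ξ - U (rayVertex ξ m)‖ₑ ≤ S m ξ) :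
    besovEnergy ε θ p l ν f ≤ 2 ^ (p - 1) * (1 + K) *
      ∑' m, levelWeight (-(ε * θ * p)) l m * ∫⁻ ξ, S m ξ ^ p ∂ν := by
  have hp0 : 0 < p := by linarith
  rw [besovEnergy, ← ENNReal.tsum_mul_left]
  refine ENNReal.tsum_le_tsum fun m => ?_
  have hw : ENNReal.ofReal (Real.exp (ε * ((m + 1 : ℕ) : ℝ) * θ * p) * ((m + 1 : ℕ) : ℝ) ^ l) =
      levelWeight (-(ε * θ * p)) l m := by
    rw [levelWeight]
    congr 3
    ring
  rw [hw, mul_left_comm]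
  refine mul_le_mul_right ?_ _
  have hcyl : ∀ v : Fin (m + 1) → Fin K, ∀ s ⊆ cyl (List.ofFn v).dropLast, MeasurableSet s →
      ν s * ‖(⨍ ξ in s, f ξ ∂ν) - U (List.ofFn v).dropLast‖ₑ ^ p ≤ ∫⁻ ξ in s, S m ξ ^ p ∂ν := by
    intro v s hs hsm
    refine (measure_mul_setAverage_sub_le hp hf _ s).trans ?_
    refine lintegral_mono_ae ?_
    filter_upwards [ae_restrict_of_ae h, ae_restrict_mem hsm] with ξ hξ hξs
    have : rayVertex ξ m = (List.ofFn v).dropLast := by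
      have h1 : rayVertex ξ (List.ofFn v).dropLast.length = (List.ofFn v).dropLast := hs hξs
      simpa using h1
    rw [← this]
    gcongr
    exact hξ m
  calc _ ≤ ∑ v : Fin (m + 1) → Fin K, 2 ^ (p - 1) * (∫⁻ ξ in cyl (List.ofFn v), S m ξ ^ p ∂ν +
        ∫⁻ ξ in cyl (List.ofFn v).dropLast, S m ξ ^ p ∂ν) := by
        refine Finset.sum_le_sum fun v _ => ?_
        set c := U (List.ofFn v).dropLast
        have h1 := hcyl v _ (cyl_subset_cyl_dropLast _) (measurableSet_cyl _)
        have h2 := hcyl v _ subset_rfl (measurableSet_cyl _)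
        have h3 : ‖(⨍ ξ in cyl (List.ofFn v), f ξ ∂ν) -
            ⨍ ξ in cyl (List.ofFn v).dropLast, f ξ ∂ν‖ₑ ^ p ≤
            2 ^ (p - 1) * (‖(⨍ ξ in cyl (List.ofFn v), f ξ ∂ν) - c‖ₑ ^ p +
              ‖(⨍ ξ in cyl (List.ofFn v).dropLast, f ξ ∂ν) - c‖ₑ ^ p) := by
          refine le_trans ?_ (ENNReal.rpow_add_le_mul_rpow_add_rpow _ _ hp)
          gcongr
          rw [← sub_sub_sub_cancel_right _ _ c]
          exact enorm_sub_le
        calc _ ≤ ν (cyl (List.ofFn v)) * (2 ^ (p - 1) *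
              (‖(⨍ ξ in cyl (List.ofFn v), f ξ ∂ν) - c‖ₑ ^ p +
              ‖(⨍ ξ in cyl (List.ofFn v).dropLast, f ξ ∂ν) - c‖ₑ ^ p)) := by gcongr
          _ = 2 ^ (p - 1) * (ν (cyl (List.ofFn v)) *
              ‖(⨍ ξ in cyl (List.ofFn v), f ξ ∂ν) - c‖ₑ ^ p + ν (cyl (List.ofFn v)) *
              ‖(⨍ ξ in cyl (List.ofFn v).dropLast, f ξ ∂ν) - c‖ₑ ^ p) := by ring
          _ ≤ 2 ^ (p - 1) * (ν (cyl (List.ofFn v)) *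
              ‖(⨍ ξ in cyl (List.ofFn v), f ξ ∂ν) - c‖ₑ ^ p + ν (cyl (List.ofFn v).dropLast) *
              ‖(⨍ ξ in cyl (List.ofFn v).dropLast, f ξ ∂ν) - c‖ₑ ^ p) := by
              gcongr
              exact cyl_subset_cyl_dropLast _
          _ ≤ _ := by gcongr
    _ = _ := by
        rw [← Finset.mul_sum, Finset.sum_add_distrib, ← lintegral_eq_sum_cyl ν (m + 1),
          sum_setLIntegral_cyl_dropLast]
        ring

lemma IsUpperGradient.enorm_root_le {ε : ℝ} {g : Tree K → ℝ≥0∞} {u : Tree K → ℝ}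
    (hg : IsUpperGradient ε g u) (hu : Measurable u) (v : Fin 1 → Fin K) :
    ‖u (vertexPoint [])‖ₑ ≤ ∫⁻ x in edge (List.ofFn v), ‖u x‖ₑ ∂lengthMeasure K +
      ∫⁻ x in edge (List.ofFn v), g x ∂arcLength K ε := by
  set A := ∫⁻ x in edge (List.ofFn v), g x ∂arcLength K ε
  have h1 : lengthMeasure K (edge (List.ofFn v)) = 1 := lengthMeasure_edge (m := 0) List.length_ofFn
  calc ‖u (vertexPoint [])‖ₑ
      = ∫⁻ _ in edge (List.ofFn v), ‖u (vertexPoint [])‖ₑ ∂lengthMeasure K := by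
        rw [setLIntegral_const, h1, mul_one]
    _ ≤ ∫⁻ x in edge (List.ofFn v), (‖u x‖ₑ + A) ∂lengthMeasure K := by
        refine setLIntegral_mono' (measurableSet_edge _) fun x hx => ?_
        have h2 := hg.abs_sub_le_edge hx (by simp)
        have h3 : (List.ofFn v).dropLast = [] := by simp [List.ofFn_succ]
        rw [h3, ← Real.enorm_eq_ofReal_abs] at h2
        calc ‖u (vertexPoint [])‖ₑ = ‖u x - (u x - u (vertexPoint []))‖ₑ := by
              rw [sub_sub_cancel]
          _ ≤ ‖u x‖ₑ + ‖u x - u (vertexPoint [])‖ₑ := enorm_sub_le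
          _ ≤ _ := by gcongr
    _ = _ := by rw [lintegral_add_left hu.enorm, setLIntegral_const, h1, mul_one]

/-- Existence of traces, with the bound of the Besov norm. -/
lemma exists_trace (hK : 0 < K) {ε β C p l₁ l₂ θ : ℝ} (hε : 0 < ε)
    (hβ : Real.log K < β) (hC : 0 < C) (hΦ : Admissible p l₁) (hθ0 : 0 < θ)
    (hθ : ε * θ * p = ε * p - (β - Real.log K)) {ν : Measure (Boundary K)} [IsFiniteMeasure ν]
    (hν : IsAhlforsRegular ε (Real.log K / ε) ν) :
    ∃ c : ℝ≥0, ∀ (u : Tree K → ℝ) (g : Tree K → ℝ≥0∞) (k₁ k₂ : ℝ≥0), Measurable u →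
      IsUpperGradient ε g u → 0 < k₁ → 0 < k₂ →
      ∫⁻ x, PhiE p l₁ (‖u x‖ₑ / k₁) ∂weightedMeasure K β C l₂ ≤ 1 →
      ∫⁻ x, PhiE p l₁ (g x / k₂) ∂weightedMeasure K β C l₂ ≤ 1 →
      ∃ F : Lp ℝ (ENNReal.ofReal p) ν,
        (∀ᵐ ξ ∂ν, Tendsto (fun s : ℝ≥0 => u (rayPoint ξ s)) atTop (𝓝 (F ξ))) ∧
        besovNorm ε θ p (l₁ + l₂) ν F ≤ c * (k₁ + k₂) := by
  have hp1 := hΦ.one_le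
  have hp : 0 < p := zero_lt_one.trans_le hp1
  obtain ⟨c₁, hc₁⟩ := exists_levelSum_edge_le (l₂ := l₂) hK hβ hC hΦ
  obtain ⟨c₂, hc₂⟩ := exists_sum_rayTail_le (l₂ := l₂) hK hε hβ hC hΦ hθ0 hθ hν
  set v : Fin 1 → Fin K := fun _ => ⟨0, hK⟩ with hv
  set w₁ := levelWeight β (l₁ + l₂) 0 with hw₁
  set w₂ := levelWeight (-(ε * θ * p)) (l₁ + l₂) 0 with hw₂
  have hw₁0 : w₁ ≠ 0 := levelWeight_ne_zero _ _ _
  have hw₁t : w₁ ≠ ⊤ := levelWeight_ne_top _ _ _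
  have hw₂0 : w₂ ≠ 0 := levelWeight_ne_zero _ _ _
  have hw₂t : w₂ ≠ ⊤ := levelWeight_ne_top _ _ _
  -- `d₁` bounds the integrals over the first edge, `d₂` the `L^p` norm of the gradient along rays
  set d₁ : ℝ≥0∞ := (w₁⁻¹ * c₁) ^ (1 / p) with hd₁
  set d₂ : ℝ≥0∞ := (w₂⁻¹ * c₂) ^ (1 / p) with hd₂
  set d₃ : ℝ≥0∞ := (2 ^ (p - 1) * (1 + K) * c₂) ^ (1 / p) with hd₃
  set N : ℝ≥0∞ := ν Set.univ ^ (1 / p) with hN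
  have hi : 0 ≤ 1 / p := by positivity
  have hp1' : 0 ≤ p - 1 := by linarith
  have hd₁t : d₁ ≠ ⊤ := ENNReal.rpow_ne_top_of_nonneg hi (by finiteness)
  have hd₂t : d₂ ≠ ⊤ := ENNReal.rpow_ne_top_of_nonneg hi (by finiteness)
  have hd₃t : d₃ ≠ ⊤ := ENNReal.rpow_ne_top_of_nonneg hi (by finiteness)
  have hNt : N ≠ ⊤ := ENNReal.rpow_ne_top_of_nonneg hi (measure_ne_top _ _)
  refine ⟨(d₁ * N + d₂ + d₃).toNNReal, fun u g k₁ k₂ hu hg hk₁ hk₂ hi₁ hi₂ => ?_⟩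
  rw [ENNReal.coe_toNNReal (by finiteness)]
  have hfirst : ∀ (h : Tree K → ℝ≥0∞) (k : ℝ≥0), Measurable h → 0 < k →
      ∫⁻ x, PhiE p l₁ (h x / k) ∂weightedMeasure K β C l₂ ≤ 1 →
      ∫⁻ x in edge (List.ofFn v), h x ∂lengthMeasure K ≤ d₁ * k := by
    intro h k hh hk hi
    refine le_rpow_mul_of_rpow_le hp ?_
    have h1 := (le_levelSum β (l₁ + l₂)
      (fun w => (∫⁻ x in edge w, h x ∂lengthMeasure K) ^ p) 0 v).trans (hc₁ h k hh hk hi)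
    rw [mul_assoc, mul_comm, ← div_eq_mul_inv,
      ENNReal.le_div_iff_mul_le (Or.inl hw₁0) (Or.inl hw₁t), mul_comm]
    exact h1
  have hu₁ := hfirst _ k₁ hu.enorm hk₁ hi₁
  have hg₁ : ∫⁻ x in edge (List.ofFn v), g x ∂arcLength K ε ≤ d₁ * k₂ := by
    refine (setLIntegral_arcLength_edge_le (m := 0) hε.le List.length_ofFn hg.1).trans ?_
    simpa using hfirst _ k₂ hg.1 hk₂ hi₂
  set R := ‖u (vertexPoint [])‖ₑ with hR
  have hroot : R ≤ d₁ * (k₁ + k₂) := by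
    rw [mul_add]
    exact (hg.enorm_root_le hu v).trans (add_le_add hu₁ hg₁)
  have htails := hc₂ g k₂ hg.1 hk₂ hi₂
  have htail : (∫⁻ ξ, rayTail ε g 0 ξ ^ p ∂ν) ≤ w₂⁻¹ * c₂ * (k₂ : ℝ≥0∞) ^ p := by
    have h1 := (ENNReal.le_tsum 0).trans htails
    rw [mul_assoc, mul_comm, ← div_eq_mul_inv,
      ENNReal.le_div_iff_mul_le (Or.inl hw₂0) (Or.inl hw₂t), mul_comm]
    exact h1
  have hfin : ∀ᵐ ξ ∂ν, rayTail ε g 0 ξ ≠ ⊤ := by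
    have h1 : ∫⁻ ξ, rayTail ε g 0 ξ ^ p ∂ν ≠ ⊤ := ne_top_of_le_ne_top (by finiteness) htail
    filter_upwards [ae_lt_top ((measurable_rayTail ε g 0).pow_const p) h1] with ξ hξ htop
    rw [htop, ENNReal.top_rpow_of_pos hp] at hξ
    exact lt_irrefl _ hξ
  obtain ⟨f, hfm, hflim⟩ := exists_stronglyMeasurable_limit_of_tendsto_ae
    (f := fun (m : ℕ) (ξ : Boundary K) => u (vertexPoint (rayVertex ξ m)))
    (fun m => ((measurable_of_countable fun w : List (Fin K) => u (vertexPoint w)).comp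
      (measurable_rayVertex m)).aestronglyMeasurable)
    (hfin.mono fun ξ hξ => (hg.exists_tendsto_ray hξ).imp fun _ h => h.2.1)
  have hfray : ∀ᵐ ξ ∂ν, Tendsto (fun s : ℝ≥0 => u (rayPoint ξ s)) atTop (𝓝 (f ξ)) ∧
      ∀ m, ‖f ξ - u (vertexPoint (rayVertex ξ m))‖ₑ ≤ rayTail ε g m ξ := by
    filter_upwards [hfin, hflim] with ξ h1 h2
    obtain ⟨a, ha1, ha2, ha3⟩ := hg.exists_tendsto_ray h1
    obtain rfl := tendsto_nhds_unique ha2 h2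
    exact ⟨ha1, ha3⟩
  have hnorm : eLpNorm f (ENNReal.ofReal p) ν ≤ d₁ * (k₁ + k₂) * N + d₂ * k₂ := by
    rw [eLpNorm_eq_lintegral_rpow_enorm_toReal (by simpa using hp) ENNReal.ofReal_ne_top,
      ENNReal.toReal_ofReal hp.le]
    calc (∫⁻ ξ, ‖f ξ‖ₑ ^ p ∂ν) ^ (1 / p)
        ≤ (∫⁻ ξ, ((fun _ => R) + rayTail ε g 0 : Boundary K → ℝ≥0∞) ξ ^ p ∂ν) ^ (1 / p) := by
          gcongr 1
          refine lintegral_mono_ae ?_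
          filter_upwards [hfray] with ξ hξ
          gcongr
          have h1 := hξ.2 0
          have h2 : rayVertex ξ 0 = [] := by simp [rayVertex]
          rw [h2] at h1
          calc ‖f ξ‖ₑ = ‖u (vertexPoint []) + (f ξ - u (vertexPoint []))‖ₑ := by
                rw [add_sub_cancel]
            _ ≤ R + ‖f ξ - u (vertexPoint [])‖ₑ := enorm_add_le _ _
            _ ≤ _ := by
              rw [Pi.add_apply]
              gcongr
      _ ≤ (∫⁻ _, R ^ p ∂ν) ^ (1 / p) + (∫⁻ ξ, rayTail ε g 0 ξ ^ p ∂ν) ^ (1 / p) :=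
          ENNReal.lintegral_Lp_add_le aemeasurable_const (measurable_rayTail ε g 0).aemeasurable hp1
      _ ≤ R * N + (w₂⁻¹ * c₂ * (k₂ : ℝ≥0∞) ^ p) ^ (1 / p) := by
          rw [lintegral_const, ENNReal.mul_rpow_of_nonneg _ _ hi, ← ENNReal.rpow_mul,
            mul_one_div_cancel hp.ne', ENNReal.rpow_one]
          gcongr
      _ ≤ _ := by
          rw [ENNReal.mul_rpow_of_nonneg _ _ hi, ← ENNReal.rpow_mul (k₂ : ℝ≥0∞),
            mul_one_div_cancel hp.ne', ENNReal.rpow_one]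
          gcongr
  have hmem : MemLp f (ENNReal.ofReal p) ν :=
    ⟨hfm.aestronglyMeasurable, hnorm.trans_lt (by finiteness)⟩
  have hfint : Integrable f ν := hmem.integrable (by simpa using hp1)
  have henergy : besovEnergy ε θ p (l₁ + l₂) ν f ^ (1 / p) ≤ d₃ * k₂ := by
    have h1 := besovEnergy_le_of_approx (l := l₁ + l₂) (ε := ε) (θ := θ) hp1 hfint
      (fun w => u (vertexPoint w)) (hfray.mono fun ξ h => h.2)
    have h2 : besovEnergy ε θ p (l₁ + l₂) ν f ≤
        (2 ^ (p - 1) * (1 + K) * c₂) * (k₂ : ℝ≥0∞) ^ p := by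
      refine h1.trans ?_
      rw [mul_assoc _ (c₂ : ℝ≥0∞)]
      gcongr
    calc _ ≤ ((2 ^ (p - 1) * (1 + K) * c₂) * (k₂ : ℝ≥0∞) ^ p) ^ (1 / p) := by gcongr
      _ = _ := by
        rw [ENNReal.mul_rpow_of_nonneg _ _ hi, ← ENNReal.rpow_mul (k₂ : ℝ≥0∞),
          mul_one_div_cancel hp.ne', ENNReal.rpow_one]
  refine ⟨hmem.toLp f, ?_, ?_⟩
  · filter_upwards [hfray, hmem.coeFn_toLp] with ξ h1 h2
    rw [h2]
    exact h1.1
  · rw [besovNorm, besovEnergy_congr hmem.coeFn_toLp, Lp.enorm_toLp]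
    calc _ ≤ (d₁ * (k₁ + k₂) * N + d₂ * k₂) + d₃ * k₂ := add_le_add hnorm henergy
      _ ≤ (d₁ * (k₁ + k₂) * N + d₂ * (k₁ + k₂)) + d₃ * (k₁ + k₂) := by
        gcongr <;> exact le_add_self
      _ = _ := by ring

/-! ### The extension operator -/

/-- The increment of `A` along the edge that ends at `w`. -/
noncomputable def edgeIncrement (A : List (Fin K) → ℝ) (w : List (Fin K)) : ℝ := A w - A w.dropLast

/-- The function on the tree that takes the values `A` at the vertices and is affine on the
edges. At the root the increment vanishes, since `[].dropLast = []`. -/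
noncomputable def affineExtension (A : List (Fin K) → ℝ) (x : Tree K) : ℝ :=
  A x.1.1 - (x.1.1.length - height x) * edgeIncrement A x.1.1

/-- The upper gradient of `affineExtension A`: the absolute value of the slope with respect to arc
length. -/
noncomputable def affineGradient (ε : ℝ) (A : List (Fin K) → ℝ) (x : Tree K) : ℝ≥0∞ :=
  ENNReal.ofReal (Real.exp (ε * height x)) * ‖edgeIncrement A x.1.1‖ₑ

lemma measurable_affineExtension (A : List (Fin K) → ℝ) : Measurable (affineExtension A) := by
  have h : ∀ B : List (Fin K) → ℝ, Measurable fun x : Tree K => B x.1.1 :=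
    fun B => (measurable_of_countable B).comp measurable_word
  exact (h A).sub (((h fun w => w.length).sub measurable_height).mul (h (edgeIncrement A)))

lemma measurable_affineGradient (ε : ℝ) (A : List (Fin K) → ℝ) :
    Measurable (affineGradient ε A) := by
  have h1 : Measurable fun x : Tree K => ‖edgeIncrement A x.1.1‖ₑ :=
    (measurable_of_countable fun w : List (Fin K) => ‖edgeIncrement A w‖ₑ).comp measurable_word
  have h2 : Measurable fun x : Tree K => ENNReal.ofReal (Real.exp (ε * height x)) := by
    have := measurable_height (K := K)
    fun_prop
  exact h2.mul h1

lemma affineExtension_vertexPoint (A : List (Fin K) → ℝ) (w : List (Fin K)) :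
    affineExtension A (vertexPoint w) = A w := by
  simp [affineExtension, vertexPoint, height]

lemma intervalIntegrable_take (φ : List (Fin K) → ℝ) (w : List (Fin K)) (a b : ℝ) :
    IntervalIntegrable (fun s => φ (w.take ⌈s⌉₊)) volume a b := by
  have hm : Measurable fun s : ℝ => φ (w.take ⌈s⌉₊) :=
    (measurable_of_countable fun n : ℕ => φ (w.take n)).comp Nat.measurable_ceil
  refine (intervalIntegrable_const (c := ∑ n ∈ Finset.range (w.length + 1),
    ‖φ (w.take n)‖)).mono_fun hm.aestronglyMeasurable (Eventually.of_forall fun s => ?_)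
  have h1 : w.take ⌈s⌉₊ = w.take (min ⌈s⌉₊ w.length) := by
    rcases le_total ⌈s⌉₊ w.length with h | h
    · rw [min_eq_left h]
    · rw [min_eq_right h, List.take_of_length_le h, List.take_length]
  refine le_trans ?_ (Real.le_norm_self _)
  simp only [h1]
  exact Finset.single_le_sum (f := fun n => ‖φ (w.take n)‖) (fun _ _ => norm_nonneg _)
    (Finset.mem_range.2 (Nat.lt_succ_of_le (min_le_right _ _)))

lemma integral_take_of_mem (φ : List (Fin K) → ℝ) (w : List (Fin K)) (n : ℕ) {s : ℝ}
    (h1 : (n : ℝ) ≤ s) (h2 : s ≤ ((n + 1 : ℕ) : ℝ)) :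
    ∫ r in (n : ℝ)..s, φ (w.take ⌈r⌉₊) = (s - n) * φ (w.take (n + 1)) := by
  rw [intervalIntegral.integral_of_le h1,
    setIntegral_congr_fun (g := fun _ => φ (w.take (n + 1))) measurableSet_Ioc, setIntegral_const,
    smul_eq_mul, measureReal_def, Real.volume_Ioc, ENNReal.toReal_ofReal (by linarith)]
  intro r hr
  have : ⌈r⌉₊ = n + 1 := (Nat.ceil_eq_iff (Nat.succ_ne_zero n)).2 ⟨hr.1, hr.2.trans h2⟩
  simp only [this]

lemma integral_edgeIncrement_nat (A : List (Fin K) → ℝ) (w : List (Fin K)) {n : ℕ}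
    (hn : n ≤ w.length) :
    ∫ r in (0 : ℝ)..n, edgeIncrement A (w.take ⌈r⌉₊) = A (w.take n) - A [] := by
  induction n with
  | zero => simp
  | succ n ih =>
    rw [← intervalIntegral.integral_add_adjacent_intervals
      (intervalIntegrable_take _ w 0 n) (intervalIntegrable_take _ w n _), ih (by omega),
      integral_take_of_mem _ w n (by push_cast; linarith) le_rfl, edgeIncrement,
      List.dropLast_eq_take, List.length_take, min_eq_left hn, Nat.add_sub_cancel, List.take_take,
      min_eq_left (Nat.le_succ n)]
    push_cast
    ring

/-- The affine extension is the integral of its slope along the geodesic from the root. -/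
lemma integral_edgeIncrement (A : List (Fin K) → ℝ) (y : Tree K) :
    ∫ r in (0 : ℝ)..height y, edgeIncrement A (y.1.1.take ⌈r⌉₊) = affineExtension A y - A [] := by
  rcases Nat.eq_zero_or_eq_succ_pred y.1.1.length with h0 | hn
  · have hh : height y = 0 := by
      have := height_le_length y
      rw [h0] at this
      exact le_antisymm (by simpa using this) (height_nonneg y)
    rw [List.length_eq_zero_iff] at h0
    simp [affineExtension, hh, h0]
  · obtain ⟨n, hn⟩ : ∃ n, y.1.1.length = n + 1 := ⟨_, hn⟩
    obtain ⟨h1, h2⟩ := height_mem_of_mem_edge hn (x := y) rfl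
    rw [← intervalIntegral.integral_add_adjacent_intervals
      (intervalIntegrable_take _ _ 0 n) (intervalIntegrable_take _ _ n _),
      integral_edgeIncrement_nat A _ (by omega), integral_take_of_mem _ _ n h1.le h2,
      List.take_of_length_le hn.le, affineExtension, hn, edgeIncrement, List.dropLast_eq_take, hn,
      Nat.add_sub_cancel]
    push_cast
    ring

lemma enorm_affineExtension_sub_le (A : List (Fin K) → ℝ) {m y : Tree K} (h : Anc m y) :
    ‖affineExtension A y - affineExtension A m‖ₑ ≤
      ∫⁻ s in Set.Ioc (height m) (height y), ‖edgeIncrement A (y.1.1.take ⌈s⌉₊)‖ₑ := by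
  have h1 : ∫ r in (0 : ℝ)..height m, edgeIncrement A (m.1.1.take ⌈r⌉₊) =
      ∫ r in (0 : ℝ)..height m, edgeIncrement A (y.1.1.take ⌈r⌉₊) := by
    refine intervalIntegral.integral_congr fun r hr => ?_
    rw [Set.uIcc_of_le (height_nonneg m)] at hr
    have h2 : ⌈r⌉₊ ≤ m.1.1.length := by
      rw [length_word]
      exact Nat.ceil_mono hr.2
    have h3 : m.1.1.take ⌈r⌉₊ = y.1.1.take ⌈r⌉₊ := by
      rw [List.prefix_iff_eq_take.1 h.1, List.take_take, min_eq_left h2]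
    simp only [h3]
  have h4 : affineExtension A y - affineExtension A m =
      ∫ r in height m..height y, edgeIncrement A (y.1.1.take ⌈r⌉₊) := by
    rw [← sub_sub_sub_cancel_right _ _ (A []), ← integral_edgeIncrement, ← integral_edgeIncrement,
      h1, intervalIntegral.integral_interval_sub_left (intervalIntegrable_take _ _ _ _)
        (intervalIntegrable_take _ _ _ _)]
  rw [h4, intervalIntegral.integral_of_le h.2]
  exact enorm_integral_le_lintegral_enorm _

lemma measurableSet_geodesic (y z : Tree K) : MeasurableSet (geodesic y z) := by
  obtain ⟨m, hmy, hmz, hm⟩ := exists_meet y z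
  have h1 : ∀ y : Tree K, MeasurableSet {x : Tree K | Anc x y} := fun y =>
    (measurable_word (MeasurableSet.of_discrete (s := {v : List (Fin K) | v <+: y.1.1}))).inter
      (measurableSet_le measurable_height measurable_const)
  have h2 : MeasurableSet {x : Tree K | Anc m x} :=
    (measurable_word (MeasurableSet.of_discrete (s := {v : List (Fin K) | m.1.1 <+: v}))).inter
      (measurableSet_le measurable_const measurable_height)
  have : geodesic y z = ({x | Anc x y} ∪ {x | Anc x z}) ∩ {x | Anc m x} := by
    ext x
    refine and_congr_right fun _ => ⟨fun h => h m hmy hmz, fun h w hwy hwz => ?_⟩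
    exact (hm w hwy hwz).trans h
  rw [this]
  exact ((h1 y).union (h1 z)).inter h2

lemma isUpperGradient_affineGradient (ε : ℝ) (A : List (Fin K) → ℝ) :
    IsUpperGradient ε (affineGradient ε A) (affineExtension A) := by
  refine ⟨measurable_affineGradient ε A, fun y z => ?_⟩
  obtain ⟨m, hmy, hmz, hm⟩ := exists_meet y z
  have h1 : ∫⁻ x in geodesic y z, affineGradient ε A x ∂arcLength K ε =
      ∫⁻ x in geodesic y z, ‖edgeIncrement A x.1.1‖ₑ ∂lengthMeasure K := by
    rw [arcLength, setLIntegral_withDensity_eq_setLIntegral_mul _ (measurable_arcDensity ε)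
      (measurable_affineGradient ε A) (measurableSet_geodesic y z)]
    refine lintegral_congr fun x => ?_
    rw [Pi.mul_apply, affineGradient, ← mul_assoc, ← ENNReal.ofReal_mul (Real.exp_pos _).le,
      ← Real.exp_add]
    simp
  rw [h1, ← Real.enorm_eq_ofReal_abs]
  refine le_trans ?_ (le_setLIntegral_geodesic (fun w => ‖edgeIncrement A w‖ₑ) hmy hmz hm)
  refine le_trans ?_
    (add_le_add (enorm_affineExtension_sub_le A hmy) (enorm_affineExtension_sub_le A hmz))
  rw [← sub_sub_sub_cancel_right _ _ (affineExtension A m), add_comm]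
  exact enorm_sub_le

/-- The Luxemburg norm is controlled by an `ℓ^p` sum over the vertices. -/
lemma exists_luxemburg_le (hK : 0 < K) {β C p l₁ l₂ : ℝ} (hβ : Real.log K < β)
    (hC : 0 < C) (hΦ : Admissible p l₁) (M : ℝ≥0) :
    ∃ c : ℝ≥0, ∀ (h : Tree K → ℝ≥0∞) (t : List (Fin K) → ℝ≥0∞) (k : ℝ≥0), Measurable h →
      (∀ x, h x ≤ t x.1.1) → 0 < k →
      levelSum β (l₁ + l₂) (fun w => t w ^ p) ≤ M * (k : ℝ≥0∞) ^ p →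
      luxemburg (PhiE p l₁) (weightedMeasure K β C l₂) h ≤ c * k := by
  have hp : 0 < p := zero_lt_one.trans_le hΦ.one_le
  obtain ⟨c, hc⟩ := exists_lintegral_weightedMeasure_comparable K β l₂ hC
  obtain ⟨M', hM'⟩ := exists_levelSum_PhiE_le hK l₁ l₂ hβ hp M
  set N : ℝ≥0 := max (c * M') 1 with hN
  have hN0 : N ≠ 0 := (zero_lt_one.trans_le (le_max_right _ _)).ne'
  obtain ⟨A, hA, HA⟩ := exists_PhiE_le_inv_mul hΦ N
  refine ⟨A, fun h t k hh hht hk hsum => ?_⟩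
  have hk0 : (k : ℝ≥0∞) ≠ 0 := by exact_mod_cast hk.ne'
  have hkp0 : (k : ℝ≥0∞) ^ p ≠ 0 := by simp [ENNReal.rpow_eq_zero_iff, hk0]
  have hkpt : (k : ℝ≥0∞) ^ p ≠ ⊤ := by finiteness
  have hA0 : (A : ℝ≥0∞) ≠ 0 := by exact_mod_cast hA.ne'
  have h1 : levelSum β (l₁ + l₂) (fun w => (t w / k) ^ p) ≤ M := by
    have e : ∀ w, (t w / k) ^ p = ((k : ℝ≥0∞) ^ p)⁻¹ * t w ^ p := by
      intro w
      rw [ENNReal.div_rpow_of_nonneg _ _ hp.le, div_eq_mul_inv, mul_comm]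
    simp only [e, levelSum_const_mul]
    rw [ENNReal.inv_mul_le_iff hkp0 hkpt, mul_comm]
    exact hsum
  have h2 := hM' _ h1
  have hcoe : ((A * k : ℝ≥0) : ℝ≥0∞) = A * k := by push_cast; rfl
  have hm : Measurable fun x => PhiE p l₁ (h x / ((A * k : ℝ≥0) : ℝ≥0∞)) :=
    (measurable_PhiE p l₁).comp (hh.div_const _)
  have h3 : N * levelSum β l₂ (fun w => ∫⁻ x in edge w,
      PhiE p l₁ (h x / ((A * k : ℝ≥0) : ℝ≥0∞)) ∂lengthMeasure K) ≤ M' := by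
    rw [← levelSum_const_mul]
    refine le_trans (levelSum_mono _ _ fun m v => ?_) h2
    rw [← lintegral_const_mul _ hm]
    calc _ ≤ ∫⁻ _ in edge (List.ofFn v), PhiE p l₁ (t (List.ofFn v) / k) ∂lengthMeasure K := by
          refine setLIntegral_mono' (measurableSet_edge _) fun x hx => ?_
          refine HA _ _ ?_
          rw [hcoe, ← mul_div_assoc, ENNReal.mul_div_mul_left _ _ hA0 (by simp)]
          gcongr
          have hx' : x.1.1 = List.ofFn v := hx
          rw [← hx']
          exact hht x
      _ = _ := by rw [setLIntegral_const, lengthMeasure_edge List.length_ofFn, mul_one]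
  have h4 : ∫⁻ x, PhiE p l₁ (h x / ((A * k : ℝ≥0) : ℝ≥0∞)) ∂weightedMeasure K β C l₂ ≤ 1 := by
    have hN0' : (N : ℝ≥0∞) ≠ 0 := by exact_mod_cast hN0
    refine (ENNReal.mul_le_mul_iff_right hN0' ENNReal.coe_ne_top).1 ?_
    calc _ ≤ N * (c * levelSum β l₂ (fun w => ∫⁻ x in edge w,
          PhiE p l₁ (h x / ((A * k : ℝ≥0) : ℝ≥0∞)) ∂lengthMeasure K)) :=
          mul_le_mul_right (hc _ hm).1 _
      _ = c * (N * levelSum β l₂ (fun w => ∫⁻ x in edge w,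
          PhiE p l₁ (h x / ((A * k : ℝ≥0) : ℝ≥0∞)) ∂lengthMeasure K)) := mul_left_comm _ _ _
      _ ≤ c * M' := by gcongr
      _ ≤ N * 1 := by
        rw [mul_one]
        exact_mod_cast le_max_left _ _
  rw [← hcoe]
  exact iInf_le_of_le (A * k) (iInf_le_of_le (mul_pos hA hk) (iInf_le_of_le h4 le_rfl))

lemma tsum_levelWeight_ne_top {τ : ℝ} (hτ : 0 < τ) (l : ℝ) : ∑' m, levelWeight τ l m ≠ ⊤ := by
  obtain ⟨M, hM, H⟩ := exists_rpow_le_exp l (half_pos hτ)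
  have hfin := tsum_geometric_ne_top (half_pos hτ)
  refine ne_top_of_le_ne_top (b := ENNReal.ofReal M *
    ∑' j : ℕ, ENNReal.ofReal (Real.exp (-(τ / 2) * j))) (by finiteness) ?_
  rw [← ENNReal.tsum_mul_left]
  refine ENNReal.tsum_le_tsum fun m => ?_
  rw [levelWeight, ← ENNReal.ofReal_mul hM.le]
  apply ENNReal.ofReal_le_ofReal
  have h1 := H ((m + 1 : ℕ) : ℝ) (by exact_mod_cast Nat.le_add_left 1 m)
  calc _ ≤ Real.exp (-τ * ((m + 1 : ℕ) : ℝ)) * (M * Real.exp (τ / 2 * ((m + 1 : ℕ) : ℝ))) := by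
        gcongr
    _ = M * Real.exp (-(τ / 2) * ((m + 1 : ℕ) : ℝ)) := by
        rw [mul_left_comm, ← Real.exp_add]
        ring_nf
    _ ≤ _ := by
        gcongr M * Real.exp ?_
        push_cast
        linarith

/-- The extension of a function on the boundary: at a vertex it is the average over the rays
through that vertex, and it is affine on the edges. -/
noncomputable def dyadicExtension (ν : Measure (Boundary K)) (f : Boundary K → ℝ) :
    Tree K → ℝ :=
  affineExtension fun w => ⨍ ξ in cyl w, f ξ ∂ν

/-- Boundedness of the extension. -/
lemma exists_sobolevNorm_dyadicExtension_le (hK : 0 < K) {ε β C p l₁ l₂ θ : ℝ} (hε : 0 < ε)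
    (hβ : Real.log K < β) (hC : 0 < C) (hΦ : Admissible p l₁)
    (hθ : ε * θ * p = ε * p - (β - Real.log K)) {ν : Measure (Boundary K)} [IsFiniteMeasure ν]
    (hν : IsAhlforsRegular ε (Real.log K / ε) ν) :
    ∃ c : ℝ≥0, ∀ (f : Lp ℝ (ENNReal.ofReal p) ν) (k : ℝ≥0), 0 < k →
      besovNorm ε θ p (l₁ + l₂) ν f ≤ k →
      sobolevNorm ε p l₁ (weightedMeasure K β C l₂) (dyadicExtension ν f) ≤ c * k := by
  have hp1 := hΦ.one_le
  have hp : 0 < p := zero_lt_one.trans_le hp1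
  have hp1' : 0 ≤ p - 1 := by linarith
  obtain ⟨b, hb⟩ := hν.exists_cyl_comparable hε
  set τ : ℝ := β - Real.log K with hτ
  set W := ∑' m, levelWeight τ (l₁ + l₂) m with hW
  have hWt : W ≠ ⊤ := tsum_levelWeight_ne_top (by rw [hτ]; linarith) _
  obtain ⟨c, hc⟩ := exists_luxemburg_le (l₂ := l₂) hK hβ hC hΦ
    (2 ^ (p - 1) * (b * W + b)).toNNReal
  rw [ENNReal.coe_toNNReal (by finiteness)] at hc
  refine ⟨2 * c, fun f k hk hfk => ?_⟩
  have hf : Integrable f ν := integrable_of_Lp hp1 f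
  set A : List (Fin K) → ℝ := fun w => ⨍ ξ in cyl w, f ξ ∂ν with hA
  -- on the edge that ends at `w`, the sum `‖A w‖ₑ + t w` bounds both the extension and its gradient
  set t : List (Fin K) → ℝ≥0∞ := fun w =>
    ENNReal.ofReal (Real.exp (ε * w.length)) * ‖edgeIncrement A w‖ₑ with ht
  have hfnorm : ∫⁻ ξ, ‖f ξ‖ₑ ^ p ∂ν ≤ (k : ℝ≥0∞) ^ p := by
    have h1 : ‖f‖ₑ ≤ k := le_self_add.trans hfk
    rw [Lp.enorm_def, eLpNorm_eq_lintegral_rpow_enorm_toReal (by simpa using hp)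
      ENNReal.ofReal_ne_top, ENNReal.toReal_ofReal hp.le] at h1
    calc _ = ((∫⁻ ξ, ‖f ξ‖ₑ ^ p ∂ν) ^ (1 / p)) ^ p := by
          rw [← ENNReal.rpow_mul, one_div_mul_cancel hp.ne', ENNReal.rpow_one]
      _ ≤ _ := by gcongr
  have henergy : besovEnergy ε θ p (l₁ + l₂) ν f ≤ (k : ℝ≥0∞) ^ p := by
    have h1 : besovEnergy ε θ p (l₁ + l₂) ν f ^ (1 / p) ≤ k := le_add_self.trans hfk
    calc _ = (besovEnergy ε θ p (l₁ + l₂) ν f ^ (1 / p)) ^ p := by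
          rw [← ENNReal.rpow_mul, one_div_mul_cancel hp.ne', ENNReal.rpow_one]
      _ ≤ _ := by gcongr
  have hA1 : levelSum β (l₁ + l₂) (fun w => ‖A w‖ₑ ^ p) ≤ b * W * (k : ℝ≥0∞) ^ p := by
    rw [levelSum, hW, ← ENNReal.tsum_mul_left, ← ENNReal.tsum_mul_right]
    refine ENNReal.tsum_le_tsum fun m => ?_
    rw [show β = τ + Real.log K by rw [hτ]; ring, ← levelWeight_mul_exp, mul_assoc,
      mul_comm (b : ℝ≥0∞), mul_assoc]
    refine mul_le_mul_right ?_ _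
    calc _ ≤ ∑ v : Fin (m + 1) → Fin K, b * ∫⁻ ξ in cyl (List.ofFn v), ‖f ξ‖ₑ ^ p ∂ν := by
          rw [Finset.mul_sum]
          refine Finset.sum_le_sum fun v _ => ?_
          have h1 := measure_mul_setAverage_sub_le hp1 hf 0 (cyl (List.ofFn v))
          simp only [sub_zero] at h1
          calc _ ≤ b * ν (cyl (List.ofFn v)) * ‖A (List.ofFn v)‖ₑ ^ p :=
                mul_le_mul_left (hb m v).2 _
            _ ≤ _ := by
              rw [mul_assoc]
              gcongr
      _ ≤ _ := by
          rw [← Finset.mul_sum, ← lintegral_eq_sum_cyl]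
          gcongr
  have ht1 : levelSum β (l₁ + l₂) (fun w => t w ^ p) ≤ b * (k : ℝ≥0∞) ^ p := by
    refine le_trans ?_ (mul_le_mul_right henergy _)
    rw [levelSum, besovEnergy, ← ENNReal.tsum_mul_left]
    refine ENNReal.tsum_le_tsum fun m => ?_
    have hw : ENNReal.ofReal (Real.exp (ε * ((m + 1 : ℕ) : ℝ) * θ * p) *
        ((m + 1 : ℕ) : ℝ) ^ (l₁ + l₂)) = levelWeight (-(ε * θ * p)) (l₁ + l₂) m := by
      rw [levelWeight]
      congr 3
      ring
    rw [hw, Finset.mul_sum, Finset.mul_sum, Finset.mul_sum]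
    refine Finset.sum_le_sum fun v _ => ?_
    have h5 : ENNReal.ofReal (Real.exp (ε * (((List.ofFn v).length : ℕ) : ℝ))) ^ p =
        ENNReal.ofReal (Real.exp (-(-(ε * p)) * ((m + 1 : ℕ) : ℝ))) := by
      rw [List.length_ofFn, ENNReal.ofReal_rpow_of_pos (Real.exp_pos _), ← Real.exp_mul]
      congr 2
      ring
    simp only [ht]
    rw [ENNReal.mul_rpow_of_nonneg _ _ hp.le, h5, ← mul_assoc, levelWeight_mul_exp,
      show β + -(ε * p) = -(ε * θ * p) + Real.log K by rw [hθ, hτ]; ring, ← levelWeight_mul_exp,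
      mul_left_comm, mul_assoc, ← mul_assoc (b : ℝ≥0∞)]
    refine mul_le_mul_right ?_ _
    exact mul_le_mul_left (hb m v).2 _
  have hsum : levelSum β (l₁ + l₂) (fun w => (‖A w‖ₑ + t w) ^ p) ≤
      2 ^ (p - 1) * (b * W + b) * (k : ℝ≥0∞) ^ p := by
    calc _ ≤ levelSum β (l₁ + l₂) (fun w => 2 ^ (p - 1) * (‖A w‖ₑ ^ p + t w ^ p)) :=
          levelSum_mono _ _ fun m v => ENNReal.rpow_add_le_mul_rpow_add_rpow _ _ hp1
      _ ≤ 2 ^ (p - 1) * (b * W * (k : ℝ≥0∞) ^ p + b * (k : ℝ≥0∞) ^ p) := by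
          rw [levelSum_const_mul, levelSum_add]
          gcongr
      _ = _ := by ring
  have hu : luxemburg (PhiE p l₁) (weightedMeasure K β C l₂)
      (fun x => ‖affineExtension A x‖ₑ) ≤ c * k := by
    refine hc _ _ k (measurable_affineExtension A).enorm (fun x => ?_) hk hsum
    refine enorm_sub_le.trans (add_le_add_right ?_ _)
    rw [enorm_mul]
    simp only [ht]
    gcongr
    rw [Real.enorm_eq_ofReal_abs]
    apply ENNReal.ofReal_le_ofReal
    have h1 : (0 : ℝ) ≤ x.1.1.length - height x := sub_nonneg.2 (height_le_length x)
    have h2 : (x.1.1.length : ℝ) - height x ≤ 1 := by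
      rw [length_word]
      linarith [Nat.ceil_lt_add_one (height_nonneg x)]
    rw [abs_of_nonneg h1]
    exact h2.trans (Real.one_le_exp (by positivity))
  have hg : luxemburg (PhiE p l₁) (weightedMeasure K β C l₂) (affineGradient ε A) ≤ c * k := by
    refine hc _ _ k (measurable_affineGradient ε A) (fun x => ?_) hk hsum
    refine le_trans ?_ le_add_self
    simp only [ht, affineGradient]
    gcongr
    exact height_le_length x
  rw [sobolevNorm]
  calc _ ≤ (c : ℝ≥0∞) * k + c * k := by
        refine add_le_add hu ?_
        exact iInf_le_of_le _ (iInf_le_of_le (isUpperGradient_affineGradient ε A) hg)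
    _ = _ := by push_cast; ring

/-! ### The trace space -/

lemma affineExtension_add (A B : List (Fin K) → ℝ) :
    affineExtension (A + B) = affineExtension A + affineExtension B := by
  funext x
  simp only [affineExtension, edgeIncrement, Pi.add_apply]
  ring

lemma affineExtension_smul (c : ℝ) (A : List (Fin K) → ℝ) :
    affineExtension (c • A) = c • affineExtension A := by
  funext x
  simp only [affineExtension, edgeIncrement, Pi.smul_apply, smul_eq_mul]
  ring

lemma dyadicExtension_add {ν : Measure (Boundary K)} [IsFiniteMeasure ν] {p : ℝ} (hp : 1 ≤ p)
    (f g : Lp ℝ (ENNReal.ofReal p) ν) :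
    dyadicExtension ν (f + g : Lp ℝ (ENNReal.ofReal p) ν) =
      dyadicExtension ν f + dyadicExtension ν g := by
  rw [dyadicExtension, dyadicExtension, dyadicExtension, ← affineExtension_add]
  congr 1
  funext w
  rw [Pi.add_apply, average_congr (ae_restrict_of_ae (Lp.coeFn_add f g))]
  simp only [setAverage_eq, Pi.add_apply]
  rw [integral_add (integrable_of_Lp hp f).integrableOn (integrable_of_Lp hp g).integrableOn,
    smul_add]

lemma dyadicExtension_smul {ν : Measure (Boundary K)} {p : ℝ} (c : ℝ)
    (f : Lp ℝ (ENNReal.ofReal p) ν) :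
    dyadicExtension ν (c • f : Lp ℝ (ENNReal.ofReal p) ν) = c • dyadicExtension ν f := by
  rw [dyadicExtension, dyadicExtension, ← affineExtension_smul]
  congr 1
  funext w
  rw [Pi.smul_apply, average_congr (ae_restrict_of_ae (Lp.coeFn_smul c f))]
  simp only [setAverage_eq, Pi.smul_apply, smul_eq_mul, integral_const_mul]
  ring

/-- A nonnegative quantity that is at most `c (k₁ + k₂)` for all `k₁ > a`, `k₂ > b` is at most
`c (a + b)`. -/
lemma le_mul_add_of_forall_lt {x a b : ℝ≥0∞} {c : ℝ≥0} (ha : a ≠ ⊤) (hb : b ≠ ⊤)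
    (h : ∀ k₁ k₂ : ℝ≥0, a < k₁ → b < k₂ → x ≤ c * (k₁ + k₂)) : x ≤ c * (a + b) := by
  lift a to ℝ≥0 using ha
  lift b to ℝ≥0 using hb
  have ht : Tendsto (fun δ : ℝ≥0 => c * ((a + δ) + (b + δ))) (𝓝[>] 0) (𝓝 (c * (a + b))) := by
    have : Continuous fun δ : ℝ≥0 => c * ((a + δ) + (b + δ)) := by fun_prop
    simpa using (this.tendsto 0).mono_left nhdsWithin_le_nhds
  have ht' := ENNReal.tendsto_coe.2 ht
  rw [ENNReal.coe_mul, ENNReal.coe_add] at ht'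
  refine ge_of_tendsto ht' ?_
  filter_upwards [self_mem_nhdsWithin] with δ hδ
  have hδ' : 0 < δ := hδ
  have := h (a + δ) (b + δ) (by exact_mod_cast lt_add_of_pos_right a hδ')
    (by exact_mod_cast lt_add_of_pos_right b hδ')
  exact_mod_cast this

lemma exists_lt_of_luxemburg_lt {α : Type*} [MeasurableSpace α] {φ : ℝ≥0∞ → ℝ≥0∞}
    {μ : Measure α} {h : α → ℝ≥0∞} {a : ℝ≥0∞} (ha : luxemburg φ μ h < a) :
    ∃ k : ℝ≥0, 0 < k ∧ ∫⁻ x, φ (h x / k) ∂μ ≤ 1 ∧ (k : ℝ≥0∞) < a := by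
  simp only [luxemburg, iInf_lt_iff] at ha
  obtain ⟨k, hk, hi, hlt⟩ := ha
  exact ⟨k, hk, hi, hlt⟩

/-- The relation between `θ`, `β` and `ε` says that the Besov weight `e^{εnθp}`, the mass `K^{-n}`
of a cylinder and the factor `e^{-εnp}` from `ds` multiply to the weight `e^{-βn}` of the tree. -/
theorem isTraceSpace_besovSpace (hK : 0 < K) {ε β C p l₁ l₂ θ : ℝ} (hε : 0 < ε)
    (hβ : Real.log K < β) (hC : 0 < C) (hΦ : Admissible p l₁) (hθ0 : 0 < θ)
    (hθ : ε * θ * p = ε * p - (β - Real.log K)) (ν : Measure (Boundary K)) [IsFiniteMeasure ν]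
    (hν : IsAhlforsRegular ε (Real.log K / ε) ν) :
    IsTraceSpace (besovSpace ε θ hΦ.one_le (l₁ + l₂) ν) (besovNorm ε θ p (l₁ + l₂) ν)
      (sobolevSpace ε hΦ (weightedMeasure K β C l₂))
      (sobolevNorm ε p l₁ (weightedMeasure K β C l₂)) := by
  set μ := weightedMeasure K β C l₂
  have hp1 := hΦ.one_le
  obtain ⟨c₁, hc₁⟩ := exists_trace (l₂ := l₂) hK hε hβ hC hΦ hθ0 hθ hν
  obtain ⟨c₂, hc₂⟩ := exists_sobolevNorm_dyadicExtension_le (C := C) (l₂ := l₂) hK hε hβ hC hΦ hθ hν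
  -- the trace does not depend on the upper gradient, so that the bound passes to the infimum
  have htrace : ∀ u : sobolevSpace ε hΦ μ, ∃ F : besovSpace ε θ hp1 (l₁ + l₂) ν,
      (∀ᵐ ξ ∂ν, Tendsto (fun s : ℝ≥0 => (u : Tree K → ℝ) (rayPoint ξ s)) atTop
        (𝓝 ((F : Lp ℝ (ENNReal.ofReal p) ν) ξ))) ∧
      besovNorm ε θ p (l₁ + l₂) ν F ≤ c₁ * sobolevNorm ε p l₁ μ u := by
    rintro ⟨u, hum, hu⟩
    have hu' := hu
    rw [sobolevNorm, ENNReal.add_lt_top] at hu'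
    obtain ⟨hu₁, hu₂⟩ := hu'
    have hF : ∀ k₁ k₂ : ℝ≥0, luxemburg (PhiE p l₁) μ (fun x => ‖u x‖ₑ) < k₁ →
        (⨅ (g : Tree K → ℝ≥0∞) (_ : IsUpperGradient ε g u), luxemburg (PhiE p l₁) μ g) < k₂ →
        ∃ F : Lp ℝ (ENNReal.ofReal p) ν,
          (∀ᵐ ξ ∂ν, Tendsto (fun s : ℝ≥0 => u (rayPoint ξ s)) atTop (𝓝 (F ξ))) ∧
          besovNorm ε θ p (l₁ + l₂) ν F ≤ c₁ * (k₁ + k₂) := by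
      intro k₁ k₂ h₁ h₂
      obtain ⟨k₁', hk₁, hi₁, hlt₁⟩ := exists_lt_of_luxemburg_lt h₁
      simp only [iInf_lt_iff] at h₂
      obtain ⟨g, hg, h₂⟩ := h₂
      obtain ⟨k₂', hk₂, hi₂, hlt₂⟩ := exists_lt_of_luxemburg_lt h₂
      obtain ⟨F, hF1, hF2⟩ := hc₁ u g k₁' k₂' hum hg hk₁ hk₂ hi₁ hi₂
      exact ⟨F, hF1, hF2.trans (by gcongr)⟩
    obtain ⟨k₁, hk₁, -⟩ := ENNReal.lt_iff_exists_nnreal_btwn.1 hu₁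
    obtain ⟨k₂, hk₂, -⟩ := ENNReal.lt_iff_exists_nnreal_btwn.1 hu₂
    obtain ⟨F, hF1, hF2⟩ := hF k₁ k₂ hk₁ hk₂
    refine ⟨⟨F, hF2.trans_lt (by finiteness)⟩, hF1, ?_⟩
    refine le_mul_add_of_forall_lt hu₁.ne hu₂.ne fun j₁ j₂ hj₁ hj₂ => ?_
    obtain ⟨G, hG1, hG2⟩ := hF j₁ j₂ hj₁ hj₂
    obtain rfl : F = G := by
      refine Lp.ext ?_
      filter_upwards [hF1, hG1] with ξ h1 h2
      exact tendsto_nhds_unique h1 h2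
    exact hG2
  choose T hT1 hT2 using htrace
  have hTuniq : ∀ (u : sobolevSpace ε hΦ μ) (F : besovSpace ε θ hp1 (l₁ + l₂) ν),
      (∀ᵐ ξ ∂ν, Tendsto (fun s : ℝ≥0 => (u : Tree K → ℝ) (rayPoint ξ s)) atTop
        (𝓝 ((F : Lp ℝ (ENNReal.ofReal p) ν) ξ))) → T u = F := by
    intro u F hF
    refine Subtype.ext (Lp.ext ?_)
    filter_upwards [hT1 u, hF] with ξ h1 h2
    exact tendsto_nhds_unique h1 h2
  have hEbound : ∀ f : besovSpace ε θ hp1 (l₁ + l₂) ν,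
      sobolevNorm ε p l₁ μ (dyadicExtension ν (f : Lp ℝ (ENNReal.ofReal p) ν)) ≤
        c₂ * besovNorm ε θ p (l₁ + l₂) ν f := by
    intro f
    have h := le_mul_add_of_forall_lt (a := besovNorm ε θ p (l₁ + l₂) ν f) (b := 0) (c := c₂)
      (x := sobolevNorm ε p l₁ μ (dyadicExtension ν (f : Lp ℝ (ENNReal.ofReal p) ν)))
      f.2.ne ENNReal.zero_ne_top fun k₁ k₂ h₁ _ => by
        refine (hc₂ f k₁ ?_ h₁.le).trans (mul_le_mul_right le_self_add _)
        exact_mod_cast pos_of_gt h₁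
    simpa using h
  let E : besovSpace ε θ hp1 (l₁ + l₂) ν →ₗ[ℝ] sobolevSpace ε hΦ μ :=
    { toFun := fun f => ⟨dyadicExtension ν (f : Lp ℝ (ENNReal.ofReal p) ν),
        measurable_affineExtension _,
        (hEbound f).trans_lt (ENNReal.mul_lt_top ENNReal.coe_lt_top f.2)⟩
      map_add' := fun f g => Subtype.ext (dyadicExtension_add hp1 _ _)
      map_smul' := fun c f => Subtype.ext (dyadicExtension_smul c _) }
  let T' : sobolevSpace ε hΦ μ →ₗ[ℝ] besovSpace ε θ hp1 (l₁ + l₂) ν :=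
    { toFun := T
      map_add' := fun u v => by
        refine hTuniq _ _ ?_
        filter_upwards [hT1 u, hT1 v, Lp.coeFn_add (T u : Lp ℝ (ENNReal.ofReal p) ν) (T v)]
          with ξ h1 h2 h3
        change Tendsto _ _ (𝓝 (((T u : Lp ℝ (ENNReal.ofReal p) ν) + T v :
          Lp ℝ (ENNReal.ofReal p) ν) ξ))
        rw [h3]
        exact h1.add h2
      map_smul' := fun c u => by
        refine hTuniq _ _ ?_
        filter_upwards [hT1 u, Lp.coeFn_smul c (T u : Lp ℝ (ENNReal.ofReal p) ν)] with ξ h1 h2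
        change Tendsto _ _ (𝓝 ((c • (T u : Lp ℝ (ENNReal.ofReal p) ν) :
          Lp ℝ (ENNReal.ofReal p) ν) ξ))
        rw [h2]
        exact h1.const_smul c }
  refine ⟨T', E, ⟨c₁, hT2⟩, ⟨c₂, hEbound⟩, fun f => ?_, hT1⟩
  refine Subtype.ext (Lp.ext ?_)
  -- at the vertices of the ray the extension is a cylinder average, and these converge to `f`
  filter_upwards [hT1 (E f), tendsto_average_cyl (integrable_of_Lp hp1 (f : Lp ℝ _ ν))]
    with ξ h1 h2
  have hnat : Tendsto (fun n : ℕ => (n : ℝ≥0)) atTop atTop := tendsto_natCast_atTop_atTop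
  refine tendsto_nhds_unique (h1.comp hnat) (h2.congr fun n => ?_)
  have hpt : rayPoint ξ (n : ℝ≥0) = vertexPoint (rayVertex ξ n) := by
    refine Subtype.ext (Prod.ext ?_ ?_)
    · simp [rayPoint, vertexPoint]
    · simp [rayPoint, vertexPoint, length_rayVertex]
  have hE : ((E f : Tree K → ℝ)) (rayPoint ξ (n : ℝ≥0)) =
      affineExtension (fun w => ⨍ ζ in cyl w, (f : Lp ℝ (ENNReal.ofReal p) ν) ζ ∂ν)
        (rayPoint ξ (n : ℝ≥0)) := rfl
  rw [Function.comp_apply, hE, hpt, affineExtension_vertexPoint]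

end RegularTree

theorem corollary1p3 (K : ℕ) (hK : 2 ≤ K) (ε β C p l l₁ l₂ θ : ℝ) (hε : 0 < ε)
    (hΦ : RegularTree.Admissible p l₁)
    (hpos : 0 < (β - Real.log K) / ε) (hlt : (β - Real.log K) / ε < p)
    (hC : max (2 * |l₂| / (β - Real.log K)) (2 * Real.log 4 / ε) ≤ C)
    (hθ : θ = 1 - (β - Real.log K) / (ε * p))
    (hl : l₁ + l₂ = l)
    (ν : Measure (RegularTree.Boundary K)) [IsFiniteMeasure ν]
    (hν : RegularTree.IsAhlforsRegular ε (Real.log K / ε) ν) :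
    RegularTree.IsTraceSpace
      (RegularTree.besovSpace ε θ hΦ.one_le l ν)
      (RegularTree.besovNorm ε θ p l ν)
      (RegularTree.sobolevSpace ε hΦ (RegularTree.weightedMeasure K β C l₂))
      (RegularTree.sobolevNorm ε p l₁ (RegularTree.weightedMeasure K β C l₂)) := by
  subst hl
  have hp : 0 < p := zero_lt_one.trans_le hΦ.one_le
  have hβ : Real.log K < β := by
    have := (div_pos_iff_of_pos_right hε).1 hpos
    linarith
  have hC0 : 0 < C := by
    refine lt_of_lt_of_le ?_ ((le_max_right _ _).trans hC)
    have : 0 < Real.log 4 := Real.log_pos (by norm_num)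
    positivity
  have hθ0 : 0 < θ := by
    rw [hθ, sub_pos, ← div_div, div_lt_one hp]
    exact hlt
  refine RegularTree.isTraceSpace_besovSpace (by omega) hε hβ hC0 hΦ hθ0 ?_ ν hν
  rw [hθ]
  field_simp
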